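/- Let $m\in\mathbb C$ with $\operatorname{Re} m>-1$. On $C_c^\infty(0,\infty)$ consider the differential expression $$L_{m^2}=-\partial_x^2+\Big(-\frac14+m^2\Big)\frac1{x^2}.$$ In the Hilbert space $L^2[0,\infty)$ let $L_{m^2}^{\min}$ be the closure of $L_{m^2}$ restricted to $C_c^\infty(0,\infty)$, and let $L_{m^2}^{\max}$ be the operator $L_{m^2}$ (in the sense of distributions on $(0,\infty)$) with domain $\{f\in L^2[0,\infty) : L_{m^2}f\in L^2[0,\infty)\}$. Let $\xi$ be a smooth compactly supported cutoff equal to $1$ around $0$, and let $H_m$ be the restriction of $L_{m^2}^{\max}$ to the domain $$\operatorname{Dom}L_{m^2}^{\min}+\mathbb C\,x^{\frac12+m}\xi .$$ Let $k\in\mathbb C$ with $\operatorname{Re}k>0$. Then $k^2+H_m$ has a bounded inverse on $L^2[0,\infty)$, and $(k^2+H_m)^{-1}$ is the integral operator whose kernel is $$R_m(-k^2;x,y)=\begin{cases}\sqrt{xy}\,I_m(kx)K_m(ky) & \text{if } x<y,\\ \sqrt{xy}\,I_m(ky)K_m(kx) & \text{if } x>y;\end{cases}$$ that is, for every $f\in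 L^2[0,\infty)$ and almost every $x>0$, $\big((k^2+H_m)^{-1}f\big)(x)=\int_0^\infty R_m(-k^2;x,y)f(y)\,dy$, the integral being absolutely convergent. Here $$I_m(z)=\sum_{j=0}^\infty\frac{(z/2)^{m+2j}}{j!\,\Gamma(m+j+1)}$$ (principal branch) is the modified Bessel function and $$K_m(z)=\int_0^\infty e^{-z\cosh t}\cosh(mt)\,dt\qquad(\operatorname{Re}z>0)$$ is the MacDonald function. -/

import Mathlib

open MeasureTheory Set Filter Topology
open scoped ContDiff Distributions

noncomputable section

namespace BesselOp

/-! ### The Hilbert space and the differential expression -/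

/-- Lebesgue measure on the half-line `(0, ∞)`. -/
abbrev halfMeasure : Measure ℝ := volume.restrict (Ioi 0)

/-- The Hilbert space `L²[0, ∞)` of complex-valued functions. -/
abbrev L2 : Type := Lp ℂ 2 halfMeasure

/-- The open half-line `(0, ∞)`, as an open set; `𝓓(halfLine, ℂ)` is `C_c^∞(0, ∞)`. -/
def halfLine : TopologicalSpace.Opens ℝ := ⟨Ioi 0, isOpen_Ioi⟩

/-- The differential expression `L_α φ = -φ'' + (-1/4 + α) x⁻² φ`. -/
def diffExpr (α : ℂ) (φ : ℝ → ℂ) (x : ℝ) : ℂ :=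
  -deriv (deriv φ) x + (-1 / 4 + α) / (x : ℂ) ^ 2 * φ x

section Basic

variable (φ ψ : 𝓓(halfLine, ℂ))

theorem testFunction_contDiff : ContDiff ℝ ∞ φ := φ.contDiff'

theorem testFunction_differentiable : Differentiable ℝ φ :=
  (testFunction_contDiff φ).differentiable (by simp)

theorem testFunction_contDiff_deriv : ContDiff ℝ ∞ (deriv φ) :=
  (contDiff_infty_iff_deriv.1 (testFunction_contDiff φ)).2

theorem testFunction_differentiable_deriv : Differentiable ℝ (deriv φ) :=
  (testFunction_contDiff_deriv φ).differentiable (by simp)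

theorem testFunction_eq_zero {x : ℝ} (hx : x ∉ Ioi (0 : ℝ)) : φ x = 0 :=
  image_eq_zero_of_notMem_tsupport fun h => hx (φ.tsupport_subset' h)

theorem diffExpr_add (α : ℂ) : diffExpr α (φ + ψ : 𝓓(halfLine, ℂ)) =
    diffExpr α φ + diffExpr α ψ := by
  have h1 : deriv (⇑(φ + ψ)) = deriv φ + deriv ψ := by
    ext x
    exact deriv_add (testFunction_differentiable φ x) (testFunction_differentiable ψ x)
  ext x
  have h2 : deriv (deriv φ + deriv ψ) x = deriv (deriv φ) x + deriv (deriv ψ) x :=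
    deriv_add (testFunction_differentiable_deriv φ x) (testFunction_differentiable_deriv ψ x)
  have h3 : (φ + ψ) x = φ x + ψ x := rfl
  simp only [diffExpr, h1, h2, h3, Pi.add_apply]
  ring

theorem diffExpr_smul (α c : ℂ) : diffExpr α (c • φ : 𝓓(halfLine, ℂ)) =
    c • diffExpr α φ := by
  have h1 : deriv (⇑(c • φ)) = c • deriv φ := by
    ext x
    exact deriv_const_smul c (testFunction_differentiable φ x)
  ext x
  have h2 : deriv (c • deriv φ) x = c • deriv (deriv φ) x :=
    deriv_const_smul c (testFunction_differentiable_deriv φ x)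
  have h3 : (c • φ) x = c • φ x := rfl
  simp only [diffExpr, h1, h2, h3, Pi.smul_apply, smul_eq_mul]
  ring

theorem tsupport_diffExpr (α : ℂ) : tsupport (diffExpr α φ) ⊆ tsupport φ := by
  refine closure_minimal (fun x hx => ?_) (isClosed_tsupport _)
  by_contra h
  have h1 : deriv (deriv φ) x = 0 :=
    image_eq_zero_of_notMem_tsupport fun h' => h (tsupport_deriv_subset
      (tsupport_deriv_subset h'))
  exact hx (by simp [diffExpr, h1, image_eq_zero_of_notMem_tsupport h])

theorem continuous_diffExpr (α : ℂ) : Continuous (diffExpr α φ) := by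
  rw [continuous_iff_continuousAt]
  intro x
  by_cases hx : x ∈ tsupport φ
  · have hx0 : (0 : ℝ) < x := φ.tsupport_subset' hx
    have h2 : Continuous (deriv (deriv φ)) :=
      (contDiff_infty_iff_deriv.1 (testFunction_contDiff_deriv φ)).2.continuous
    have h3 : Continuous φ := (testFunction_contDiff φ).continuous
    have h4 : (x : ℂ) ^ 2 ≠ 0 := by simpa using hx0.ne'
    have h5 : ContinuousAt (fun x : ℝ => (-1 / 4 + α) / (x : ℂ) ^ 2) x :=
      ContinuousAt.div continuousAt_const (by fun_prop) h4
    exact h2.continuousAt.neg.add (h5.mul h3.continuousAt)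
  · have h1 : x ∉ tsupport (diffExpr α φ) := fun h => hx (tsupport_diffExpr φ α h)
    exact (notMem_tsupport_iff_eventuallyEq.1 h1).continuousAt

theorem hasCompactSupport_diffExpr (α : ℂ) : HasCompactSupport (diffExpr α φ) :=
  φ.hasCompactSupport'.of_isClosed_subset (isClosed_tsupport _) (tsupport_diffExpr φ α)

theorem memLp_diffExpr (α : ℂ) : MemLp (diffExpr α φ) 2 halfMeasure :=
  (continuous_diffExpr φ α).memLp_of_hasCompactSupport (hasCompactSupport_diffExpr φ α)

theorem memLp_testFunction : MemLp φ 2 halfMeasure :=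
  (testFunction_contDiff φ).continuous.memLp_of_hasCompactSupport φ.hasCompactSupport'

theorem integrable_mul_of_memLp (f : L2) {u : ℝ → ℂ} (hu : MemLp u 2 halfMeasure) :
    Integrable (fun x => f x * u x) halfMeasure :=
  (Lp.memLp f).integrable_mul hu

end Basic

/-! ### Minimal and maximal operators -/

/-- The graph of `L_α` on `C_c^∞(0, ∞)`. -/
def coreGraph (α : ℂ) : Submodule ℂ (L2 × L2) where
  carrier := {p | ∃ φ : 𝓓(halfLine, ℂ), p.1 =ᵐ[halfMeasure] φ ∧
    p.2 =ᵐ[halfMeasure] diffExpr α φ}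
  zero_mem' := by
    refine ⟨0, Lp.coeFn_zero _ _ _, ?_⟩
    have : diffExpr α (0 : 𝓓(halfLine, ℂ)) = 0 := by
      simpa using diffExpr_smul 0 α 0
    rw [this]
    exact Lp.coeFn_zero _ _ _
  add_mem' := by
    rintro ⟨a, b⟩ ⟨c, d⟩ ⟨φ, h1, h2⟩ ⟨ψ, h3, h4⟩
    refine ⟨φ + ψ, (Lp.coeFn_add a c).trans (h1.add h3), ?_⟩
    rw [diffExpr_add]
    exact (Lp.coeFn_add b d).trans (h2.add h4)
  smul_mem' := by
    rintro c ⟨a, b⟩ ⟨φ, h1, h2⟩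
    refine ⟨c • φ, (Lp.coeFn_smul c a).trans (h1.const_smul c), ?_⟩
    rw [diffExpr_smul]
    exact (Lp.coeFn_smul c b).trans (h2.const_smul c)

/-- The graph of the maximal operator: the pairs `(f, g)` in `L²` such that `L_α f = g` in the
sense of distributions on `(0, ∞)`. -/
def maxGraph (α : ℂ) : Submodule ℂ (L2 × L2) where
  carrier := {p | ∀ φ : 𝓓(halfLine, ℂ),
    ∫ x in Ioi (0 : ℝ), p.1 x * diffExpr α φ x = ∫ x in Ioi (0 : ℝ), p.2 x * φ x}
  zero_mem' := by
    intro φ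
    have h : ∀ u : ℝ → ℂ, ∫ x in Ioi (0 : ℝ), (0 : L2) x * u x = 0 := fun u => by
      rw [integral_congr_ae (g := fun _ => 0), integral_zero]
      filter_upwards [Lp.coeFn_zero ℂ 2 halfMeasure] with x hx
      rw [hx, Pi.zero_apply, zero_mul]
    exact (h _).trans (h _).symm
  add_mem' := by
    rintro ⟨a, b⟩ ⟨c, d⟩ h1 h2 φ
    have h : ∀ (a c : L2) {u : ℝ → ℂ}, MemLp u 2 halfMeasure →
        ∫ x in Ioi (0 : ℝ), (a + c : L2) x * u x =
          (∫ x in Ioi (0 : ℝ), a x * u x) + ∫ x in Ioi (0 : ℝ), c x * u x := fun a c u hu => by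
      rw [← integral_add (integrable_mul_of_memLp a hu) (integrable_mul_of_memLp c hu)]
      refine integral_congr_ae ?_
      filter_upwards [Lp.coeFn_add a c] with x hx
      rw [hx, Pi.add_apply, add_mul]
    have e1 := h1 φ
    have e2 := h2 φ
    simp only at e1 e2
    simp only [Prod.mk_add_mk]
    rw [h a c (memLp_diffExpr φ α), h b d (memLp_testFunction φ), e1, e2]
  smul_mem' := by
    rintro c ⟨a, b⟩ h1 φ
    have h : ∀ (a : L2) (u : ℝ → ℂ), ∫ x in Ioi (0 : ℝ), (c • a : L2) x * u x =
        c * ∫ x in Ioi (0 : ℝ), a x * u x := fun a u => by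
      rw [← integral_const_mul]
      refine integral_congr_ae ?_
      filter_upwards [Lp.coeFn_smul c a] with x hx
      rw [hx, Pi.smul_apply, smul_eq_mul, mul_assoc]
    have e1 := h1 φ
    simp only at e1
    simp only [Prod.smul_mk]
    rw [h, h, e1]

/-- The maximal operator `L_α^max`. -/
def LMax (α : ℂ) : L2 →ₗ.[ℂ] L2 := (maxGraph α).toLinearPMap

/-- The minimal operator `L_α^min`: the closure of `L_α` on `C_c^∞(0, ∞)`. -/
def LMin (α : ℂ) : L2 →ₗ.[ℂ] L2 := (coreGraph α).topologicalClosure.toLinearPMap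

/-! `maxGraph α` is closed, single-valued and contains `coreGraph α`, so that the two operators
above have exactly the graphs they are built from. -/

theorem maxGraph_single_valued (α : ℂ) (p : L2 × L2) (hp : p ∈ maxGraph α) (h0 : p.1 = 0) :
    p.2 = 0 := by
  obtain ⟨f, g⟩ := p
  simp only at h0
  subst h0
  have hp' : ∀ φ : 𝓓(halfLine, ℂ), ∫ x in Ioi (0 : ℝ), g x * φ x = 0 := fun φ => by
    rw [← hp φ, integral_congr_ae (g := fun _ => 0), integral_zero]
    filter_upwards [Lp.coeFn_zero ℂ 2 halfMeasure] with x hx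
    rw [hx, Pi.zero_apply, zero_mul]
  have hloc : LocallyIntegrableOn g (Ioi (0 : ℝ)) volume := by
    rw [locallyIntegrableOn_iff (isOpen_Ioi.isLocallyClosed)]
    intro k hk hkc
    have h1 : MemLp g 2 (volume.restrict k) :=
      (Lp.memLp g).mono_measure (Measure.restrict_mono hk le_rfl)
    have : IsFiniteMeasure (volume.restrict k) :=
      ⟨by simpa using hkc.measure_lt_top⟩
    exact h1.integrable (by norm_num)
  have key := isOpen_Ioi.ae_eq_zero_of_integral_contDiff_smul_eq_zero hloc (fun u hu hc hs => by
    let φ : 𝓓(halfLine, ℂ) :=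
      { toFun := fun x => (u x : ℂ)
        contDiff' := Complex.ofRealCLM.contDiff.comp hu
        hasCompactSupport' := hc.comp_left (g := fun t : ℝ => (t : ℂ)) (by simp)
        tsupport_subset' := (tsupport_comp_subset (g := fun t : ℝ => (t : ℂ)) (by simp) u).trans hs }
    have h1 := hp' φ
    rw [← h1, setIntegral_eq_integral_of_forall_compl_eq_zero]
    · refine integral_congr_ae (Eventually.of_forall fun x => ?_)
      change u x • g x = g x * (u x : ℂ)
      rw [Complex.real_smul, mul_comm]
    · intro x hx
      rw [testFunction_eq_zero φ hx, mul_zero])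
  refine Lp.ext ?_
  have h2 : ∀ᵐ x ∂halfMeasure, g x = 0 := (ae_restrict_iff' measurableSet_Ioi).2 key
  filter_upwards [h2, Lp.coeFn_zero ℂ 2 halfMeasure] with x hx h0
  rw [hx, h0, Pi.zero_apply]

theorem isClosed_maxGraph (α : ℂ) : IsClosed (maxGraph α : Set (L2 × L2)) := by
  have hc : ∀ {u : ℝ → ℂ}, MemLp u 2 halfMeasure →
      Continuous fun f : L2 => ∫ x in Ioi (0 : ℝ), f x * u x := fun {u} hu => by
    have hv : MemLp (fun x => star (u x)) 2 halfMeasure := hu.star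
    have : (fun f : L2 => ∫ x in Ioi (0 : ℝ), f x * u x) =
        fun f : L2 => inner ℂ (hv.toLp _) f := by
      ext f
      rw [L2.inner_def]
      refine integral_congr_ae ?_
      filter_upwards [hv.coeFn_toLp] with x hx
      rw [hx]
      simp
    rw [this]
    fun_prop
  have : (maxGraph α : Set (L2 × L2)) = ⋂ φ : 𝓓(halfLine, ℂ), {p : L2 × L2 |
      ∫ x in Ioi (0 : ℝ), p.1 x * diffExpr α φ x = ∫ x in Ioi (0 : ℝ), p.2 x * φ x} := by
    ext p
    simp only [mem_iInter]
    rfl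
  rw [this]
  exact isClosed_iInter fun φ => isClosed_eq ((hc (memLp_diffExpr φ α)).comp continuous_fst)
    ((hc (memLp_testFunction φ)).comp continuous_snd)

theorem coreGraph_le_maxGraph (α : ℂ) : coreGraph α ≤ maxGraph α := by
  rintro ⟨f, g⟩ ⟨φ, h1, h2⟩ ψ
  simp only at h1 h2 ⊢
  have e1 : ∫ x in Ioi (0 : ℝ), f x * diffExpr α ψ x = ∫ x : ℝ, φ x * diffExpr α ψ x := by
    rw [← setIntegral_eq_integral_of_forall_compl_eq_zero (s := Ioi (0 : ℝ))
      (f := fun x => φ x * diffExpr α ψ x)]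
    · refine integral_congr_ae ?_
      filter_upwards [h1] with x hx
      rw [hx]
    · intro x hx
      rw [testFunction_eq_zero φ hx, zero_mul]
  have e2 : ∫ x in Ioi (0 : ℝ), g x * ψ x = ∫ x : ℝ, diffExpr α φ x * ψ x := by
    rw [← setIntegral_eq_integral_of_forall_compl_eq_zero (s := Ioi (0 : ℝ))
      (f := fun x => diffExpr α φ x * ψ x)]
    · refine integral_congr_ae ?_
      filter_upwards [h2] with x hx
      rw [hx]
    · intro x hx
      rw [testFunction_eq_zero ψ hx, mul_zero]
  rw [e1, e2]
  have hφ := testFunction_differentiable φ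
  have hψ := testFunction_differentiable ψ
  have hφ' := testFunction_differentiable_deriv φ
  have hψ' := testFunction_differentiable_deriv ψ
  have cφ2 : Continuous (deriv (deriv φ)) :=
    (contDiff_infty_iff_deriv.1 (testFunction_contDiff_deriv φ)).2.continuous
  have cψ2 : Continuous (deriv (deriv ψ)) :=
    (contDiff_infty_iff_deriv.1 (testFunction_contDiff_deriv ψ)).2.continuous
  have sφ : HasCompactSupport φ := φ.hasCompactSupport'
  have sψ : HasCompactSupport ψ := ψ.hasCompactSupport'
  have i1 : Integrable (⇑φ * deriv (deriv ψ)) :=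
    (hφ.continuous.mul cψ2).integrable_of_hasCompactSupport sφ.mul_right
  have i2 : Integrable (deriv φ * deriv ψ) :=
    (hφ'.continuous.mul hψ'.continuous).integrable_of_hasCompactSupport sψ.deriv.mul_left
  have i3 : Integrable (⇑φ * deriv ψ) :=
    (hφ.continuous.mul hψ'.continuous).integrable_of_hasCompactSupport sφ.mul_right
  have i4 : Integrable (deriv (deriv φ) * ⇑ψ) :=
    (cφ2.mul hψ.continuous).integrable_of_hasCompactSupport sψ.mul_left
  have i5 : Integrable (deriv φ * ⇑ψ) :=
    (hφ'.continuous.mul hψ.continuous).integrable_of_hasCompactSupport sψ.mul_left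
  have p1 := integral_mul_deriv_eq_deriv_mul_of_integrable
    (fun x _ => (hφ x).hasDerivAt) (fun x _ => (hψ' x).hasDerivAt) i1 i2 i3
  have p2 := integral_mul_deriv_eq_deriv_mul_of_integrable
    (fun x _ => (hφ' x).hasDerivAt) (fun x _ => (hψ x).hasDerivAt) i2 i4 i5
  have q : ∫ x, φ x * deriv (deriv ψ) x = ∫ x, deriv (deriv φ) x * ψ x := by
    rw [p1, p2, neg_neg]
  have j1 : Integrable (fun x => φ x * diffExpr α ψ x) :=
    (hφ.continuous.mul (continuous_diffExpr ψ α)).integrable_of_hasCompactSupport sφ.mul_right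
  have j2 : Integrable (fun x => diffExpr α φ x * ψ x) :=
    ((continuous_diffExpr φ α).mul hψ.continuous).integrable_of_hasCompactSupport sψ.mul_left
  rw [← sub_eq_zero, ← integral_sub j1 j2]
  have : (fun x => φ x * diffExpr α ψ x - diffExpr α φ x * ψ x) =
      fun x => deriv (deriv φ) x * ψ x - φ x * deriv (deriv ψ) x := by
    ext x
    simp only [diffExpr]
    ring
  rw [this]
  exact (integral_sub i4 i1).trans (sub_eq_zero.2 q.symm)

theorem closure_coreGraph_le_maxGraph (α : ℂ) :
    (coreGraph α).topologicalClosure ≤ maxGraph α :=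
  Submodule.topologicalClosure_minimal _ (coreGraph_le_maxGraph α) (isClosed_maxGraph α)

theorem LMax_graph (α : ℂ) : (LMax α).graph = maxGraph α :=
  Submodule.toLinearPMap_graph_eq _ (maxGraph_single_valued α)

theorem LMin_graph (α : ℂ) : (LMin α).graph = (coreGraph α).topologicalClosure :=
  Submodule.toLinearPMap_graph_eq _ fun p hp =>
    maxGraph_single_valued α p (closure_coreGraph_le_maxGraph α hp)

/-! ### The homogeneous operators `H_m` -/

/-- A smooth compactly supported cutoff on `[0, ∞)` that equals `1` around `0`. -/
def IsCutoff (ξ : ℝ → ℝ) : Prop :=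
  ContDiff ℝ ∞ ξ ∧ HasCompactSupport ξ ∧ ∀ᶠ x in 𝓝 0, ξ x = 1

/-- The line `ℂ x^{1/2+m} ξ` in `L²`. -/
def boundaryLine (m : ℂ) (ξ : ℝ → ℝ) : Submodule ℂ L2 :=
  Submodule.span ℂ {u : L2 | u =ᵐ[halfMeasure] fun x => (x : ℂ) ^ (1 / 2 + m) * (ξ x : ℂ)}

/-- The operator `H_m`: the restriction of `L_{m²}^max` to `Dom L_{m²}^min + ℂ x^{1/2+m} ξ`. -/
def H (m : ℂ) (ξ : ℝ → ℝ) : L2 →ₗ.[ℂ] L2 :=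
  (LMax (m ^ 2)).domRestrict ((LMin (m ^ 2)).domain ⊔ boundaryLine m ξ)

/-! ### Modified Bessel functions -/

/-- The modified Bessel function `I_m(z) = ∑ⱼ (z/2)^{m+2j} / (j! Γ(m+j+1))` (principal branch of
the power; `1/Γ` vanishes at the poles of `Γ`, in agreement with Mathlib's conventions). -/
def besselI (m z : ℂ) : ℂ :=
  ∑' j : ℕ, (z / 2) ^ m * (z / 2) ^ (2 * j) / ((Nat.factorial j : ℂ) * Complex.Gamma (m + j + 1))

/-- The MacDonald function `K_m(z) = ∫₀^∞ e^{-z cosh t} cosh(m t) dt`, for `Re z > 0`. -/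
def besselK (m z : ℂ) : ℂ :=
  ∫ t in Ioi (0 : ℝ), Complex.exp (-z * (Real.cosh t : ℂ)) * Complex.cosh (m * t)

/-! ### Resolvents and integral kernels -/

/-- `R` is the bounded operator `(c + A)⁻¹`, i.e. a bounded two-sided inverse of
`c + A : Dom A → E`. -/
def IsBoundedInverse {E : Type*} [NormedAddCommGroup E] [NormedSpace ℂ E]
    (A : E →ₗ.[ℂ] E) (c : ℂ) (R : E →L[ℂ] E) : Prop :=
  (∀ u : A.domain, R (c • (u : E) + A u) = u) ∧
    ∀ f : E, ∃ u : A.domain, (u : E) = R f ∧ c • (u : E) + A u = f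

/-- The bounded operator `R` on `L²[0, ∞)` has the integral kernel `G`: for each `f` in `L²`,
`(R f)(x) = ∫₀^∞ G(x, y) f(y) dy` for almost every `x`, with absolutely convergent integrals. -/
def HasIntegralKernel (R : L2 →L[ℂ] L2) (G : ℝ → ℝ → ℂ) : Prop :=
  AEStronglyMeasurable (Function.uncurry G) (halfMeasure.prod halfMeasure) ∧
    ∀ f : L2, ∀ᵐ x ∂halfMeasure,
      Integrable (fun y => G x y * f y) halfMeasure ∧ R f x = ∫ y in Ioi (0 : ℝ), G x y * f y

/-- The kernel `√(xy) I_m(kx) K_m(ky)` for `x < y`, `√(xy) I_m(ky) K_m(kx)` for `x > y`. (Its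
values on the diagonal, a null set, play no role.) -/
def resolventKernel (m k : ℂ) (x y : ℝ) : ℂ :=
  if x < y then (Real.sqrt (x * y) : ℂ) * besselI m (k * x) * besselK m (k * y)
  else (Real.sqrt (x * y) : ℂ) * besselI m (k * y) * besselK m (k * x)

end BesselOp

end

/-!
Put `w(x) = √x I_m(kx)` and `v(x) = √x K_m(kx)`. Both solve `L_{m²} u = -k² u`, their Wronskian is
constant, `w` has the boundary behaviour `x^{1/2+m}` at `0`, and `v` decays exponentially at `∞`,
so variation of parameters produces the kernel `R_m(-k²; x, y)`. It is dominated by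
`exp (-c |x - y|)` times powers at the origin, and a Schur test with power weights makes it a
bounded operator `R` on `L²`.

Green's formula, with the boundary terms at `0` removed by the condition defining `Dom H_m`, shows
that `R` is a left inverse of `k² + H_m` on its graph. Since that graph is closed, the range of
`k² + H_m` is closed. A vector orthogonal to it is, after conjugation, a square-integrable weak
solution of the homogeneous equation, hence equal to `a w + b v`. Square-integrability at `∞`
forces `a = 0`, and orthogonality to the image of `x^{1/2+m} ξ` forces `b = 0`, because the
Wronskian of `v` and `x^{1/2+m}` does not vanish at `0`. So the range is everything.
-/

noncomputable section

namespace BesselOp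

/-! ### The Bessel series -/

theorem hasDerivAt_tsum_mul_pow {a : ℕ → ℂ} (ha : ∀ r : ℝ, Summable fun n => ‖a n‖ * r ^ n)
    (z : ℂ) :
    HasDerivAt (fun w => ∑' n, a n * w ^ n)
      (∑' n, ((n + 1 : ℕ) : ℂ) * a (n + 1) * z ^ n) z := by
  have hz : z ∈ Metric.ball (0 : ℂ) (‖z‖ + 1) := by simp
  have hdiff : ∀ n, DifferentiableOn ℂ (fun w : ℂ => a n * w ^ n) (Metric.ball 0 (‖z‖ + 1)) :=
    fun n => by fun_prop
  have hle : ∀ n, ∀ w ∈ Metric.ball (0 : ℂ) (‖z‖ + 1), ‖a n * w ^ n‖ ≤ ‖a n‖ * (‖z‖ + 1) ^ n :=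
    fun n w hw => by
      rw [norm_mul, norm_pow]
      gcongr
      exact (mem_ball_zero_iff.1 hw).le
  have hsum := Complex.hasSum_deriv_of_summable_norm (ha (‖z‖ + 1)) hdiff Metric.isOpen_ball hle hz
  have hderiv := ((Complex.differentiableOn_tsum_of_summable_norm (ha (‖z‖ + 1)) hdiff
    Metric.isOpen_ball hle).differentiableAt (Metric.isOpen_ball.mem_nhds hz)).hasDerivAt
  rw [← hsum.tsum_eq, hsum.summable.tsum_eq_zero_add] at hderiv
  simpa [mul_comm, mul_assoc, mul_left_comm] using hderiv

/-- The coefficients `1 / (n! Γ(c + n))` of the series of `hyp01`. -/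
def hyp01Coeff (c : ℂ) (n : ℕ) : ℂ := Complex.regularizedHGFunCoeff 0 {c} n

/-- The entire function `₀F₁(; c; s) / Γ(c) = ∑ₙ sⁿ / (n! Γ(c + n))`, regularized so that it is
entire in `c` too. It is the entire factor of the Bessel function `I_{c-1}`. -/
def hyp01 (c s : ℂ) : ℂ := ∑' n : ℕ, hyp01Coeff c n * s ^ n

theorem hyp01Coeff_eq (c : ℂ) (n : ℕ) :
    hyp01Coeff c n = ((n.factorial : ℂ) * Complex.Gamma (c + n))⁻¹ := by
  simp [hyp01Coeff, Complex.regularizedHGFunCoeff]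

theorem summable_norm_hyp01Coeff (c : ℂ) (r : ℝ) : Summable fun n => ‖hyp01Coeff c n‖ * r ^ n := by
  have hrad := Complex.radius_regularizedHGFunSeries_eq_top (a := 0) (b := {c}) (by simp)
  have h := (Complex.regularizedHGFunSeries 0 {c}).summable_norm_mul_pow (r := ‖r‖₊)
    (by simp [hrad])
  simp only [FormalMultilinearSeries.norm_apply_eq_norm_coef,
    Complex.regularizedHGFunSeries_coeff] at h
  exact Summable.of_norm (by simpa [hyp01Coeff] using h)

theorem summable_hyp01Coeff (c s : ℂ) : Summable fun n => hyp01Coeff c n * s ^ n :=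
  Summable.of_norm (by simpa using summable_norm_hyp01Coeff c ‖s‖)

theorem succ_mul_hyp01Coeff_succ (c : ℂ) (n : ℕ) :
    ((n + 1 : ℕ) : ℂ) * hyp01Coeff c (n + 1) = hyp01Coeff (c + 1) n := by
  have hn : ((n + 1 : ℕ) : ℂ) ≠ 0 := by exact_mod_cast n.succ_ne_zero
  rw [hyp01Coeff_eq, hyp01Coeff_eq, Nat.factorial_succ, Nat.cast_mul, mul_assoc, mul_inv,
    mul_inv_cancel_left₀ hn]
  push_cast
  ring_nf

theorem hyp01Coeff_eq_mul_hyp01Coeff_add_one (c : ℂ) (n : ℕ) :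
    hyp01Coeff c n = (c + n) * hyp01Coeff (c + 1) n := by
  have hΓ := Complex.one_div_Gamma_eq_self_mul_one_div_Gamma_add_one (c + n)
  rw [hyp01Coeff_eq, hyp01Coeff_eq, mul_inv, mul_inv, hΓ, add_right_comm c 1]
  ring

theorem hasDerivAt_hyp01 (c s : ℂ) : HasDerivAt (hyp01 c) (hyp01 (c + 1) s) s := by
  have h := hasDerivAt_tsum_mul_pow (summable_norm_hyp01Coeff c) s
  simp only [succ_mul_hyp01Coeff_succ] at h
  exact h

theorem continuous_hyp01 (c : ℂ) : Continuous (hyp01 c) :=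
  continuous_iff_continuousAt.2 fun s => (hasDerivAt_hyp01 c s).continuousAt

theorem hyp01_zero (c : ℂ) : hyp01 c 0 = (Complex.Gamma c)⁻¹ := by
  rw [hyp01, tsum_eq_single 0 fun n hn => by simp [hn]]
  simp [hyp01Coeff_eq]

theorem hyp01_eq_mul_add_mul (c s : ℂ) :
    hyp01 c s = c * hyp01 (c + 1) s + s * hyp01 (c + 2) s := by
  have hshift : HasSum (fun n : ℕ => (n : ℂ) * hyp01Coeff (c + 1) n * s ^ n)
      (s * hyp01 (c + 2) s) := by
    rw [← hasSum_nat_add_iff' 1]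
    have h := (summable_hyp01Coeff (c + 1 + 1) s).hasSum.mul_left s
    simp only [← succ_mul_hyp01Coeff_succ (c + 1)] at h
    rw [show c + 2 = c + 1 + 1 by ring]
    simpa [hyp01, ← succ_mul_hyp01Coeff_succ (c + 1), pow_succ, mul_comm, mul_assoc,
      mul_left_comm] using h
  have hmul := (summable_hyp01Coeff (c + 1) s).hasSum.mul_left c
  refine HasSum.tsum_eq ((hmul.add hshift).congr_fun fun n => ?_)
  rw [hyp01Coeff_eq_mul_hyp01Coeff_add_one]
  ring

theorem besselI_eq_cpow_mul_hyp01 (m z : ℂ) :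
    besselI m z = (z / 2) ^ m * hyp01 (m + 1) (z ^ 2 / 4) := by
  rw [besselI, hyp01, ← tsum_mul_left]
  refine tsum_congr fun j => ?_
  rw [hyp01Coeff_eq, pow_mul, div_pow, add_right_comm]
  ring

section Derivative

variable {z : ℂ}

theorem hasDerivAt_besselI (m : ℂ) (hz : 0 < z.re) :
    HasDerivAt (besselI m) (besselI (m + 1) z + m / z * besselI m z) z := by
  have hz2 : z / 2 ≠ 0 := div_ne_zero (Complex.ne_zero_of_re_pos hz) two_ne_zero
  have hslit : z / 2 ∈ Complex.slitPlane := Or.inl (by simpa using hz)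
  have hpow : HasDerivAt (fun z : ℂ => (z / 2) ^ m) (m * (z / 2) ^ (m - 1) * (1 / 2)) z :=
    ((hasDerivAt_id z).div_const 2).cpow_const hslit
  have hhyp : HasDerivAt (fun z : ℂ => hyp01 (m + 1) (z ^ 2 / 4))
      (hyp01 (m + 1 + 1) (z ^ 2 / 4) * (2 * z / 4)) z :=
    (hasDerivAt_hyp01 _ _).comp z (by simpa using (hasDerivAt_pow 2 z).div_const 4)
  rw [funext (besselI_eq_cpow_mul_hyp01 m)]
  refine (hpow.mul hhyp).congr_deriv ?_
  rw [besselI_eq_cpow_mul_hyp01, Complex.cpow_add _ _ hz2, Complex.cpow_sub _ _ hz2,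
    Complex.cpow_one]
  field_simp
  ring

theorem besselI_sub_one (m : ℂ) (hz : 0 < z.re) :
    besselI (m - 1) z = besselI (m + 1) z + 2 * m / z * besselI m z := by
  have hz0 := Complex.ne_zero_of_re_pos hz
  have hz2 : z / 2 ≠ 0 := div_ne_zero hz0 two_ne_zero
  simp only [besselI_eq_cpow_mul_hyp01]
  rw [sub_add_cancel, hyp01_eq_mul_add_mul m, Complex.cpow_add _ _ hz2, Complex.cpow_sub _ _ hz2,
    Complex.cpow_one, show m + 1 + 1 = m + 2 by ring]
  field_simp
  ring

theorem hasDerivAt_besselI' (m : ℂ) (hz : 0 < z.re) :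
    HasDerivAt (besselI m) (besselI (m - 1) z - m / z * besselI m z) z :=
  (hasDerivAt_besselI m hz).congr_deriv (by rw [besselI_sub_one m hz]; ring)

end Derivative

theorem ofReal_div_two_cpow (m : ℂ) {x : ℝ} (hx : 0 < x) :
    ((x : ℂ) / 2) ^ m = (x : ℂ) ^ m * (1 / 2 : ℂ) ^ m := by
  have h := Complex.mul_cpow_ofReal_nonneg hx.le (by norm_num : (0 : ℝ) ≤ 1 / 2) m
  push_cast at h
  rw [← h, mul_one_div]

theorem tendsto_cpow_neg_mul_besselI (m : ℂ) :
    Tendsto (fun x : ℝ => (x : ℂ) ^ (-m) * besselI m x) (𝓝[>] 0)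
      (𝓝 ((1 / 2 : ℂ) ^ m * (Complex.Gamma (m + 1))⁻¹)) := by
  have hhyp : Continuous fun x : ℝ => hyp01 (m + 1) ((x : ℂ) ^ 2 / 4) :=
    (continuous_hyp01 _).comp (by fun_prop)
  have hlim := ((hhyp.tendsto 0).mono_left (nhdsWithin_le_nhds (s := Ioi 0))).const_mul
    ((1 / 2 : ℂ) ^ m)
  simp only [Complex.ofReal_zero, zero_pow two_ne_zero, zero_div, hyp01_zero] at hlim
  refine hlim.congr' ?_
  filter_upwards [self_mem_nhdsWithin] with x hx
  have hx0 : (x : ℂ) ≠ 0 := by exact_mod_cast (mem_Ioi.1 hx).ne'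
  have hpow : (x : ℂ) ^ (-m) * (x : ℂ) ^ m = 1 := by rw [← Complex.cpow_add _ _ hx0]; simp
  rw [besselI_eq_cpow_mul_hyp01, ofReal_div_two_cpow m hx]
  linear_combination -(1 / 2 : ℂ) ^ m * hyp01 (m + 1) ((x : ℂ) ^ 2 / 4) * hpow

/-! ### Laplace integrals against `e^{-z cosh t}` -/

/-- Continuous functions of at most exponential growth on `[0, ∞)`, the class of amplitudes of
`coshLaplace`. -/
def IsExpBounded (g : ℝ → ℂ) : Prop :=
  Continuous g ∧ ∃ C b : ℝ, ∀ t, 0 ≤ t → ‖g t‖ ≤ C * Real.exp (b * t)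

/-- The integral `∫₀^∞ e^{-z cosh t} g(t) dt`, which is `K_m(z)` for the amplitude
`g(t) = cosh(mt)`. -/
def coshLaplace (g : ℝ → ℂ) (z : ℂ) : ℂ :=
  ∫ t in Ioi (0 : ℝ), Complex.exp (-z * (Real.cosh t : ℂ)) * g t

theorem norm_complex_cosh_le (z : ℂ) : ‖Complex.cosh z‖ ≤ Real.cosh z.re := by
  rw [Complex.cosh, Real.cosh_eq, norm_div, Complex.norm_ofNat]
  gcongr
  exact (norm_add_le _ _).trans_eq (by simp [Complex.norm_exp])

theorem norm_complex_sinh_le (z : ℂ) : ‖Complex.sinh z‖ ≤ Real.cosh z.re := by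
  rw [Complex.sinh, Real.cosh_eq, norm_div, Complex.norm_ofNat]
  gcongr
  exact (norm_sub_le _ _).trans_eq (by simp [Complex.norm_exp])

theorem cosh_le_exp_abs (x : ℝ) : Real.cosh x ≤ Real.exp |x| := by
  rw [← Real.cosh_abs, ← Real.cosh_add_sinh |x|]
  linarith [Real.sinh_nonneg_iff.2 (abs_nonneg x)]

theorem cosh_re_mul_ofReal_le (ν : ℂ) {t : ℝ} (ht : 0 ≤ t) :
    Real.cosh (ν * t).re ≤ Real.exp (|ν.re| * t) := by
  simpa [abs_mul, abs_of_nonneg ht] using cosh_le_exp_abs (ν.re * t)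

theorem IsExpBounded.mul {g h : ℝ → ℂ} (hg : IsExpBounded g) (hh : IsExpBounded h) :
    IsExpBounded fun t => g t * h t := by
  obtain ⟨gc, C, b, hC⟩ := hg
  obtain ⟨hc, D, d, hD⟩ := hh
  refine ⟨gc.mul hc, C * D, b + d, fun t ht => ?_⟩
  calc ‖g t * h t‖ ≤ (C * Real.exp (b * t)) * (D * Real.exp (d * t)) :=
        norm_mul_le_of_le (hC t ht) (hD t ht)
    _ = C * D * Real.exp ((b + d) * t) := by rw [add_mul, Real.exp_add]; ring

theorem isExpBounded_const (c : ℂ) : IsExpBounded fun _ => c :=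
  ⟨continuous_const, ‖c‖, 0, fun t _ => by simp⟩

theorem isExpBounded_exp (ν : ℂ) : IsExpBounded fun t => Complex.exp (ν * t) :=
  ⟨by fun_prop, 1, ν.re, fun t _ => by simp [Complex.norm_exp]⟩

theorem isExpBounded_cosh (ν : ℂ) : IsExpBounded fun t => Complex.cosh (ν * t) :=
  ⟨by fun_prop, 1, |ν.re|, fun t ht => by
    simpa using (norm_complex_cosh_le _).trans (cosh_re_mul_ofReal_le ν ht)⟩

theorem isExpBounded_sinh (ν : ℂ) : IsExpBounded fun t => Complex.sinh (ν * t) :=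
  ⟨by fun_prop, 1, |ν.re|, fun t ht => by
    simpa using (norm_complex_sinh_le _).trans (cosh_re_mul_ofReal_le ν ht)⟩

theorem isExpBounded_ofReal_cosh : IsExpBounded fun t => (Real.cosh t : ℂ) := by
  simpa using isExpBounded_cosh 1

theorem isExpBounded_ofReal_sinh : IsExpBounded fun t => (Real.sinh t : ℂ) := by
  simpa using isExpBounded_sinh 1

theorem one_add_sq_div_two_le_cosh (t : ℝ) : 1 + t ^ 2 / 2 ≤ Real.cosh t := by
  have hsinh : |t / 2| ≤ |Real.sinh (t / 2)| := by
    rw [Real.abs_sinh]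
    exact Real.self_le_sinh_iff.2 (abs_nonneg _)
  have hdouble := Real.cosh_two_mul (t / 2)
  rw [mul_div_cancel₀ t two_ne_zero, Real.cosh_sq (t / 2)] at hdouble
  linarith [sq_le_sq.2 hsinh]

theorem neg_mul_cosh_add_mul_le {x : ℝ} (hx : 0 < x) (b t : ℝ) :
    -x * Real.cosh t + b * t ≤ -x + b ^ 2 / x - x / 4 * t ^ 2 := by
  have hcosh := mul_le_mul_of_nonneg_left (one_add_sq_div_two_le_cosh t) hx.le
  have hsq : x / 4 * t ^ 2 + b ^ 2 / x - b * t = (x * t / 2 - b) ^ 2 / x := by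
    field_simp
    ring
  have hnonneg : 0 ≤ (x * t / 2 - b) ^ 2 / x := by positivity
  linarith

theorem norm_exp_neg_mul_cosh (z : ℂ) (t : ℝ) :
    ‖Complex.exp (-z * (Real.cosh t : ℂ))‖ = Real.exp (-z.re * Real.cosh t) := by
  rw [Complex.norm_exp, Complex.re_mul_ofReal, Complex.neg_re]

section CoshLaplace

variable {g : ℝ → ℂ}

theorem IsExpBounded.exists_norm_exp_neg_mul_cosh_mul_le (hg : IsExpBounded g) {x : ℝ}
    (hx : 0 < x) :
    ∃ C : ℝ, ∀ z : ℂ, x ≤ z.re → ∀ t : ℝ, 0 ≤ t →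
      ‖Complex.exp (-z * (Real.cosh t : ℂ)) * g t‖ ≤ C * Real.exp (-t) := by
  obtain ⟨-, C, b, hC⟩ := hg
  have hC0 : 0 ≤ C := by simpa using (norm_nonneg _).trans (hC 0 le_rfl)
  refine ⟨C * Real.exp ((b + 1) ^ 2 / x), fun z hz t ht => ?_⟩
  have hexp : -x * Real.cosh t + b * t ≤ (b + 1) ^ 2 / x - t := by
    have := neg_mul_cosh_add_mul_le hx (b + 1) t
    nlinarith [mul_nonneg hx.le (sq_nonneg t)]
  rw [norm_mul, norm_exp_neg_mul_cosh]
  calc Real.exp (-z.re * Real.cosh t) * ‖g t‖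
      ≤ Real.exp (-x * Real.cosh t) * (C * Real.exp (b * t)) := by
        gcongr
        exact hC t ht
    _ = C * Real.exp (-x * Real.cosh t + b * t) := by rw [Real.exp_add]; ring
    _ ≤ C * Real.exp ((b + 1) ^ 2 / x - t) := by gcongr
    _ = C * Real.exp ((b + 1) ^ 2 / x) * Real.exp (-t) := by rw [sub_eq_add_neg, Real.exp_add]; ring

theorem IsExpBounded.continuous_exp_neg_mul_cosh_mul (hg : IsExpBounded g) (z : ℂ) :
    Continuous fun t : ℝ => Complex.exp (-z * (Real.cosh t : ℂ)) * g t := by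
  have := hg.1
  have := Real.continuous_cosh
  fun_prop

theorem IsExpBounded.integrableOn_exp_neg_mul_cosh_mul (hg : IsExpBounded g) {z : ℂ}
    (hz : 0 < z.re) :
    IntegrableOn (fun t : ℝ => Complex.exp (-z * (Real.cosh t : ℂ)) * g t) (Ioi 0) := by
  obtain ⟨C, hC⟩ := hg.exists_norm_exp_neg_mul_cosh_mul_le hz
  refine ((integrableOn_exp_neg_Ioi 0).const_mul C).mono'
    (hg.continuous_exp_neg_mul_cosh_mul z).aestronglyMeasurable ?_
  filter_upwards [ae_restrict_mem measurableSet_Ioi] with t ht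
  exact hC z le_rfl t (mem_Ioi.1 ht).le

theorem coshLaplace_add {h : ℝ → ℂ} (hg : IsExpBounded g) (hh : IsExpBounded h) {z : ℂ}
    (hz : 0 < z.re) :
    coshLaplace (fun t => g t + h t) z = coshLaplace g z + coshLaplace h z := by
  simp only [coshLaplace, mul_add]
  exact integral_add (hg.integrableOn_exp_neg_mul_cosh_mul hz)
    (hh.integrableOn_exp_neg_mul_cosh_mul hz)

theorem coshLaplace_const_mul (c : ℂ) (g : ℝ → ℂ) (z : ℂ) :
    coshLaplace (fun t => c * g t) z = c * coshLaplace g z := by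
  simp only [coshLaplace, mul_left_comm _ c]
  exact integral_const_mul _ _

theorem hasDerivAt_coshLaplace (hg : IsExpBounded g) {z : ℂ} (hz : 0 < z.re) :
    HasDerivAt (coshLaplace g) (-coshLaplace (fun t => (Real.cosh t : ℂ) * g t) z) z := by
  have hcg := isExpBounded_ofReal_cosh.mul hg
  obtain ⟨C, hC⟩ := hcg.exists_norm_exp_neg_mul_cosh_mul_le (half_pos hz)
  have hs : {w : ℂ | z.re / 2 < w.re} ∈ 𝓝 z :=
    (isOpen_lt continuous_const Complex.continuous_re).mem_nhds (half_lt_self hz)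
  rw [coshLaplace, ← integral_neg]
  refine (hasDerivAt_integral_of_dominated_loc_of_deriv_le (μ := volume.restrict (Ioi (0 : ℝ)))
    (F := fun z t => Complex.exp (-z * (Real.cosh t : ℂ)) * g t)
    (F' := fun z t => -(Complex.exp (-z * (Real.cosh t : ℂ)) * ((Real.cosh t : ℂ) * g t)))
    (bound := fun t => C * Real.exp (-t)) hs
    (Eventually.of_forall fun w => (hg.continuous_exp_neg_mul_cosh_mul w).aestronglyMeasurable)
    (hg.integrableOn_exp_neg_mul_cosh_mul hz)
    (hcg.continuous_exp_neg_mul_cosh_mul z).neg.aestronglyMeasurable ?_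
    ((integrableOn_exp_neg_Ioi 0).const_mul C) ?_).2
  · filter_upwards [ae_restrict_mem measurableSet_Ioi] with t ht w hw
    rw [norm_neg]
    exact hC w (le_of_lt hw) t (le_of_lt ht)
  · refine Eventually.of_forall fun t w _ => ?_
    have hlin : HasDerivAt (fun w : ℂ => -w * (Real.cosh t : ℂ)) (-1 * (Real.cosh t : ℂ)) w :=
      (hasDerivAt_id w).neg.mul_const _
    exact (hlin.cexp.mul_const (g t)).congr_deriv (by ring)

theorem mul_coshLaplace_sinh_mul {g' : ℝ → ℂ} (hg : IsExpBounded g) (hg' : IsExpBounded g')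
    (hderiv : ∀ t, HasDerivAt g (g' t) t) {z : ℂ} (hz : 0 < z.re) :
    z * coshLaplace (fun t => (Real.sinh t : ℂ) * g t) z =
      Complex.exp (-z) * g 0 + coshLaplace g' z := by
  have hint := hg'.integrableOn_exp_neg_mul_cosh_mul hz
  have hints := ((isExpBounded_ofReal_sinh.mul hg).integrableOn_exp_neg_mul_cosh_mul hz).const_mul z
  obtain ⟨C, hC⟩ := hg.exists_norm_exp_neg_mul_cosh_mul_le hz
  have hprim : ∀ t : ℝ, HasDerivAt (fun t : ℝ => Complex.exp (-z * (Real.cosh t : ℂ)) * g t)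
      (Complex.exp (-z * (Real.cosh t : ℂ)) * g' t -
        z * (Complex.exp (-z * (Real.cosh t : ℂ)) * ((Real.sinh t : ℂ) * g t))) t := fun t => by
    have hexp : HasDerivAt (fun t : ℝ => -z * (Real.cosh t : ℂ)) (-z * (Real.sinh t : ℂ)) t :=
      ((Real.hasDerivAt_cosh t).ofReal_comp).const_mul _
    exact (hexp.cexp.mul (hderiv t)).congr_deriv (by ring)
  have hlim : Tendsto (fun t : ℝ => Complex.exp (-z * (Real.cosh t : ℂ)) * g t) atTop (𝓝 0) := by
    refine squeeze_zero_norm' (a := fun t => C * Real.exp (-t)) ?_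
      (by simpa using Real.tendsto_exp_neg_atTop_nhds_zero.const_mul C)
    filter_upwards [eventually_ge_atTop 0] with t ht using hC z le_rfl t ht
  have hFTC := integral_Ioi_of_hasDerivAt_of_tendsto
    (hg.continuous_exp_neg_mul_cosh_mul z).continuousWithinAt (fun t _ => hprim t)
    (hint.sub hints) hlim
  rw [integral_sub hint hints, integral_const_mul, Real.cosh_zero, Complex.ofReal_one, mul_one]
    at hFTC
  simp only [coshLaplace]
  linear_combination -hFTC

end CoshLaplace

/-! ### The MacDonald function -/

section Macdonald

variable {z : ℂ}

theorem besselK_eq_coshLaplace (m : ℂ) :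
    besselK m = coshLaplace fun t => Complex.cosh (m * t) := rfl

theorem mul_besselK_eq_mul_coshLaplace (m : ℂ) (hz : 0 < z.re) :
    m * besselK m z =
      z * coshLaplace (fun t => (Real.sinh t : ℂ) * Complex.sinh (m * t)) z := by
  have hderiv : ∀ t : ℝ, HasDerivAt (fun t : ℝ => Complex.sinh (m * t))
      (m * Complex.cosh (m * t)) t := fun t => by
    have hlin : HasDerivAt (fun t : ℝ => m * (t : ℂ)) (m * 1) t :=
      (hasDerivAt_id t).ofReal_comp.const_mul m
    exact ((Complex.hasDerivAt_sinh _).comp t hlin).congr_deriv (by ring)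
  rw [mul_coshLaplace_sinh_mul (isExpBounded_sinh m)
    ((isExpBounded_const m).mul (isExpBounded_cosh m)) hderiv hz, coshLaplace_const_mul]
  simp [besselK_eq_coshLaplace]

theorem besselK_add_one_eq_coshLaplace_add (m : ℂ) (hz : 0 < z.re) :
    besselK (m + 1) z = coshLaplace (fun t => (Real.cosh t : ℂ) * Complex.cosh (m * t)) z +
      coshLaplace (fun t => (Real.sinh t : ℂ) * Complex.sinh (m * t)) z := by
  rw [← coshLaplace_add (isExpBounded_ofReal_cosh.mul (isExpBounded_cosh m))
    (isExpBounded_ofReal_sinh.mul (isExpBounded_sinh m)) hz, besselK_eq_coshLaplace]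
  congr 1
  ext t
  rw [add_mul, one_mul, Complex.cosh_add, Complex.ofReal_cosh, Complex.ofReal_sinh]
  ring

theorem besselK_neg (m : ℂ) : besselK (-m) = besselK m := by
  simp only [besselK_eq_coshLaplace, neg_mul, Complex.cosh_neg]

theorem hasDerivAt_besselK (m : ℂ) (hz : 0 < z.re) :
    HasDerivAt (besselK m) (-besselK (m + 1) z + m / z * besselK m z) z := by
  refine (hasDerivAt_coshLaplace (isExpBounded_cosh m) hz).congr_deriv ?_
  rw [besselK_add_one_eq_coshLaplace_add m hz, div_mul_eq_mul_div,
    mul_besselK_eq_mul_coshLaplace m hz, mul_div_cancel_left₀ _ (Complex.ne_zero_of_re_pos hz)]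
  ring

theorem hasDerivAt_besselK' (m : ℂ) (hz : 0 < z.re) :
    HasDerivAt (besselK m) (-besselK (m - 1) z - m / z * besselK m z) z := by
  have h := hasDerivAt_besselK (-m) hz
  rw [← besselK_neg (-m + 1), neg_add, neg_neg, ← sub_eq_add_neg, besselK_neg] at h
  exact h.congr_deriv (by ring)

theorem besselK_add_one (m : ℂ) (hz : 0 < z.re) :
    besselK (m + 1) z = besselK (m - 1) z + 2 * m / z * besselK m z := by
  linear_combination (hasDerivAt_besselK' m hz).unique (hasDerivAt_besselK m hz)

theorem norm_besselK_le_integral {m : ℂ} {σ : ℝ} (hσ : |m.re| ≤ σ) (hz : 0 < z.re) :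
    ‖besselK m z‖ ≤ ∫ t in Ioi (0 : ℝ), Real.exp (-z.re * Real.cosh t) * Real.cosh (σ * t) := by
  have hint := ((isExpBounded_cosh σ).integrableOn_exp_neg_mul_cosh_mul (z := z.re)
    (by simpa using hz)).re
  refine norm_integral_le_of_norm_le (by exact_mod_cast hint) (Eventually.of_forall fun t => ?_)
  rw [norm_mul, norm_exp_neg_mul_cosh]
  gcongr
  refine (norm_complex_cosh_le _).trans (Real.cosh_le_cosh.2 ?_)
  rw [Complex.re_mul_ofReal, abs_mul, abs_mul]
  exact mul_le_mul_of_nonneg_right (hσ.trans (le_abs_self σ)) (abs_nonneg t)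

theorem sqrt_re_mul_norm_besselK_le (m : ℂ) (hz : 0 < z.re) :
    √z.re * ‖besselK m z‖ ≤ √Real.pi * Real.exp (m.re ^ 2 / z.re) * Real.exp (-z.re) := by
  have hbound : ‖besselK m z‖ ≤ ∫ t in Ioi (0 : ℝ),
      Real.exp (-z.re + m.re ^ 2 / z.re) * Real.exp (-(z.re / 4) * t ^ 2) := by
    have hgauss := integrable_exp_neg_mul_sq (b := z.re / 4) (by positivity)
    refine (norm_besselK_le_integral le_rfl hz).trans (integral_mono_of_nonneg
      (Eventually.of_forall fun t => by positivity) (hgauss.integrableOn.const_mul _) ?_)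
    filter_upwards [ae_restrict_mem measurableSet_Ioi] with t ht
    have hexp := neg_mul_cosh_add_mul_le hz |m.re| t
    rw [sq_abs] at hexp
    calc Real.exp (-z.re * Real.cosh t) * Real.cosh (|m.re| * t)
        ≤ Real.exp (-z.re * Real.cosh t) * Real.exp (|m.re| * t) := by
          gcongr
          simpa using cosh_re_mul_ofReal_le (|m.re| : ℝ) (mem_Ioi.1 ht).le
      _ ≤ _ := by
          rw [← Real.exp_add, ← Real.exp_add]
          exact Real.exp_le_exp.2 (by linarith)
  have hsqrt : √z.re * (√(Real.pi / (z.re / 4)) / 2) = √Real.pi := by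
    rw [mul_div_assoc', ← Real.sqrt_mul hz.le,
      show z.re * (Real.pi / (z.re / 4)) = 2 ^ 2 * Real.pi by field_simp; norm_num,
      Real.sqrt_mul (by positivity), Real.sqrt_sq zero_le_two,
      mul_div_cancel_left₀ _ two_ne_zero]
  rw [integral_const_mul, integral_gaussian_Ioi] at hbound
  calc √z.re * ‖besselK m z‖
      ≤ √z.re * (Real.exp (-z.re + m.re ^ 2 / z.re) * (√(Real.pi / (z.re / 4)) / 2)) := by gcongr
    _ = √z.re * (√(Real.pi / (z.re / 4)) / 2) *
          (Real.exp (m.re ^ 2 / z.re) * Real.exp (-z.re)) := by rw [Real.exp_add]; ring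
    _ = √Real.pi * Real.exp (m.re ^ 2 / z.re) * Real.exp (-z.re) := by rw [hsqrt]; ring

theorem two_mul_besselK_eq_integral_exp (m : ℂ) (hz : 0 < z.re) :
    2 * besselK m z = ∫ t : ℝ, Complex.exp (-z * (Real.cosh t : ℂ)) * Complex.exp (m * t) := by
  set f : ℝ → ℂ := fun t => Complex.exp (-z * (Real.cosh t : ℂ)) * Complex.exp (m * t)
  have hneg : ∀ t, f (-t) = Complex.exp (-z * (Real.cosh t : ℂ)) * Complex.exp (-m * t) :=
    fun t => by simp [f]
  have hpos : IntegrableOn f (Ioi 0) := (isExpBounded_exp m).integrableOn_exp_neg_mul_cosh_mul hz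
  have hposneg : IntegrableOn (fun t => f (-t)) (Ioi 0) := by
    simpa only [hneg] using (isExpBounded_exp (-m)).integrableOn_exp_neg_mul_cosh_mul hz
  have hIic : IntegrableOn f (Iic 0) := by
    rw [integrableOn_Iic_iff_integrableOn_Iio]
    simpa using hposneg.comp_neg
  rw [← intervalIntegral.integral_Iic_add_Ioi hIic hpos, ← neg_zero, ← integral_comp_neg_Ioi,
    neg_zero, ← integral_add hposneg hpos, besselK, ← integral_const_mul]
  refine integral_congr_ae (Eventually.of_forall fun t => ?_)
  simp only [f, Complex.cosh, Real.cosh_neg, Complex.ofReal_neg, mul_neg, neg_mul]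
  ring

end Macdonald

theorem integral_Ioi_eq_integral_comp_mul_exp {E : Type*} [NormedAddCommGroup E] [NormedSpace ℝ E]
    (g : ℝ → E) {x : ℝ} (hx : 0 < x) :
    ∫ y in Ioi (0 : ℝ), g y = ∫ t : ℝ, (x * Real.exp t) • g (x * Real.exp t) := by
  have himage : (fun t => x * Real.exp t) '' univ = Ioi 0 := by
    ext y
    simp only [image_univ, mem_range, mem_Ioi]
    refine ⟨?_, fun hy => ⟨Real.log (y / x), ?_⟩⟩
    · rintro ⟨t, rfl⟩
      positivity
    · rw [Real.exp_log (by positivity), mul_div_cancel₀ y hx.ne']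
  rw [← himage, integral_image_eq_integral_abs_deriv_smul MeasurableSet.univ
    (fun t _ => ((Real.hasDerivAt_exp t).const_mul x).hasDerivWithinAt)
    ((mul_right_injective₀ hx.ne').comp Real.exp_injective).injOn, Measure.restrict_univ]
  exact integral_congr_ae (Eventually.of_forall fun t => by
    simp only [abs_of_pos (mul_pos hx (Real.exp_pos t))])

theorem two_mul_cpow_mul_besselK (m : ℂ) {x : ℝ} (hx : 0 < x) :
    2 * ((x : ℂ) ^ m * besselK m x) =
      ∫ y in Ioi (0 : ℝ), (y : ℂ) ^ (m - 1) * Complex.exp (-(y + x ^ 2 / y : ℝ) / 2) := by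
  rw [integral_Ioi_eq_integral_comp_mul_exp _ hx, mul_left_comm,
    two_mul_besselK_eq_integral_exp m (by simpa using hx), ← integral_const_mul]
  refine integral_congr_ae (Eventually.of_forall fun t => ?_)
  have hxt : ((x * Real.exp t : ℝ) : ℂ) ≠ 0 := by
    exact_mod_cast (mul_pos hx (Real.exp_pos t)).ne'
  have hpow : ((x * Real.exp t : ℝ) : ℂ) ^ m = (x : ℂ) ^ m * Complex.exp (m * t) := by
    rw [Complex.ofReal_mul, Complex.mul_cpow_ofReal_nonneg hx.le (Real.exp_pos t).le,
      Complex.cpow_def_of_ne_zero (x := (Real.exp t : ℂ))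
        (by exact_mod_cast (Real.exp_pos t).ne'),
      ← Complex.ofReal_log (Real.exp_pos t).le, Real.log_exp, mul_comm (t : ℂ)]
  have hexp : -(x * Real.exp t + x ^ 2 / (x * Real.exp t)) / 2 = -x * Real.cosh t := by
    rw [Real.cosh_eq, Real.exp_neg]
    field_simp
  have hcexp : -((x * Real.exp t + x ^ 2 / (x * Real.exp t) : ℝ) : ℂ) / 2 =
      -x * (Real.cosh t : ℂ) := by exact_mod_cast congrArg (fun r : ℝ => (r : ℂ)) hexp
  simp only [Complex.real_smul]
  rw [hcexp, Complex.cpow_sub _ _ hxt, hpow, Complex.cpow_one, div_mul_eq_mul_div,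
    mul_div_cancel₀ _ hxt]
  ring

theorem norm_cpow_sub_one_mul_exp_le (m : ℂ) (x : ℝ) {y : ℝ} (hy : 0 < y) :
    ‖(y : ℂ) ^ (m - 1) * Complex.exp (-(y + x ^ 2 / y : ℝ) / 2)‖ ≤
      y ^ (m.re - 1) * Real.exp (-(1 / 2 * y)) := by
  have hre : (-((y + x ^ 2 / y : ℝ) : ℂ) / 2).re = -(y + x ^ 2 / y) / 2 := by
    rw [Complex.div_ofNat_re, Complex.neg_re, Complex.ofReal_re]
  have : 0 ≤ x ^ 2 / y := by positivity
  rw [norm_mul, Complex.norm_cpow_eq_rpow_re_of_pos hy, Complex.norm_exp, hre, Complex.sub_re,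
    Complex.one_re]
  gcongr
  linarith

theorem integrableOn_rpow_sub_one_mul_exp_neg_half {σ : ℝ} (hσ : 0 < σ) :
    IntegrableOn (fun y : ℝ => y ^ (σ - 1) * Real.exp (-(1 / 2 * y))) (Ioi 0) := by
  simpa using integrableOn_rpow_mul_exp_neg_mul_rpow (p := 1) (s := σ - 1) (b := 1 / 2)
    (by linarith) one_pos (by norm_num)

theorem tendsto_cpow_mul_besselK {m : ℂ} (hm : 0 < m.re) :
    Tendsto (fun x : ℝ => (x : ℂ) ^ m * besselK m x) (𝓝[>] 0)
      (𝓝 (2 ^ m * Complex.Gamma m / 2)) := by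
  have hGamma := Complex.integral_cpow_mul_exp_neg_mul_Ioi hm (r := 1 / 2) (by norm_num)
  simp only [Complex.ofReal_div, Complex.ofReal_one, Complex.ofReal_ofNat, one_div_one_div]
    at hGamma
  have hlim : Tendsto (fun x : ℝ => ∫ y in Ioi (0 : ℝ),
      (y : ℂ) ^ (m - 1) * Complex.exp (-(y + x ^ 2 / y : ℝ) / 2)) (𝓝[>] 0)
      (𝓝 (∫ y in Ioi (0 : ℝ), (y : ℂ) ^ (m - 1) * Complex.exp (-(1 / 2 * y)))) := by
    refine tendsto_integral_filter_of_dominated_convergence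
      (fun y : ℝ => y ^ (m.re - 1) * Real.exp (-(1 / 2 * y)))
      (Eventually.of_forall fun x => Measurable.aestronglyMeasurable (by fun_prop))
      (Eventually.of_forall fun x => ?_) (integrableOn_rpow_sub_one_mul_exp_neg_half hm)
      (Eventually.of_forall fun y => ?_)
    · filter_upwards [ae_restrict_mem measurableSet_Ioi] with y hy
      exact norm_cpow_sub_one_mul_exp_le m x hy
    · have hcont : Continuous fun x : ℝ =>
          (y : ℂ) ^ (m - 1) * Complex.exp (-(y + x ^ 2 / y : ℝ) / 2) := by fun_prop
      convert (hcont.tendsto 0).mono_left nhdsWithin_le_nhds using 4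
      simp
      ring
  rw [hGamma] at hlim
  refine (hlim.div_const 2).congr' ?_
  filter_upwards [self_mem_nhdsWithin] with x hx
  rw [← two_mul_cpow_mul_besselK m hx, mul_div_cancel_left₀ _ two_ne_zero]

theorem norm_besselK_le {m z : ℂ} {σ : ℝ} (hσ0 : 0 < σ) (hσ : |m.re| ≤ σ) (hz : 0 < z.re) :
    ‖besselK m z‖ ≤ 2 ^ σ * Real.Gamma σ / 2 * z.re ^ (-σ) := by
  have hreal : ‖besselK m z‖ ≤ ‖besselK σ z.re‖ := by
    refine (norm_besselK_le_integral hσ hz).trans ((le_abs_self _).trans_eq ?_)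
    rw [← Real.norm_eq_abs, ← Complex.norm_real, ← integral_complex_ofReal]
    simp [besselK]
  have hbound : ‖2 * (((z.re : ℝ) : ℂ) ^ (σ : ℂ) * besselK σ z.re)‖ ≤ 2 ^ σ * Real.Gamma σ := by
    have hGamma := Real.integral_rpow_mul_exp_neg_mul_Ioi hσ0 (r := 1 / 2) (by norm_num)
    rw [one_div_one_div] at hGamma
    rw [two_mul_cpow_mul_besselK _ hz, ← hGamma]
    refine norm_integral_le_of_norm_le (integrableOn_rpow_sub_one_mul_exp_neg_half hσ0) ?_
    filter_upwards [ae_restrict_mem measurableSet_Ioi] with y hy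
    exact norm_cpow_sub_one_mul_exp_le σ _ hy
  rw [norm_mul, norm_mul, Complex.norm_ofNat, Complex.norm_cpow_eq_rpow_re_of_pos hz,
    Complex.ofReal_re] at hbound
  refine hreal.trans ?_
  rw [Real.rpow_neg hz.le, ← div_eq_mul_inv, le_div_iff₀ (by positivity)]
  linarith

/-! ### The Wronskian of `I_m` and `K_m` -/

theorem tendsto_mul_besselI_add_one_mul_besselK {m : ℂ} (hm : 0 < m.re) :
    Tendsto (fun x : ℝ => (x : ℂ) * (besselI (m + 1) x * besselK m x)) (𝓝[>] 0) (𝓝 0) := by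
  have hsq : Tendsto (fun x : ℝ => (x : ℂ) ^ 2) (𝓝[>] 0) (𝓝 0) := by
    have hcont : Continuous fun x : ℝ => (x : ℂ) ^ 2 := by fun_prop
    simpa using (hcont.tendsto 0).mono_left (nhdsWithin_le_nhds (s := Ioi 0))
  have hlim := hsq.mul ((tendsto_cpow_neg_mul_besselI (m + 1)).mul (tendsto_cpow_mul_besselK hm))
  rw [zero_mul] at hlim
  refine hlim.congr' ?_
  filter_upwards [self_mem_nhdsWithin] with x hx
  have hx0 : (x : ℂ) ≠ 0 := by exact_mod_cast (mem_Ioi.1 hx).ne'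
  have hpow : (x : ℂ) ^ 2 * (x : ℂ) ^ (-(m + 1)) * (x : ℂ) ^ m = x := by
    rw [← Complex.cpow_ofNat, ← Complex.cpow_add _ _ hx0, ← Complex.cpow_add _ _ hx0]
    ring_nf
    exact Complex.cpow_one _
  linear_combination besselI (m + 1) x * besselK m x * hpow

theorem tendsto_mul_besselI_mul_besselK_add_one {m : ℂ} (hm : -1 < m.re) :
    Tendsto (fun x : ℝ => (x : ℂ) * (besselI m x * besselK (m + 1) x)) (𝓝[>] 0) (𝓝 1) := by
  have hm1 : 0 < (m + 1).re := by rw [Complex.add_re, Complex.one_re]; linarith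
  have hlim := (tendsto_cpow_neg_mul_besselI m).mul (tendsto_cpow_mul_besselK hm1)
  have hconst : (1 / 2 : ℂ) ^ m * (Complex.Gamma (m + 1))⁻¹ *
      (2 ^ (m + 1) * Complex.Gamma (m + 1) / 2) = 1 := by
    have hGamma := Complex.Gamma_ne_zero_of_re_pos hm1
    have htwo := ofReal_div_two_cpow m (x := 2) two_pos
    rw [Complex.ofReal_ofNat, div_self two_ne_zero, Complex.one_cpow] at htwo
    rw [Complex.cpow_add _ _ two_ne_zero, Complex.cpow_one]
    field_simp
    linear_combination -htwo
  rw [hconst] at hlim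
  refine hlim.congr' ?_
  filter_upwards [self_mem_nhdsWithin] with x hx
  have hx0 : (x : ℂ) ≠ 0 := by exact_mod_cast (mem_Ioi.1 hx).ne'
  have hpow : (x : ℂ) ^ (-m) * (x : ℂ) ^ (m + 1) = x := by
    rw [← Complex.cpow_add _ _ hx0, neg_add_cancel_left, Complex.cpow_one]
  linear_combination besselI m x * besselK (m + 1) x * hpow

theorem hasDerivAt_besselI_besselK_wronskian (m : ℂ) {z : ℂ} (hz : 0 < z.re) :
    HasDerivAt (fun z => z * (besselI (m + 1) z * besselK m z + besselI m z * besselK (m + 1) z))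
      0 z := by
  have hz0 := Complex.ne_zero_of_re_pos hz
  refine ((hasDerivAt_id z).mul (((hasDerivAt_besselI' (m + 1) hz).mul
    (hasDerivAt_besselK m hz)).add ((hasDerivAt_besselI m hz).mul
    (hasDerivAt_besselK' (m + 1) hz)))).congr_deriv ?_
  simp only [Pi.add_apply, Pi.mul_apply, id, add_sub_cancel_right]
  field_simp
  ring

theorem besselI_besselK_wronskian_of_re_pos {m z : ℂ} (hm : 0 < m.re) (hz : 0 < z.re) :
    z * (besselI (m + 1) z * besselK m z + besselI m z * besselK (m + 1) z) = 1 := by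
  have hconst : ∀ x ∈ {w : ℂ | 0 < w.re},
      x * (besselI (m + 1) x * besselK m x + besselI m x * besselK (m + 1) x) =
        z * (besselI (m + 1) z * besselK m z + besselI m z * besselK (m + 1) z) := fun x hx =>
    (isOpen_lt continuous_const Complex.continuous_re).is_const_of_deriv_eq_zero
      (convex_halfSpace_re_gt 0).isPreconnected
      (fun w hw => (hasDerivAt_besselI_besselK_wronskian m
        hw).differentiableAt.differentiableWithinAt)
      (fun w hw => (hasDerivAt_besselI_besselK_wronskian m hw).deriv) hx hz
  have hlim := (tendsto_mul_besselI_add_one_mul_besselK hm).add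
    (tendsto_mul_besselI_mul_besselK_add_one (m := m) (by linarith))
  rw [zero_add] at hlim
  refine tendsto_nhds_unique (Tendsto.congr' ?_ tendsto_const_nhds) hlim
  filter_upwards [self_mem_nhdsWithin] with x hx
  rw [← mul_add, hconst x (by simpa using hx)]

theorem besselI_besselK_wronskian_add_one (m : ℂ) {z : ℂ} (hz : 0 < z.re) :
    besselI (m + 1 + 1) z * besselK (m + 1) z + besselI (m + 1) z * besselK (m + 1 + 1) z =
      besselI (m + 1) z * besselK m z + besselI m z * besselK (m + 1) z := by
  have hI := besselI_sub_one (m + 1) hz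
  have hK := besselK_add_one (m + 1) hz
  rw [add_sub_cancel_right] at hI hK
  linear_combination besselI (m + 1) z * hK - besselK (m + 1) z * hI

theorem besselI_besselK_wronskian (m : ℂ) {z : ℂ} (hz : 0 < z.re) :
    z * (besselI (m + 1) z * besselK m z + besselI m z * besselK (m + 1) z) = 1 := by
  have hshift : ∀ n : ℕ, besselI (m + n + 1) z * besselK (m + n) z +
      besselI (m + n) z * besselK (m + n + 1) z =
        besselI (m + 1) z * besselK m z + besselI m z * besselK (m + 1) z := fun n => by
    induction n with
    | zero => simp
    | succ n ih =>
      rw [Nat.cast_succ, ← add_assoc, besselI_besselK_wronskian_add_one (m + n) hz, ih]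
  obtain ⟨n, hn⟩ := exists_nat_gt (-m.re)
  rw [← hshift n]
  exact besselI_besselK_wronskian_of_re_pos (by simpa using by linarith) hz

/-! ### Second order equations on the half-line -/

/-- `u` solves `u'' = q u` on `(0, ∞)`, with derivative `u₁`; the equation is encoded as the first
order system `u' = u₁`, `u₁' = q u`. -/
def IsSolution (q u u₁ : ℝ → ℂ) : Prop :=
  ∀ x, 0 < x → HasDerivAt u (u₁ x) x ∧ HasDerivAt u₁ (q x * u x) x

namespace IsSolution

variable {q u u₁ : ℝ → ℂ}

theorem continuousOn (h : IsSolution q u u₁) : ContinuousOn u (Ioi 0) :=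
  fun x hx => (h x hx).1.continuousAt.continuousWithinAt

theorem continuousOn_deriv (h : IsSolution q u u₁) : ContinuousOn u₁ (Ioi 0) :=
  fun x hx => (h x hx).2.continuousAt.continuousWithinAt

theorem contDiffOn (h : IsSolution q u u₁) (hq : ContDiffOn ℝ ∞ q (Ioi 0)) :
    ContDiffOn ℝ ∞ u (Ioi 0) := by
  have contDiffOn_nat (n : ℕ) : ContDiffOn ℝ n u (Ioi 0) ∧ ContDiffOn ℝ n u₁ (Ioi 0) := by
    induction n with
    | zero =>
      simpa only [Nat.cast_zero, contDiffOn_zero] using ⟨h.continuousOn, h.continuousOn_deriv⟩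
    | succ n ih =>
      push_cast
      rw [contDiffOn_succ_iff_deriv_of_isOpen isOpen_Ioi,
        contDiffOn_succ_iff_deriv_of_isOpen isOpen_Ioi]
      refine ⟨⟨fun x hx => (h x hx).1.differentiableAt.differentiableWithinAt, by simp,
        ih.2.congr fun x hx => (h x hx).1.deriv⟩,
        ⟨fun x hx => (h x hx).2.differentiableAt.differentiableWithinAt, by simp,
        ((hq.of_le (by exact_mod_cast le_top)).mul ih.1).congr fun x hx => (h x hx).2.deriv⟩⟩
  exact contDiffOn_infty.2 fun n => (contDiffOn_nat n).1

end IsSolution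

theorem le_mul_exp_sub_of_deriv_le_mul {F F' G g : ℝ → ℝ} {a b : ℝ} (hab : a ≤ b)
    (hF : ∀ x ∈ Icc a b, HasDerivAt F (F' x) x) (hG : ∀ x ∈ Icc a b, HasDerivAt G (g x) x)
    (h : ∀ x ∈ Icc a b, F' x ≤ g x * F x) : F b ≤ F a * Real.exp (G b - G a) := by
  have hderiv : ∀ x ∈ Icc a b, HasDerivAt (fun x => F x * Real.exp (-G x))
      (F' x * Real.exp (-G x) + F x * (Real.exp (-G x) * -g x)) x :=
    fun x hx => (hF x hx).mul (hG x hx).fun_neg.exp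
  have hanti : AntitoneOn (fun x => F x * Real.exp (-G x)) (Icc a b) := by
    refine antitoneOn_of_hasDerivWithinAt_nonpos (convex_Icc a b)
      (fun x hx => (hderiv x hx).continuousAt.continuousWithinAt)
      (fun x hx => (hderiv x (interior_subset hx)).hasDerivWithinAt) fun x hx => ?_
    calc F' x * Real.exp (-G x) + F x * (Real.exp (-G x) * -g x)
        = (F' x - g x * F x) * Real.exp (-G x) := by ring
      _ ≤ 0 := mul_nonpos_of_nonpos_of_nonneg
        (sub_nonpos.2 (h x (interior_subset hx))) (Real.exp_pos _).le
  calc F b = F b * Real.exp (-G b) * Real.exp (G b) := by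
        rw [mul_assoc, ← Real.exp_add, neg_add_cancel, Real.exp_zero, mul_one]
    _ ≤ F a * Real.exp (-G a) * Real.exp (G b) :=
        mul_le_mul_of_nonneg_right (hanti (left_mem_Icc.2 hab) (right_mem_Icc.2 hab) hab)
          (Real.exp_pos _).le
    _ = F a * Real.exp (G b - G a) := by
        rw [mul_assoc, ← Real.exp_add, sub_eq_neg_add]

theorem norm_sq_add_sq_norm (k : ℂ) (hk : 0 ≤ k.re) :
    ‖k ^ 2 + (‖k‖ : ℂ) ^ 2‖ = 2 * k.re * ‖k‖ := by
  have h : k ^ 2 + (‖k‖ : ℂ) ^ 2 = (2 * k.re : ℝ) * k := by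
    rw [← Complex.mul_conj', ← Complex.add_conj]
    ring
  rw [h, norm_mul, Complex.norm_real, Real.norm_of_nonneg (by positivity)]

theorem two_mul_inner_mul_add_le {k a u v : ℂ} (hk : 0 < k.re) {δ : ℝ} (ha : ‖a - k ^ 2‖ ≤ δ) :
    2 * inner ℝ v (a * u) + ‖k‖ ^ 2 * (2 * inner ℝ u v) ≤
      (2 * k.re + δ / ‖k‖) * (‖v‖ ^ 2 + ‖k‖ ^ 2 * ‖u‖ ^ 2) := by
  have hk0 : 0 < ‖k‖ := norm_pos_iff.2 (Complex.ne_zero_of_re_pos hk)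
  have hδ : 0 ≤ δ := (norm_nonneg _).trans ha
  have hinner : inner ℝ v (a * u) + ‖k‖ ^ 2 * inner ℝ u v
      = inner ℝ v ((k ^ 2 + (‖k‖ : ℂ) ^ 2) * u) + inner ℝ v ((a - k ^ 2) * u) := by
    rw [← inner_add_right, real_inner_comm v u, ← real_inner_smul_right, ← inner_add_right,
      Complex.real_smul]
    push_cast
    ring_nf
  have hmain : inner ℝ v ((k ^ 2 + (‖k‖ : ℂ) ^ 2) * u) ≤ ‖v‖ * (2 * k.re * ‖k‖ * ‖u‖) := by
    rw [← norm_sq_add_sq_norm k hk.le, ← norm_mul]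
    exact real_inner_le_norm _ _
  have herror : inner ℝ v ((a - k ^ 2) * u) ≤ ‖v‖ * (δ * ‖u‖) := by
    refine (real_inner_le_norm _ _).trans ?_
    rw [norm_mul]
    gcongr
  have hyoung : 2 * (‖k‖ * (‖v‖ * ‖u‖)) ≤ ‖v‖ ^ 2 + ‖k‖ ^ 2 * ‖u‖ ^ 2 := by
    linarith [two_mul_le_add_sq ‖v‖ (‖k‖ * ‖u‖), mul_pow ‖k‖ ‖u‖ 2]
  calc 2 * inner ℝ v (a * u) + ‖k‖ ^ 2 * (2 * inner ℝ u v)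
      ≤ 2 * (‖v‖ * (2 * k.re * ‖k‖ * ‖u‖) + ‖v‖ * (δ * ‖u‖)) := by linarith
    _ = (2 * k.re + δ / ‖k‖) * (2 * (‖k‖ * (‖v‖ * ‖u‖))) := by
        field_simp
    _ ≤ _ := by gcongr

-- Gronwall's inequality for the energy `‖u₁‖² + ‖k‖² ‖u‖²`: the identity `k² + |k|² = 2 (Re k) k`
-- gives the sharp exponential rate `2 Re k`.
theorem IsSolution.exists_norm_le_exp {q u u₁ : ℝ → ℂ} (h : IsSolution q u u₁) {k : ℂ}
    (hk : 0 < k.re) {c : ℝ} (hq : ∀ x, 1 ≤ x → ‖q x - k ^ 2‖ ≤ c / x ^ 2) :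
    ∃ C : ℝ, 0 ≤ C ∧ ∀ x : ℝ, 1 ≤ x → ‖u x‖ ≤ C * Real.exp (k.re * x) := by
  have hk0 : 0 < ‖k‖ := norm_pos_iff.2 (Complex.ne_zero_of_re_pos hk)
  have hc : 0 ≤ c := by simpa using (norm_nonneg _).trans (hq 1 le_rfl)
  set F : ℝ → ℝ := fun x => ‖u₁ x‖ ^ 2 + ‖k‖ ^ 2 * ‖u x‖ ^ 2
  set G : ℝ → ℝ := fun x => 2 * k.re * x - c / ‖k‖ * x⁻¹
  have hF : ∀ x, 0 < x → HasDerivAt F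
      (2 * inner ℝ (u₁ x) (q x * u x) + ‖k‖ ^ 2 * (2 * inner ℝ (u x) (u₁ x))) x :=
    fun x hx => (h x hx).2.norm_sq.add ((h x hx).1.norm_sq.const_mul _)
  have hG : ∀ x, 0 < x → HasDerivAt G (2 * k.re + c / x ^ 2 / ‖k‖) x := fun x hx => by
    refine (((hasDerivAt_id x).const_mul (2 * k.re)).sub
      ((hasDerivAt_inv hx.ne').const_mul (c / ‖k‖))).congr_deriv ?_
    field_simp
    ring
  have henergy : ∀ x, 1 ≤ x → F x ≤ F 1 * Real.exp (c / ‖k‖) * Real.exp (k.re * x) ^ 2 := by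
    intro x hx
    calc F x ≤ F 1 * Real.exp (G x - G 1) := by
          refine le_mul_exp_sub_of_deriv_le_mul hx (fun y hy => hF y (by linarith [hy.1]))
            (fun y hy => hG y (by linarith [hy.1])) fun y hy => ?_
          exact two_mul_inner_mul_add_le hk (hq y hy.1)
      _ ≤ F 1 * Real.exp (c / ‖k‖ + 2 * (k.re * x)) := by
          gcongr
          have : 0 ≤ c / ‖k‖ * x⁻¹ := by positivity
          simp only [G, inv_one]
          linarith
      _ = _ := by rw [Real.exp_add, ← mul_assoc, ← Real.exp_nat_mul, Nat.cast_ofNat]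
  refine ⟨√(F 1 * Real.exp (c / ‖k‖)) / ‖k‖, by positivity, fun x hx => ?_⟩
  rw [div_mul_eq_mul_div, le_div_iff₀ hk0,
    ← Real.sqrt_sq (Real.exp_pos (k.re * x)).le, ← Real.sqrt_mul (by positivity)]
  refine Real.le_sqrt_of_sq_le ((henergy x hx).trans' ?_)
  simp only [F]
  nlinarith [sq_nonneg ‖u₁ x‖]

/-! ### The solutions `√x I_m(k x)` and `√x K_m(k x)` -/

/-- The coefficient of the equation `u'' = (k² + (m² - 1/4) / x²) u`, i.e. `(L_{m²} + k²) u = 0`. -/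
def besselPotential (m k : ℂ) (x : ℝ) : ℂ := k ^ 2 + (-1 / 4 + m ^ 2) / (x : ℂ) ^ 2

theorem contDiffOn_besselPotential (m k : ℂ) : ContDiffOn ℝ ∞ (besselPotential m k) (Ioi 0) :=
  contDiffOn_const.add ((contDiffOn_const (c := -1 / 4 + m ^ 2)).mul
    ((Complex.ofRealCLM.contDiff.pow 2).contDiffOn.inv
      fun _ hx => pow_ne_zero 2 (Complex.ofReal_ne_zero.2 (ne_of_gt hx))))

theorem norm_besselPotential_sub (m k : ℂ) (x : ℝ) :
    ‖besselPotential m k x - k ^ 2‖ = ‖-1 / 4 + m ^ 2‖ / x ^ 2 := by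
  rw [besselPotential, add_sub_cancel_left, norm_div, norm_pow, Complex.norm_real, Real.norm_eq_abs,
    sq_abs]

theorem hasDerivAt_sqrt_mul {J : ℝ → ℂ} {J' : ℂ} {x : ℝ} (hx : 0 < x) (h : HasDerivAt J J' x) :
    HasDerivAt (fun x : ℝ => (√x : ℂ) * J x) ((√x : ℂ) * (1 / (2 * x) * J x + J')) x := by
  refine ((Real.hasDerivAt_sqrt hx.ne').ofReal_comp.mul h).congr_deriv ?_
  have hs : (√x : ℂ) ≠ 0 := by exact_mod_cast (Real.sqrt_pos.2 hx).ne'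
  have hx0 : (x : ℂ) ≠ 0 := by exact_mod_cast hx.ne'
  have hsq : (√x : ℂ) ^ 2 = x := by exact_mod_cast Real.sq_sqrt hx.le
  push_cast
  field_simp
  rw [hsq]
  ring

theorem isSolution_sqrt_mul {m s : ℂ} {J J₁ : ℝ → ℂ}
    (h : ∀ x, 0 < x → HasDerivAt J (s * J₁ x + m / x * J x) x)
    (h₁ : ∀ x, 0 < x → HasDerivAt J₁ (s * J x - (m + 1) / x * J₁ x) x) :
    IsSolution (besselPotential m s) (fun x => (√x : ℂ) * J x)
      (fun x => (√x : ℂ) * ((1 / 2 + m) / x * J x + s * J₁ x)) := by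
  intro x hx
  have hx0 : (x : ℂ) ≠ 0 := by exact_mod_cast hx.ne'
  constructor
  · refine (hasDerivAt_sqrt_mul hx (h x hx)).congr_deriv ?_
    field_simp
    ring
  · have hinv : HasDerivAt (fun x : ℝ => (1 / 2 + m) / (x : ℂ))
        (((0 : ℂ) * x - (1 / 2 + m) * 1) / (x : ℂ) ^ 2) x :=
      (hasDerivAt_const x (1 / 2 + m)).div (hasDerivAt_id x).ofReal_comp hx0
    refine (hasDerivAt_sqrt_mul hx ((hinv.mul (h x hx)).add
      ((h₁ x hx).const_mul s))).congr_deriv ?_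
    simp only [besselPotential, Pi.add_apply, Pi.mul_apply]
    field_simp
    ring

/-- The solution `√x I_m(k x)`, which is the one proportional to `x^{1/2 + m}` near `0`. -/
def solI (m k : ℂ) (x : ℝ) : ℂ := (√x : ℂ) * besselI m (k * x)

/-- The solution `√x K_m(k x)`, which decays exponentially at `∞`. -/
def solK (m k : ℂ) (x : ℝ) : ℂ := (√x : ℂ) * besselK m (k * x)

/-- The derivative of `solI`, in terms of `I_m` and `I_{m+1}`. -/
def solI' (m k : ℂ) (x : ℝ) : ℂ :=
  (√x : ℂ) * ((1 / 2 + m) / x * besselI m (k * x) + k * besselI (m + 1) (k * x))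

/-- The derivative of `solK`, in terms of `K_m` and `K_{m+1}`. -/
def solK' (m k : ℂ) (x : ℝ) : ℂ :=
  (√x : ℂ) * ((1 / 2 + m) / x * besselK m (k * x) + -k * besselK (m + 1) (k * x))

theorem hasDerivAt_comp_mul_ofReal {f : ℂ → ℂ} {f' k : ℂ} {x : ℝ} (h : HasDerivAt f f' (k * x)) :
    HasDerivAt (fun x : ℝ => f (k * x)) (f' * k) x :=
  (h.comp x ((hasDerivAt_id x).ofReal_comp.const_mul k)).congr_deriv
    (by rw [Complex.ofReal_one, mul_one])

theorem mul_ofReal_div_two_cpow {k : ℂ} (hk : k ≠ 0) (a : ℂ) {x : ℝ} (hx : 0 < x) :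
    (k * x / 2) ^ a = (k / 2) ^ a * (x : ℂ) ^ a := by
  have hk2 : k / 2 ≠ 0 := div_ne_zero hk two_ne_zero
  have hx0 : (x : ℂ) ≠ 0 := by exact_mod_cast hx.ne'
  rw [show k * x / 2 = (x : ℂ) * (k / 2) by ring, Complex.cpow_def_of_ne_zero (mul_ne_zero hx0 hk2),
    Complex.cpow_def_of_ne_zero hx0, Complex.cpow_def_of_ne_zero hk2,
    Complex.log_ofReal_mul hx hk2, ← Complex.exp_add, Complex.ofReal_log hx.le]
  ring_nf

section Solutions

variable {m k : ℂ}

theorem re_mul_ofReal_pos (hk : 0 < k.re) {x : ℝ} (hx : 0 < x) : 0 < (k * x).re := by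
  simpa using mul_pos hk hx

theorem isSolution_solI (m : ℂ) (hk : 0 < k.re) :
    IsSolution (besselPotential m k) (solI m k) (solI' m k) := by
  have hk0 : k ≠ 0 := Complex.ne_zero_of_re_pos hk
  refine isSolution_sqrt_mul (fun x hx => ?_) (fun x hx => ?_)
  · have hx0 : (x : ℂ) ≠ 0 := by exact_mod_cast hx.ne'
    refine (hasDerivAt_comp_mul_ofReal
      (hasDerivAt_besselI m (re_mul_ofReal_pos hk hx))).congr_deriv ?_
    field_simp
  · have hx0 : (x : ℂ) ≠ 0 := by exact_mod_cast hx.ne'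
    refine (hasDerivAt_comp_mul_ofReal
      (hasDerivAt_besselI' (m + 1) (re_mul_ofReal_pos hk hx))).congr_deriv ?_
    rw [add_sub_cancel_right]
    field_simp

theorem isSolution_solK (m : ℂ) (hk : 0 < k.re) :
    IsSolution (besselPotential m k) (solK m k) (solK' m k) := by
  have hk0 : k ≠ 0 := Complex.ne_zero_of_re_pos hk
  have hneg : besselPotential m k = besselPotential m (-k) := by
    simp only [funext_iff, besselPotential, neg_sq, implies_true]
  rw [hneg]
  refine isSolution_sqrt_mul (fun x hx => ?_) (fun x hx => ?_)
  · have hx0 : (x : ℂ) ≠ 0 := by exact_mod_cast hx.ne'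
    refine (hasDerivAt_comp_mul_ofReal
      (hasDerivAt_besselK m (re_mul_ofReal_pos hk hx))).congr_deriv ?_
    field_simp
  · have hx0 : (x : ℂ) ≠ 0 := by exact_mod_cast hx.ne'
    refine (hasDerivAt_comp_mul_ofReal
      (hasDerivAt_besselK' (m + 1) (re_mul_ofReal_pos hk hx))).congr_deriv ?_
    rw [add_sub_cancel_right]
    field_simp

theorem solI_solK_wronskian (m : ℂ) (hk : 0 < k.re) {x : ℝ} (hx : 0 < x) :
    solI' m k x * solK m k x - solI m k x * solK' m k x = 1 := by
  have hsq : (√x : ℂ) ^ 2 = x := by exact_mod_cast Real.sq_sqrt hx.le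
  rw [← besselI_besselK_wronskian m (re_mul_ofReal_pos hk hx), solI, solI', solK, solK', ← hsq]
  ring

theorem solI_eq_cpow_mul_hyp01 (m : ℂ) (hk : 0 < k.re) {x : ℝ} (hx : 0 < x) :
    solI m k x = (k / 2) ^ m * ((x : ℂ) ^ (1 / 2 + m) * hyp01 (m + 1) (k ^ 2 * x ^ 2 / 4)) := by
  have hsqrt : (√x : ℂ) = (x : ℂ) ^ (1 / 2 : ℂ) := by
    rw [Real.sqrt_eq_rpow, Complex.ofReal_cpow hx.le]
    norm_num
  rw [solI, besselI_eq_cpow_mul_hyp01, mul_ofReal_div_two_cpow (Complex.ne_zero_of_re_pos hk) m hx,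
    Complex.cpow_add _ _ (Complex.ofReal_ne_zero.2 hx.ne'), hsqrt, mul_pow]
  ring

theorem exists_norm_solI_le_rpow (m : ℂ) (hk : 0 < k.re) :
    ∃ C : ℝ, 0 ≤ C ∧ ∀ x : ℝ, 0 < x → x ≤ 1 → ‖solI m k x‖ ≤ C * x ^ (1 / 2 + m.re) := by
  obtain ⟨C, hC⟩ := (isCompact_Icc (a := (0 : ℝ)) (b := 1)).exists_bound_of_continuousOn
    (f := fun x : ℝ => hyp01 (m + 1) (k ^ 2 * x ^ 2 / 4))
    ((continuous_hyp01 (m + 1)).comp (by fun_prop)).continuousOn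
  refine ⟨‖(k / 2) ^ m‖ * C, mul_nonneg (norm_nonneg _)
    ((norm_nonneg _).trans (hC 0 (by simp))), fun x hx hx1 => ?_⟩
  rw [solI_eq_cpow_mul_hyp01 m hk hx, norm_mul, norm_mul, Complex.norm_cpow_eq_rpow_re_of_pos hx,
    Complex.add_re, Complex.div_ofNat_re, Complex.one_re, mul_assoc, mul_comm C]
  gcongr
  exact hC x ⟨hx.le, hx1⟩

theorem norm_solK (m k : ℂ) (x : ℝ) : ‖solK m k x‖ = √x * ‖besselK m (k * x)‖ := by
  rw [solK, norm_mul, Complex.norm_real, Real.norm_of_nonneg (Real.sqrt_nonneg x)]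

theorem exists_norm_solK_le_rpow (hk : 0 < k.re) {σ : ℝ} (hσ0 : 0 < σ) (hσ : |m.re| ≤ σ) :
    ∃ C : ℝ, 0 ≤ C ∧ ∀ x : ℝ, 0 < x → ‖solK m k x‖ ≤ C * x ^ (1 / 2 - σ) := by
  refine ⟨2 ^ σ * Real.Gamma σ / 2 * k.re ^ (-σ), ?_, fun x hx => ?_⟩
  · have := (Real.Gamma_pos_of_pos hσ0).le
    positivity
  have h := norm_besselK_le hσ0 hσ (re_mul_ofReal_pos hk hx)
  rw [Complex.re_mul_ofReal, Real.mul_rpow hk.le hx.le] at h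
  rw [norm_solK, sub_eq_add_neg, Real.rpow_add hx, Real.sqrt_eq_rpow]
  calc x ^ (1 / 2 : ℝ) * ‖besselK m (k * x)‖
      ≤ x ^ (1 / 2 : ℝ) * (2 ^ σ * Real.Gamma σ / 2 * (k.re ^ (-σ) * x ^ (-σ))) := by gcongr
    _ = _ := by ring

theorem exists_norm_solK_le_exp (m : ℂ) (hk : 0 < k.re) :
    ∃ C : ℝ, 0 ≤ C ∧ ∀ x : ℝ, 1 ≤ x → ‖solK m k x‖ ≤ C * Real.exp (-(k.re * x)) := by
  refine ⟨√Real.pi * Real.exp (m.re ^ 2 / k.re) / √k.re, by positivity, fun x hx => ?_⟩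
  have h := sqrt_re_mul_norm_besselK_le m (re_mul_ofReal_pos hk (one_pos.trans_le hx))
  rw [Complex.re_mul_ofReal, Real.sqrt_mul hk.le] at h
  rw [norm_solK, div_mul_eq_mul_div, le_div_iff₀ (Real.sqrt_pos.2 hk)]
  calc √x * ‖besselK m (k * x)‖ * √k.re
      = √k.re * √x * ‖besselK m (k * x)‖ := by ring
    _ ≤ √Real.pi * Real.exp (m.re ^ 2 / (k.re * x)) * Real.exp (-(k.re * x)) := h
    _ ≤ √Real.pi * Real.exp (m.re ^ 2 / k.re) * Real.exp (-(k.re * x)) := by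
        gcongr
        exact le_mul_of_one_le_right hk.le hx

theorem solK'_eq (m k : ℂ) (x : ℝ) :
    solK' m k x = (1 / 2 + m) / x * solK m k x - k * solK (m + 1) k x := by
  simp only [solK', solK]
  ring

theorem exists_norm_solK'_le_exp (m : ℂ) (hk : 0 < k.re) :
    ∃ C : ℝ, 0 ≤ C ∧ ∀ x : ℝ, 1 ≤ x → ‖solK' m k x‖ ≤ C * Real.exp (-(k.re * x)) := by
  obtain ⟨C, hC0, hC⟩ := exists_norm_solK_le_exp m hk
  obtain ⟨D, hD0, hD⟩ := exists_norm_solK_le_exp (m + 1) hk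
  refine ⟨‖1 / 2 + m‖ * C + ‖k‖ * D, by positivity, fun x hx => ?_⟩
  have hcoeff : ‖(1 / 2 + m) / (x : ℂ)‖ ≤ ‖1 / 2 + m‖ := by
    rw [norm_div, Complex.norm_real, Real.norm_of_nonneg (by linarith)]
    exact div_le_self (norm_nonneg _) hx
  calc ‖solK' m k x‖
      ≤ ‖(1 / 2 + m) / (x : ℂ)‖ * ‖solK m k x‖ + ‖k‖ * ‖solK (m + 1) k x‖ := by
        rw [solK'_eq, ← norm_mul, ← norm_mul]
        exact norm_sub_le _ _
    _ ≤ ‖1 / 2 + m‖ * (C * Real.exp (-(k.re * x))) + ‖k‖ * (D * Real.exp (-(k.re * x))) := by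
        gcongr
        exacts [hC x hx, hD x hx]
    _ = _ := by ring

end Solutions

/-! ### Schur's test -/

section Schur

open scoped ENNReal

variable {α β : Type*} [MeasurableSpace α] [MeasurableSpace β] {μ : Measure α} {ν : Measure β}

theorem lintegral_mul_sq_le_lintegral_mul_lintegral_div {K F h : β → ℝ≥0∞}
    (hK : AEMeasurable K ν) (hF : AEMeasurable F ν) (hh : AEMeasurable h ν)
    (hh0 : ∀ᵐ y ∂ν, h y ≠ 0) (hhtop : ∀ᵐ y ∂ν, h y ≠ ⊤) :
    (∫⁻ y, K y * F y ∂ν) ^ 2 ≤ (∫⁻ y, K y * h y ∂ν) * ∫⁻ y, K y * (F y ^ 2 / h y) ∂ν := by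
  have half_rpow_sq (t : ℝ≥0∞) : (t ^ (1 / 2 : ℝ)) ^ 2 = t := by
    rw [← ENNReal.rpow_two, ← ENNReal.rpow_mul, one_div_mul_cancel two_ne_zero, ENNReal.rpow_one]
  have sq_half_rpow (t : ℝ≥0∞) : (t ^ 2) ^ (1 / 2 : ℝ) = t := by
    rw [← ENNReal.rpow_two, ← ENNReal.rpow_mul, mul_one_div_cancel two_ne_zero, ENNReal.rpow_one]
  have hsplit : ∫⁻ y, K y * F y ∂ν =
      ∫⁻ y, (K y * h y) ^ (1 / 2 : ℝ) * (K y * (F y ^ 2 / h y)) ^ (1 / 2 : ℝ) ∂ν := by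
    refine lintegral_congr_ae ?_
    filter_upwards [hh0, hhtop] with y hy0 hytop
    rw [← ENNReal.mul_rpow_of_nonneg _ _ (by norm_num), mul_mul_mul_comm,
      ENNReal.mul_div_cancel hy0 hytop, ← sq, ← mul_pow, sq_half_rpow]
  have hcauchy := ENNReal.lintegral_mul_norm_pow_le (hK.mul hh) (hK.mul ((hF.pow_const 2).div hh))
    (p := 1 / 2) (q := 1 / 2) (by norm_num) (by norm_num) (by norm_num)
  calc (∫⁻ y, K y * F y ∂ν) ^ 2
      ≤ ((∫⁻ y, K y * h y ∂ν) ^ (1 / 2 : ℝ) *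
          (∫⁻ y, K y * (F y ^ 2 / h y) ∂ν) ^ (1 / 2 : ℝ)) ^ 2 := by
        rw [hsplit]
        gcongr
        exact hcauchy
    _ = _ := by rw [mul_pow, half_rpow_sq, half_rpow_sq]

variable {𝕜 : Type*} [RCLike 𝕜] {G : α → β → 𝕜}

theorem eLpNorm_two_sq (f : α → 𝕜) : eLpNorm f 2 μ ^ 2 = ∫⁻ x, ‖f x‖ₑ ^ 2 ∂μ := by
  simpa using eLpNorm_nnreal_pow_eq_lintegral (μ := μ) (f := f) (p := 2) two_ne_zero

variable [SFinite ν]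

theorem ae_integrable_of_lintegral_lintegral_enorm_sq_ne_top
    (hG : AEStronglyMeasurable (Function.uncurry G) (μ.prod ν))
    (hfin : ∫⁻ x, (∫⁻ y, ‖G x y‖ₑ ∂ν) ^ 2 ∂μ ≠ ⊤) : ∀ᵐ x ∂μ, Integrable (G x) ν := by
  have hmeas : AEMeasurable (fun x => (∫⁻ y, ‖G x y‖ₑ ∂ν) ^ 2) μ :=
    hG.enorm.lintegral_prod_right'.pow_const 2
  filter_upwards [hG.prodMk_left, ae_lt_top' hmeas hfin] with x hx hlt
  exact ⟨hx, (ENNReal.pow_lt_top_iff.1 hlt).resolve_right two_ne_zero⟩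

theorem exists_continuousLinearMap_of_eLpNorm_integral_le {p q : ℝ≥0∞} [Fact (1 ≤ p)]
    [Fact (1 ≤ q)] (hG : AEStronglyMeasurable (Function.uncurry G) (μ.prod ν)) {C : ℝ≥0∞}
    (hC : C ≠ ⊤) (hint : ∀ f : Lp 𝕜 q ν, ∀ᵐ x ∂μ, Integrable (fun y => G x y * f y) ν)
    (hle : ∀ f : Lp 𝕜 q ν, eLpNorm (fun x => ∫ y, G x y * f y ∂ν) p μ ≤ C * eLpNorm f q ν) :
    ∃ R : Lp 𝕜 q ν →L[𝕜] Lp 𝕜 p μ, ∀ f : Lp 𝕜 q ν, ∀ᵐ x ∂μ, R f x = ∫ y, G x y * f y ∂ν := by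
  have hfin (f : Lp 𝕜 q ν) : C * eLpNorm f q ν < ⊤ :=
    ENNReal.mul_lt_top hC.lt_top (Lp.eLpNorm_lt_top f)
  have hmem (f : Lp 𝕜 q ν) : MemLp (fun x => ∫ y, G x y * f y ∂ν) p μ :=
    ⟨(hG.mul (Lp.aestronglyMeasurable f).comp_snd).integral_prod_right', (hle f).trans_lt (hfin f)⟩
  let T : Lp 𝕜 q ν →ₗ[𝕜] Lp 𝕜 p μ :=
    { toFun := fun f => (hmem f).toLp _
      map_add' := fun f g => by
        rw [← MemLp.toLp_add]
        refine MemLp.toLp_congr _ _ ?_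
        filter_upwards [hint f, hint g] with x hf hg
        rw [Pi.add_apply, ← integral_add hf hg]
        refine integral_congr_ae ?_
        filter_upwards [Lp.coeFn_add f g] with y hy
        rw [hy, Pi.add_apply, mul_add]
      map_smul' := fun c f => by
        rw [RingHom.id_apply, ← MemLp.toLp_const_smul]
        refine MemLp.toLp_congr _ _ (Eventually.of_forall fun x => ?_)
        rw [Pi.smul_apply, smul_eq_mul, ← integral_const_mul]
        refine integral_congr_ae ?_
        filter_upwards [Lp.coeFn_smul c f] with y hy
        rw [hy, Pi.smul_apply, smul_eq_mul, mul_left_comm] }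
  refine ⟨T.mkContinuous C.toReal fun f => ?_, fun f => (hmem f).coeFn_toLp⟩
  change ‖(hmem f).toLp _‖ ≤ _
  rw [Lp.norm_toLp, Lp.norm_def, ← ENNReal.toReal_mul]
  exact ENNReal.toReal_mono (hfin f).ne (hle f)

theorem exists_continuousLinearMap_of_lintegral_sq_le
    (hG : AEStronglyMeasurable (Function.uncurry G) (μ.prod ν)) {C : ℝ≥0∞} (hC : C ≠ ⊤)
    (hbound : ∀ f : Lp 𝕜 2 ν,
      ∫⁻ x, (∫⁻ y, ‖G x y * f y‖ₑ ∂ν) ^ 2 ∂μ ≤ C ^ 2 * ∫⁻ y, ‖f y‖ₑ ^ 2 ∂ν) :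
    ∃ R : Lp 𝕜 2 ν →L[𝕜] Lp 𝕜 2 μ, ∀ f : Lp 𝕜 2 ν, ∀ᵐ x ∂μ,
      Integrable (fun y => G x y * f y) ν ∧ R f x = ∫ y, G x y * f y ∂ν := by
  have hint (f : Lp 𝕜 2 ν) : ∀ᵐ x ∂μ, Integrable (fun y => G x y * f y) ν := by
    refine ae_integrable_of_lintegral_lintegral_enorm_sq_ne_top
      (hG.mul (Lp.aestronglyMeasurable f).comp_snd) ((hbound f).trans_lt ?_).ne
    rw [← eLpNorm_two_sq]
    exact ENNReal.mul_lt_top (ENNReal.pow_lt_top hC.lt_top)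
      (ENNReal.pow_lt_top (Lp.eLpNorm_lt_top f))
  obtain ⟨R, hR⟩ := exists_continuousLinearMap_of_eLpNorm_integral_le (p := 2) hG hC hint
    fun f => by
      refine (ENNReal.pow_le_pow_left_iff two_ne_zero).1 ?_
      rw [mul_pow, eLpNorm_two_sq, eLpNorm_two_sq]
      refine (lintegral_mono fun x => ?_).trans (hbound f)
      gcongr
      exact enorm_integral_le_lintegral_enorm _
  exact ⟨R, fun f => (hint f).and (hR f)⟩

variable [SFinite μ]

theorem lintegral_lintegral_mul_sq_le {K : α → β → ℝ≥0∞} {h₁ : α → ℝ≥0∞} {h₂ F : β → ℝ≥0∞}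
    {A B : ℝ≥0∞} (hK : AEMeasurable (Function.uncurry K) (μ.prod ν)) (hh₁ : AEMeasurable h₁ μ)
    (hh₂ : AEMeasurable h₂ ν) (hF : AEMeasurable F ν) (h0 : ∀ᵐ y ∂ν, h₂ y ≠ 0)
    (htop : ∀ᵐ y ∂ν, h₂ y ≠ ⊤) (hA : ∀ᵐ x ∂μ, ∫⁻ y, K x y * h₂ y ∂ν ≤ A * h₁ x)
    (hB : ∀ᵐ y ∂ν, ∫⁻ x, K x y * h₁ x ∂μ ≤ B * h₂ y) :
    ∫⁻ x, (∫⁻ y, K x y * F y ∂ν) ^ 2 ∂μ ≤ A * B * ∫⁻ y, F y ^ 2 ∂ν := by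
  have hleft : ∀ᵐ x ∂μ, AEMeasurable (K x) ν :=
    hK.aestronglyMeasurable.prodMk_left.mono fun _ hx => hx.aemeasurable
  have hright : ∀ᵐ y ∂ν, AEMeasurable (fun x => K x y) μ :=
    hK.aestronglyMeasurable.prodMk_right.mono fun _ hy => hy.aemeasurable
  have hmeas : AEMeasurable (Function.uncurry fun x y => K x y * h₁ x * (F y ^ 2 / h₂ y))
      (μ.prod ν) :=
    (hK.mul hh₁.comp_fst).mul ((hF.pow_const 2).div hh₂).comp_snd
  calc ∫⁻ x, (∫⁻ y, K x y * F y ∂ν) ^ 2 ∂μ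
      ≤ ∫⁻ x, A * ∫⁻ y, K x y * h₁ x * (F y ^ 2 / h₂ y) ∂ν ∂μ := by
        refine lintegral_mono_ae ?_
        filter_upwards [hA, hleft] with x hx hKx
        calc (∫⁻ y, K x y * F y ∂ν) ^ 2
            ≤ (∫⁻ y, K x y * h₂ y ∂ν) * ∫⁻ y, K x y * (F y ^ 2 / h₂ y) ∂ν :=
              lintegral_mul_sq_le_lintegral_mul_lintegral_div hKx hF hh₂ h0 htop
          _ ≤ A * (h₁ x * ∫⁻ y, K x y * (F y ^ 2 / h₂ y) ∂ν) := by
              rw [← mul_assoc]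
              gcongr
          _ ≤ A * ∫⁻ y, K x y * h₁ x * (F y ^ 2 / h₂ y) ∂ν := by
              gcongr
              refine (lintegral_const_mul_le _ _).trans_eq (lintegral_congr fun y => ?_)
              ring
    _ = A * ∫⁻ y, ∫⁻ x, K x y * h₁ x * (F y ^ 2 / h₂ y) ∂μ ∂ν := by
        rw [lintegral_const_mul'' _ (by exact hmeas.lintegral_prod_right'),
          lintegral_lintegral_swap hmeas]
    _ ≤ A * ∫⁻ y, B * F y ^ 2 ∂ν := by
        gcongr 1
        refine lintegral_mono_ae ?_
        filter_upwards [hB, hright, h0, htop] with y hy hKy hy0 hytop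
        rw [lintegral_mul_const'' (f := fun x => K x y * h₁ x) _ (hKy.mul hh₁)]
        calc (∫⁻ x, K x y * h₁ x ∂μ) * (F y ^ 2 / h₂ y) ≤ B * h₂ y * (F y ^ 2 / h₂ y) := by gcongr
          _ = B * F y ^ 2 := by rw [mul_assoc, ENNReal.mul_div_cancel hy0 hytop]
    _ = A * B * ∫⁻ y, F y ^ 2 ∂ν := by
        rw [lintegral_const_mul'' _ (hF.pow_const 2), mul_assoc]

theorem exists_continuousLinearMap_of_schur
    (hG : AEStronglyMeasurable (Function.uncurry G) (μ.prod ν)) {h₁ : α → ℝ≥0∞} {h₂ : β → ℝ≥0∞}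
    {A : ℝ≥0∞} (hA : A ≠ ⊤) (hh₁ : AEMeasurable h₁ μ) (hh₂ : AEMeasurable h₂ ν)
    (h0 : ∀ᵐ y ∂ν, h₂ y ≠ 0) (htop : ∀ᵐ y ∂ν, h₂ y ≠ ⊤)
    (hleft : ∀ᵐ x ∂μ, ∫⁻ y, ‖G x y‖ₑ * h₂ y ∂ν ≤ A * h₁ x)
    (hright : ∀ᵐ y ∂ν, ∫⁻ x, ‖G x y‖ₑ * h₁ x ∂μ ≤ A * h₂ y) :
    ∃ R : Lp 𝕜 2 ν →L[𝕜] Lp 𝕜 2 μ, ∀ f : Lp 𝕜 2 ν, ∀ᵐ x ∂μ,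
      Integrable (fun y => G x y * f y) ν ∧ R f x = ∫ y, G x y * f y ∂ν := by
  refine exists_continuousLinearMap_of_lintegral_sq_le hG hA fun f => ?_
  simp only [enorm_mul, sq A]
  exact lintegral_lintegral_mul_sq_le hG.enorm hh₁ hh₂ (Lp.aestronglyMeasurable f).enorm h0 htop
    hleft hright

end Schur

/-! ### Bounded inverses of closed operators -/

theorem isBoundedInverse_of_isClosed {E : Type*} [NormedAddCommGroup E] [InnerProductSpace ℂ E]
    [CompleteSpace E] {A : E →ₗ.[ℂ] E} (hA : A.IsClosed) {c : ℂ} {R : E →L[ℂ] E}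
    (hleft : ∀ p ∈ A.graph, R (c • p.1 + p.2) = p.1)
    (hrange : ∀ g : E, (∀ p ∈ A.graph, inner ℂ g (c • p.1 + p.2) = 0) → g = 0) :
    IsBoundedInverse A c R := by
  let J : E →L[ℂ] E × E := R.prod (ContinuousLinearMap.id ℂ E - c • R)
  let S : Submodule ℂ E := A.graph.comap J.toLinearMap
  have hJ : ∀ p ∈ A.graph, J (c • p.1 + p.2) = p := fun p hp =>
    Prod.ext (hleft p hp) (by simp [J, hleft p hp])
  have : CompleteSpace S := (hA.preimage J.continuous).completeSpace_coe
  have hS : S = ⊤ := by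
    rw [← Submodule.orthogonal_eq_bot_iff, Submodule.eq_bot_iff]
    exact fun g hg => hrange g fun p hp =>
      Submodule.inner_left_of_mem_orthogonal ((congrArg (· ∈ A.graph) (hJ p hp)).mpr hp) hg
  refine ⟨fun u => hleft _ (A.mem_graph u), fun f => ?_⟩
  obtain ⟨u, hu, hAu⟩ := (LinearPMap.mem_graph_iff _).1 (show J f ∈ A.graph from
    (hS ▸ Submodule.mem_top : f ∈ S))
  exact ⟨u, hu, by rw [hu, hAu]; exact add_sub_cancel _ _⟩

/-! ### The resolvent kernel -/

/-- The weight controlling the resolvent kernel near the origin. -/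
def weight (s x : ℝ) : ℝ := 1 + x ^ (-s)

theorem measurable_weight (s : ℝ) : Measurable (weight s) := by
  unfold weight
  fun_prop

theorem one_le_weight (s : ℝ) {x : ℝ} (hx : 0 < x) : 1 ≤ weight s x :=
  le_add_of_nonneg_right (Real.rpow_pos_of_pos hx _).le

theorem rpow_le_weight {s a x : ℝ} (hx : 0 < x) (hx1 : x ≤ 1) (ha : -s ≤ a) :
    x ^ a ≤ weight s x :=
  (Real.rpow_le_rpow_of_exponent_ge hx hx1 ha).trans (le_add_of_nonneg_left zero_le_one)

theorem integrable_exp_neg_mul_abs {κ : ℝ} (hκ : 0 < κ) :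
    Integrable fun t : ℝ => Real.exp (-(κ * |t|)) := by
  have hpos : IntegrableOn (fun t : ℝ => Real.exp (-(κ * |t|))) (Ioi 0) := by
    refine (exp_neg_integrableOn_Ioi 0 hκ).congr_fun (fun t ht => ?_) measurableSet_Ioi
    simp only [abs_of_pos (mem_Ioi.1 ht), neg_mul]
  have hneg : IntegrableOn (fun t : ℝ => Real.exp (-(κ * |t|))) (Iic 0) := by
    rw [integrableOn_Iic_iff_integrableOn_Iio]
    simpa using hpos.comp_neg
  rw [← integrableOn_univ, ← Iic_union_Ioi (a := (0 : ℝ))]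
  exact hneg.union hpos

theorem weight_sq_mul_le {s y e : ℝ} (hs : 0 ≤ s) (hy : 0 < y) (he0 : 0 ≤ e) (he1 : e ≤ 1) :
    weight s y ^ 2 * e ≤ (Ioo (0 : ℝ) 1).indicator (fun t => 4 * t ^ (-(2 * s))) y + 4 * e := by
  have hpos : 0 < y ^ (-s) := Real.rpow_pos_of_pos hy _
  rw [weight]
  rcases lt_or_ge y 1 with hy1 | hy1
  · have hone : 1 ≤ y ^ (-s) := Real.one_le_rpow_of_pos_of_le_one_of_nonpos hy hy1.le (by linarith)
    have hsq : y ^ (-(2 * s)) = (y ^ (-s)) ^ 2 := by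
      rw [← Real.rpow_mul_natCast hy.le]
      congr 1
      push_cast
      ring
    rw [indicator_of_mem (show y ∈ Ioo (0 : ℝ) 1 from ⟨hy, hy1⟩), hsq]
    nlinarith [mul_le_mul_of_nonneg_left he1 (sq_nonneg (1 + y ^ (-s)))]
  · have hone : y ^ (-s) ≤ 1 := Real.rpow_le_one_of_one_le_of_nonpos hy1 (by linarith)
    rw [indicator_of_notMem fun h => hy1.not_gt h.2, zero_add]
    gcongr
    nlinarith

theorem exists_lintegral_weight_le {s κ : ℝ} (hs0 : 0 ≤ s) (hs : s < 1 / 2) (hκ : 0 < κ) :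
    ∃ M : ENNReal, M ≠ ⊤ ∧ ∀ x : ℝ, ∫⁻ y in Ioi (0 : ℝ),
      ENNReal.ofReal (weight s y ^ 2 * Real.exp (-(κ * |x - y|))) ≤ M := by
  set g : ℝ → ℝ := (Ioo (0 : ℝ) 1).indicator fun t => 4 * t ^ (-(2 * s))
  have hg : Integrable g :=
    (integrable_indicator_iff measurableSet_Ioo).2
      (((intervalIntegral.integrableOn_Ioo_rpow_iff one_pos).2 (by linarith)).const_mul 4)
  have hgmeas : Measurable g := Measurable.indicator (by fun_prop) measurableSet_Ioo
  have hexp := (integrable_exp_neg_mul_abs hκ).const_mul 4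
  refine ⟨(∫⁻ y, ENNReal.ofReal (g y)) + ∫⁻ t : ℝ, ENNReal.ofReal (4 * Real.exp (-(κ * |t|))),
    ENNReal.add_ne_top.2 ⟨hg.lintegral_lt_top.ne, hexp.lintegral_lt_top.ne⟩, fun x => ?_⟩
  rw [← lintegral_sub_left_eq_self (fun t : ℝ => ENNReal.ofReal (4 * Real.exp (-(κ * |t|)))) x,
    ← lintegral_add_left hgmeas.ennreal_ofReal]
  refine (setLIntegral_mono (by fun_prop) fun y hy => ?_).trans (setLIntegral_le_lintegral _ _)
  have hexp_le : Real.exp (-(κ * |x - y|)) ≤ 1 :=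
    Real.exp_le_one_iff.2 (neg_nonpos.2 (mul_nonneg hκ.le (abs_nonneg _)))
  exact (ENNReal.ofReal_le_ofReal (weight_sq_mul_le hs0 hy (Real.exp_pos _).le hexp_le)).trans
    ENNReal.ofReal_add_le

theorem lintegral_enorm_mul_weight_le {G : ℝ → ℂ} {C s κ x : ℝ} {M : ENNReal} (hC : 0 ≤ C)
    (hx : 0 < x) (hG : ∀ y, 0 < y →
      ‖G y‖ ≤ C * (weight s x * weight s y * Real.exp (-(κ * |x - y|))))
    (hM : ∫⁻ y in Ioi (0 : ℝ), ENNReal.ofReal (weight s y ^ 2 * Real.exp (-(κ * |x - y|))) ≤ M) :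
    ∫⁻ y in Ioi 0, ‖G y‖ₑ * ENNReal.ofReal (weight s y) ≤
      ENNReal.ofReal C * M * ENNReal.ofReal (weight s x) := by
  have hmeas := measurable_weight s
  have hwx : 0 ≤ weight s x := zero_le_one.trans (one_le_weight _ hx)
  calc ∫⁻ y in Ioi 0, ‖G y‖ₑ * ENNReal.ofReal (weight s y)
      ≤ ∫⁻ y in Ioi 0, ENNReal.ofReal (C * weight s x) *
          ENNReal.ofReal (weight s y ^ 2 * Real.exp (-(κ * |x - y|))) := by
        refine setLIntegral_mono (by fun_prop) fun y hy => ?_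
        rw [← ofReal_norm, ← ENNReal.ofReal_mul (norm_nonneg _),
          ← ENNReal.ofReal_mul (by positivity)]
        refine ENNReal.ofReal_le_ofReal ((mul_le_mul_of_nonneg_right (hG y hy)
          (zero_le_one.trans (one_le_weight _ hy))).trans_eq ?_)
        ring
    _ ≤ ENNReal.ofReal (C * weight s x) * M := by
        rw [lintegral_const_mul _ (by fun_prop)]
        gcongr
    _ = ENNReal.ofReal C * M * ENNReal.ofReal (weight s x) := by
        rw [ENNReal.ofReal_mul hC, mul_right_comm]

theorem memLp_weight_mul_exp {s κ : ℝ} (hs0 : 0 ≤ s) (hs : s < 1 / 2) (hκ : 0 < κ) (x : ℝ) :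
    MemLp (fun y => weight s y * Real.exp (-(κ * |x - y|))) 2 halfMeasure := by
  have hmeas := measurable_weight s
  rw [memLp_two_iff_integrable_sq (by fun_prop)]
  obtain ⟨M, hM0, hM⟩ := exists_lintegral_weight_le hs0 hs (κ := 2 * κ) (by linarith)
  refine ⟨by fun_prop, ?_⟩
  rw [hasFiniteIntegral_iff_ofReal (Eventually.of_forall fun y => sq_nonneg _)]
  refine lt_of_le_of_lt (le_of_eq (lintegral_congr fun y => ?_)) ((hM x).trans_lt hM0.lt_top)
  rw [mul_pow, ← Real.exp_nat_mul]
  congr 3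
  push_cast
  ring

/-- The order of the singularity of `x^{1/2+m}` at the origin, which serves as the exponent of the
weight in Schur's test for the resolvent kernel. -/
def singularExponent (m : ℂ) : ℝ := max 0 (-(1 / 2 + m.re))

section Kernel

variable {m k : ℂ}

theorem singularExponent_nonneg (m : ℂ) : 0 ≤ singularExponent m := le_max_left _ _

theorem neg_singularExponent_le (m : ℂ) : -singularExponent m ≤ 1 / 2 + m.re :=
  neg_le.1 (le_max_right _ _)

theorem singularExponent_lt (hm : -1 < m.re) : singularExponent m < 1 / 2 :=
  max_lt one_half_pos (by linarith)

theorem exists_norm_solI_le_exp (m : ℂ) (hk : 0 < k.re) :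
    ∃ C : ℝ, 0 ≤ C ∧ ∀ x : ℝ, 1 ≤ x → ‖solI m k x‖ ≤ C * Real.exp (k.re * x) :=
  (isSolution_solI m hk).exists_norm_le_exp hk fun x _ => (norm_besselPotential_sub m k x).le

theorem exists_norm_solI_le (m : ℂ) (hk : 0 < k.re) : ∃ C : ℝ, 0 ≤ C ∧ ∀ x : ℝ, 0 < x →
    ‖solI m k x‖ ≤ C * weight (singularExponent m) x * Real.exp (k.re * x) := by
  obtain ⟨A, hA0, hA⟩ := exists_norm_solI_le_rpow m hk
  obtain ⟨B, -, hB⟩ := exists_norm_solI_le_exp m hk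
  refine ⟨max A B, hA0.trans (le_max_left A B), fun x hx => ?_⟩
  have hw := one_le_weight (singularExponent m) hx
  have hC : 0 ≤ max A B := hA0.trans (le_max_left A B)
  rcases le_total x 1 with hx1 | hx1
  · calc ‖solI m k x‖ ≤ A * x ^ (1 / 2 + m.re) := hA x hx hx1
      _ ≤ max A B * weight (singularExponent m) x := by
        gcongr
        · exact le_max_left A B
        · exact rpow_le_weight hx hx1 (neg_singularExponent_le m)
      _ ≤ max A B * weight (singularExponent m) x * Real.exp (k.re * x) :=
        le_mul_of_one_le_right (by positivity) (Real.one_le_exp (by positivity))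
  · calc ‖solI m k x‖ ≤ B * Real.exp (k.re * x) := hB x hx1
      _ ≤ max A B * weight (singularExponent m) x * Real.exp (k.re * x) := by
        gcongr
        exact (le_max_right A B).trans (le_mul_of_one_le_right hC hw)

theorem exists_rpow_mul_rpow_le_weight_mul_weight (m : ℂ) : ∃ σ : ℝ, 0 < σ ∧ |m.re| ≤ σ ∧
    ∀ x y : ℝ, 0 < x → x ≤ y → y ≤ 1 → x ^ (1 / 2 + m.re) * y ^ (1 / 2 - σ) ≤
      weight (singularExponent m) x * weight (singularExponent m) y := by
  rcases le_or_gt 0 m.re with hm | hm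
  · refine ⟨m.re + 1 / 4, by linarith, by rw [abs_of_nonneg hm]; linarith,
      fun x y hx hxy hy1 => ?_⟩
    have hy : 0 < y := hx.trans_le hxy
    calc x ^ (1 / 2 + m.re) * y ^ (1 / 2 - (m.re + 1 / 4))
        ≤ y ^ (1 / 2 + m.re) * y ^ (1 / 2 - (m.re + 1 / 4)) := by gcongr
      _ = y ^ (3 / 4 : ℝ) := by rw [← Real.rpow_add hy]; ring_nf
      _ ≤ 1 := Real.rpow_le_one hy.le hy1 (by norm_num)
      _ ≤ _ := one_le_mul_of_one_le_of_one_le (one_le_weight _ hx) (one_le_weight _ hy)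
  · refine ⟨-m.re, by linarith, (abs_of_neg hm).le, fun x y hx hxy hy1 => ?_⟩
    have hy : 0 < y := hx.trans_le hxy
    rw [sub_neg_eq_add]
    exact mul_le_mul (rpow_le_weight hx (hxy.trans hy1) (neg_singularExponent_le m))
      (rpow_le_weight hy hy1 (neg_singularExponent_le m)) (Real.rpow_pos_of_pos hy _).le
      (zero_le_one.trans (one_le_weight _ hx))

theorem exists_norm_solI_mul_solK_le_of_le_one (m : ℂ) (hk : 0 < k.re) : ∃ C : ℝ, 0 ≤ C ∧
    ∀ x y : ℝ, 0 < x → x ≤ y → y ≤ 1 → ‖solI m k x * solK m k y‖ ≤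
      C * (weight (singularExponent m) x * weight (singularExponent m) y) := by
  obtain ⟨σ, hσ0, hσ, hpow⟩ := exists_rpow_mul_rpow_le_weight_mul_weight m
  obtain ⟨A, hA0, hA⟩ := exists_norm_solI_le_rpow m hk
  obtain ⟨D, hD0, hD⟩ := exists_norm_solK_le_rpow (m := m) hk hσ0 hσ
  refine ⟨A * D, by positivity, fun x y hx hxy hy1 => ?_⟩
  have hy : 0 < y := hx.trans_le hxy
  calc ‖solI m k x * solK m k y‖
      ≤ (A * x ^ (1 / 2 + m.re)) * (D * y ^ (1 / 2 - σ)) := by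
        rw [norm_mul]
        exact mul_le_mul (hA x hx (hxy.trans hy1)) (hD y hy) (norm_nonneg _) (by positivity)
    _ = A * D * (x ^ (1 / 2 + m.re) * y ^ (1 / 2 - σ)) := by ring
    _ ≤ A * D * (weight (singularExponent m) x * weight (singularExponent m) y) := by
        gcongr A * D * ?_
        exact hpow x y hx hxy hy1

theorem exists_norm_solI_mul_solK_le (m : ℂ) (hk : 0 < k.re) : ∃ C : ℝ, 0 ≤ C ∧
    ∀ x y : ℝ, 0 < x → x ≤ y → ‖solI m k x * solK m k y‖ ≤
      C * (weight (singularExponent m) x * weight (singularExponent m) y *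
        Real.exp (-(k.re * (y - x)))) := by
  obtain ⟨A, hA0, hA⟩ := exists_norm_solI_mul_solK_le_of_le_one m hk
  obtain ⟨B, hB0, hB⟩ := exists_norm_solI_le m hk
  obtain ⟨E, hE0, hE⟩ := exists_norm_solK_le_exp m hk
  refine ⟨A * Real.exp k.re + B * E, by positivity, fun x y hx hxy => ?_⟩
  have hwx := one_le_weight (singularExponent m) hx
  have hwy := one_le_weight (singularExponent m) (hx.trans_le hxy)
  set w := weight (singularExponent m)
  rcases le_total y 1 with hy1 | hy1
  · calc ‖solI m k x * solK m k y‖ ≤ A * (w x * w y) * 1 := by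
          rw [mul_one]
          exact hA x y hx hxy hy1
      _ ≤ A * (w x * w y) * (Real.exp k.re * Real.exp (-(k.re * (y - x)))) := by
          gcongr
          rw [← Real.exp_add, Real.one_le_exp_iff]
          nlinarith
      _ = A * Real.exp k.re * (w x * w y * Real.exp (-(k.re * (y - x)))) := by ring
      _ ≤ _ := by
          gcongr
          exact le_add_of_nonneg_right (by positivity)
  · calc ‖solI m k x * solK m k y‖
        ≤ (B * w x * Real.exp (k.re * x)) * (E * Real.exp (-(k.re * y))) := by
          rw [norm_mul]
          exact mul_le_mul (hB x hx) (hE y hy1) (norm_nonneg _) (by positivity)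
      _ = B * E * (w x * 1 * Real.exp (-(k.re * (y - x)))) := by
          rw [show -(k.re * (y - x)) = k.re * x + -(k.re * y) by ring, Real.exp_add]
          ring
      _ ≤ _ := by
          gcongr
          exact le_add_of_nonneg_left (by positivity)

theorem resolventKernel_of_lt (m k : ℂ) {x y : ℝ} (hx : 0 < x) (h : x < y) :
    resolventKernel m k x y = solI m k x * solK m k y := by
  rw [resolventKernel, if_pos h, Real.sqrt_mul hx.le, solI, solK]
  push_cast
  ring

theorem resolventKernel_of_le (m k : ℂ) {x y : ℝ} (hx : 0 < x) (h : y ≤ x) :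
    resolventKernel m k x y = solI m k y * solK m k x := by
  rw [resolventKernel, if_neg (not_lt.2 h), Real.sqrt_mul hx.le, solI, solK]
  push_cast
  ring

theorem exists_norm_resolventKernel_le (m : ℂ) (hk : 0 < k.re) : ∃ C : ℝ, 0 ≤ C ∧
    ∀ x y : ℝ, 0 < x → 0 < y → ‖resolventKernel m k x y‖ ≤
      C * (weight (singularExponent m) x * weight (singularExponent m) y *
        Real.exp (-(k.re * |x - y|))) := by
  obtain ⟨C, hC0, hC⟩ := exists_norm_solI_mul_solK_le m hk
  refine ⟨C, hC0, fun x y hx hy => ?_⟩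
  rcases lt_or_ge x y with h | h
  · rw [resolventKernel_of_lt m k hx h, abs_sub_comm, abs_of_pos (sub_pos.2 h)]
    exact hC x y hx h.le
  · rw [resolventKernel_of_le m k hx h, abs_of_nonneg (sub_nonneg.2 h), mul_comm (weight _ x)]
    exact hC y x hy h

theorem continuousOn_besselI_mul (m : ℂ) (hk : 0 < k.re) :
    ContinuousOn (fun x : ℝ => besselI m (k * x)) (Ioi 0) := fun _ hx =>
  (hasDerivAt_comp_mul_ofReal
    (hasDerivAt_besselI m (re_mul_ofReal_pos hk hx))).continuousAt.continuousWithinAt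

theorem continuousOn_besselK_mul (m : ℂ) (hk : 0 < k.re) :
    ContinuousOn (fun x : ℝ => besselK m (k * x)) (Ioi 0) := fun _ hx =>
  (hasDerivAt_comp_mul_ofReal
    (hasDerivAt_besselK m (re_mul_ofReal_pos hk hx))).continuousAt.continuousWithinAt

theorem aestronglyMeasurable_resolventKernel (m : ℂ) (hk : 0 < k.re) :
    AEStronglyMeasurable (Function.uncurry (resolventKernel m k))
      (halfMeasure.prod halfMeasure) := by
  have hI : AEStronglyMeasurable (fun x : ℝ => besselI m (k * x)) halfMeasure :=
    (continuousOn_besselI_mul m hk).aestronglyMeasurable measurableSet_Ioi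
  have hK : AEStronglyMeasurable (fun x : ℝ => besselK m (k * x)) halfMeasure :=
    (continuousOn_besselK_mul m hk).aestronglyMeasurable measurableSet_Ioi
  have hsqrt : AEStronglyMeasurable (fun p : ℝ × ℝ => (√(p.1 * p.2) : ℂ))
      (halfMeasure.prod halfMeasure) :=
    Continuous.aestronglyMeasurable (by fun_prop)
  classical
  refine (AEStronglyMeasurable.piecewise (measurableSet_lt measurable_fst measurable_snd)
    ((hsqrt.mul hI.comp_fst).mul hK.comp_snd).restrict
    ((hsqrt.mul hI.comp_snd).mul hK.comp_fst).restrict).congr (Eventually.of_forall fun p => ?_)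
  simp [piecewise, Function.uncurry_def, resolventKernel]

theorem exists_hasIntegralKernel_resolventKernel (hm : -1 < m.re) (hk : 0 < k.re) :
    ∃ R : L2 →L[ℂ] L2, HasIntegralKernel R (resolventKernel m k) := by
  obtain ⟨C, hC0, hC⟩ := exists_norm_resolventKernel_le m hk
  obtain ⟨M, hM0, hM⟩ :=
    exists_lintegral_weight_le (singularExponent_nonneg m) (singularExponent_lt hm) hk
  have hmeas := measurable_weight (singularExponent m)
  have hw_pos : ∀ᵐ y ∂halfMeasure, ENNReal.ofReal (weight (singularExponent m) y) ≠ 0 := by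
    filter_upwards [ae_restrict_mem measurableSet_Ioi] with y hy
    exact (ENNReal.ofReal_pos.2 (zero_lt_one.trans_le (one_le_weight _ hy))).ne'
  have hG := aestronglyMeasurable_resolventKernel m hk
  obtain ⟨R, hR⟩ := exists_continuousLinearMap_of_schur hG
    (ENNReal.mul_ne_top ENNReal.ofReal_ne_top hM0) hmeas.ennreal_ofReal.aemeasurable
    hmeas.ennreal_ofReal.aemeasurable hw_pos (Eventually.of_forall fun _ => ENNReal.ofReal_ne_top)
    ((ae_restrict_mem measurableSet_Ioi).mono fun x hx =>
      lintegral_enorm_mul_weight_le hC0 hx (fun y => hC x y hx) (hM x))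
    ((ae_restrict_mem measurableSet_Ioi).mono fun y hy =>
      lintegral_enorm_mul_weight_le hC0 hy (fun x hx => by
        rw [abs_sub_comm, mul_comm (weight _ y)]
        exact hC x y hx hy) (hM y))
  exact ⟨R, hG, hR⟩

end Kernel

/-! ### Variation of parameters -/

/-- `η` solves the inhomogeneous equation `-η'' + q η = g` on `(0, ∞)`, with derivative `η₁`; as in
`IsSolution`, the equation is encoded as a first order system. -/
def IsForcedSolution (q g η η₁ : ℝ → ℂ) : Prop :=
  ∀ x, 0 < x → HasDerivAt η (η₁ x) x ∧ HasDerivAt η₁ (q x * η x - g x) x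

section Green

variable {q u u₁ g η η₁ : ℝ → ℂ}

theorem IsForcedSolution.hasDerivAt_wronskian {h φ φ₁ : ℝ → ℂ} (hη : IsForcedSolution q g η η₁)
    (hφ : IsForcedSolution q h φ φ₁) {x : ℝ} (hx : 0 < x) :
    HasDerivAt (fun x => η₁ x * φ x - η x * φ₁ x) (η x * h x - g x * φ x) x := by
  refine (((hη x hx).2.mul (hφ x hx).1).sub ((hη x hx).1.mul (hφ x hx).2)).congr_deriv ?_
  ring

theorem IsSolution.isForcedSolution (hu : IsSolution q u u₁) : IsForcedSolution q 0 u u₁ :=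
  fun x hx => ⟨(hu x hx).1, (hu x hx).2.congr_deriv (sub_zero _).symm⟩

theorem IsSolution.hasDerivAt_wronskian (hu : IsSolution q u u₁) (hη : IsForcedSolution q g η η₁)
    {x : ℝ} (hx : 0 < x) : HasDerivAt (fun x => u₁ x * η x - u x * η₁ x) (u x * g x) x :=
  (hu.isForcedSolution.hasDerivAt_wronskian hη hx).congr_deriv
    (by rw [Pi.zero_apply, zero_mul, sub_zero])

theorem IsSolution.integral_Ioi_mul (hu : IsSolution q u u₁) (hη : IsForcedSolution q g η η₁)
    {x : ℝ} (hx : 0 < x) (hint : IntegrableOn (fun y => u y * g y) (Ioi x))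
    (hlim : Tendsto (fun y => u₁ y * η y - u y * η₁ y) atTop (𝓝 0)) :
    ∫ y in Ioi x, u y * g y = u x * η₁ x - u₁ x * η x := by
  rw [integral_Ioi_of_hasDerivAt_of_tendsto'
    (fun y hy => hu.hasDerivAt_wronskian hη (hx.trans_le hy)) hint hlim]
  ring

theorem IsSolution.integral_Ioc_mul (hu : IsSolution q u u₁) (hη : IsForcedSolution q g η η₁)
    {x : ℝ} (hx : 0 < x) (hint : IntegrableOn (fun y => u y * g y) (Ioc 0 x))
    (hlim : Tendsto (fun y => u₁ y * η y - u y * η₁ y) (𝓝[>] 0) (𝓝 0)) :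
    ∫ y in Ioc 0 x, u y * g y = u₁ x * η x - u x * η₁ x := by
  rw [← intervalIntegral.integral_of_le hx.le,
    intervalIntegral.integral_eq_sub_of_hasDerivAt_of_tendsto hx
      (fun y hy => hu.hasDerivAt_wronskian hη hy.1)
      ((intervalIntegrable_iff_integrableOn_Ioc_of_le hx.le).2 hint) hlim
      ((hu.hasDerivAt_wronskian hη hx).continuousAt.tendsto.mono_left nhdsWithin_le_nhds),
    sub_zero]

end Green

theorem integrableOn_mul_of_memLp_two {u g : ℝ → ℂ} {S : Set ℝ} (hS : S ⊆ Ioi 0)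
    (hu : MemLp u 2 (volume.restrict S)) (hg : MemLp g 2 halfMeasure) :
    IntegrableOn (fun y => u y * g y) S :=
  hu.integrable_mul (hg.mono_measure (Measure.restrict_mono hS le_rfl))

theorem Ioi_subset_Ioi_zero {x : ℝ} (hx : 0 < x) : Ioi x ⊆ Ioi 0 := Ioi_subset_Ioi hx.le

section LeftInverse

variable {m k : ℂ}

theorem memLp_solI_Ioc (hm : -1 < m.re) (hk : 0 < k.re) (x : ℝ) :
    MemLp (solI m k) 2 (volume.restrict (Ioc 0 x)) := by
  obtain ⟨C, -, hC⟩ := exists_norm_solI_le m hk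
  have hsub : Ioc 0 x ⊆ Ioi 0 := fun y hy => hy.1
  refine (((memLp_weight_mul_exp (singularExponent_nonneg m) (singularExponent_lt hm) hk
    x).mono_measure (Measure.restrict_mono hsub le_rfl)).const_mul
      (C * Real.exp (k.re * x))).mono'
    (((isSolution_solI m hk).continuousOn.mono hsub).aestronglyMeasurable measurableSet_Ioc) ?_
  filter_upwards [ae_restrict_mem measurableSet_Ioc] with y hy
  have hexp : Real.exp (k.re * y) = Real.exp (k.re * x) * Real.exp (-(k.re * |x - y|)) := by
    rw [abs_of_nonneg (sub_nonneg.2 hy.2), ← Real.exp_add]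
    ring_nf
  refine (hC y hy.1).trans_eq ?_
  rw [hexp]
  ring

theorem memLp_two_of_norm_le_exp {f : ℝ → ℂ} {C κ a : ℝ} (hκ : 0 < κ) (hf : ContinuousOn f (Ioi a))
    (hC : ∀ x, a < x → ‖f x‖ ≤ C * Real.exp (-(κ * x))) :
    MemLp f 2 (volume.restrict (Ioi a)) := by
  have hexp : MemLp (fun x : ℝ => Real.exp (-(κ * x))) 2 (volume.restrict (Ioi a)) := by
    rw [memLp_two_iff_integrable_sq (by fun_prop)]
    refine (exp_neg_integrableOn_Ioi a (b := 2 * κ) (by linarith)).congr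
      (Eventually.of_forall fun x => ?_)
    simp only
    rw [← Real.exp_nat_mul]
    push_cast
    ring_nf
  exact (hexp.const_mul C).mono' (hf.aestronglyMeasurable measurableSet_Ioi)
    ((ae_restrict_mem measurableSet_Ioi).mono hC)

theorem memLp_solK_Ioi (m : ℂ) (hk : 0 < k.re) {x : ℝ} (hx : 0 < x) :
    MemLp (solK m k) 2 (volume.restrict (Ioi x)) := by
  have hcont := (isSolution_solK m hk).continuousOn
  obtain ⟨C, -, hC⟩ := exists_norm_solK_le_exp m hk
  obtain ⟨D, hD⟩ := (isCompact_Icc (a := x) (b := 1)).exists_bound_of_continuousOn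
    (f := fun y : ℝ => solK m k y * Real.exp (k.re * y))
    ((hcont.mono fun y hy => hx.trans_le hy.1).mul (by fun_prop))
  refine memLp_two_of_norm_le_exp (C := max C D) hk (hcont.mono (Ioi_subset_Ioi_zero hx))
    fun y hy => ?_
  rcases le_total y 1 with hy1 | hy1
  · have h := hD y ⟨hy.le, hy1⟩
    rw [norm_mul, Complex.norm_real, Real.norm_of_nonneg (Real.exp_pos _).le] at h
    rw [Real.exp_neg, ← div_eq_mul_inv, le_div_iff₀ (Real.exp_pos _)]
    exact h.trans (le_max_right C D)
  · refine (hC y hy1).trans ?_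
    gcongr
    exact le_max_left _ _

theorem integrableOn_solI_mul (hm : -1 < m.re) (hk : 0 < k.re) {g : ℝ → ℂ}
    (hg : MemLp g 2 halfMeasure) (x : ℝ) : IntegrableOn (fun y => solI m k y * g y) (Ioc 0 x) :=
  integrableOn_mul_of_memLp_two (fun _ hy => hy.1) (memLp_solI_Ioc hm hk x) hg

theorem integrableOn_solK_mul (m : ℂ) (hk : 0 < k.re) {g : ℝ → ℂ}
    (hg : MemLp g 2 halfMeasure) {x : ℝ} (hx : 0 < x) :
    IntegrableOn (fun y => solK m k y * g y) (Ioi x) :=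
  integrableOn_mul_of_memLp_two (Ioi_subset_Ioi_zero hx) (memLp_solK_Ioi m hk hx) hg

theorem integral_resolventKernel_mul (hm : -1 < m.re) (hk : 0 < k.re) {g : ℝ → ℂ}
    (hg : MemLp g 2 halfMeasure) {x : ℝ} (hx : 0 < x) :
    ∫ y in Ioi (0 : ℝ), resolventKernel m k x y * g y =
      solK m k x * (∫ y in Ioc 0 x, solI m k y * g y) +
        solI m k x * ∫ y in Ioi x, solK m k y * g y := by
  have hle : EqOn (fun y => solK m k x * (solI m k y * g y))
      (fun y => resolventKernel m k x y * g y) (Ioc 0 x) := fun y hy => by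
    simp only [resolventKernel_of_le m k hx hy.2]
    ring
  have hlt : EqOn (fun y => solI m k x * (solK m k y * g y))
      (fun y => resolventKernel m k x y * g y) (Ioi x) := fun y hy => by
    simp only [resolventKernel_of_lt m k hx hy]
    ring
  rw [← Ioc_union_Ioi_eq_Ioi hx.le, setIntegral_union (Ioc_disjoint_Ioi le_rfl) measurableSet_Ioi
    (IntegrableOn.congr_fun ((integrableOn_solI_mul hm hk hg x).const_mul _) hle measurableSet_Ioc)
    (IntegrableOn.congr_fun ((integrableOn_solK_mul m hk hg hx).const_mul _) hlt measurableSet_Ioi),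
    ← setIntegral_congr_fun measurableSet_Ioc hle, ← setIntegral_congr_fun measurableSet_Ioi hlt,
    integral_const_mul, integral_const_mul]

theorem tendsto_zero_of_eventually_eq_zero {l : Filter ℝ} {u u₁ η η₁ : ℝ → ℂ}
    (h : ∀ᶠ x in l, η x = 0 ∧ η₁ x = 0) :
    Tendsto (fun x => u₁ x * η x - u x * η₁ x) l (𝓝 0) := by
  refine tendsto_const_nhds.congr' ?_
  filter_upwards [h] with x hx
  rw [hx.1, hx.2, mul_zero, mul_zero, sub_zero]

theorem integral_Ioi_solK_mul (hk : 0 < k.re) {g η η₁ : ℝ → ℂ}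
    (hη : IsForcedSolution (besselPotential m k) g η η₁) (hg : MemLp g 2 halfMeasure)
    (htop : ∀ᶠ x in atTop, η x = 0 ∧ η₁ x = 0) {x : ℝ} (hx : 0 < x) :
    ∫ y in Ioi x, solK m k y * g y = solK m k x * η₁ x - solK' m k x * η x :=
  (isSolution_solK m hk).integral_Ioi_mul hη hx (integrableOn_solK_mul m hk hg hx)
    (tendsto_zero_of_eventually_eq_zero htop)

theorem resolvent_apply_ae_eq {R : L2 →L[ℂ] L2} (hR : HasIntegralKernel R (resolventKernel m k))
    (hm : -1 < m.re) (hk : 0 < k.re) {g η η₁ : ℝ → ℂ}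
    (hη : IsForcedSolution (besselPotential m k) g η η₁) (hg : MemLp g 2 halfMeasure)
    (htop : ∀ᶠ x in atTop, η x = 0 ∧ η₁ x = 0)
    (hzero : Tendsto (fun x => solI' m k x * η x - solI m k x * η₁ x) (𝓝[>] 0) (𝓝 0)) :
    R (hg.toLp g) =ᵐ[halfMeasure] η := by
  filter_upwards [hR.2 (hg.toLp g), ae_restrict_mem measurableSet_Ioi] with x hRx hx
  have hcongr : ∫ y in Ioi (0 : ℝ), resolventKernel m k x y * hg.toLp g y =
      ∫ y in Ioi (0 : ℝ), resolventKernel m k x y * g y :=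
    integral_congr_ae (hg.coeFn_toLp.mono fun y hy => congrArg _ hy)
  rw [hRx.2, hcongr, integral_resolventKernel_mul hm hk hg hx,
    (isSolution_solI m hk).integral_Ioc_mul hη hx (integrableOn_solI_mul hm hk hg x) hzero,
    integral_Ioi_solK_mul hk hη hg htop hx]
  linear_combination η x * solI_solK_wronskian m hk hx

end LeftInverse

/-! ### Green's formula -/

/-- The potential `(-1/4 + α) x⁻²` of the differential expression `L_α`. -/
def inverseSquarePotential (α : ℂ) (x : ℝ) : ℂ := (-1 / 4 + α) / (x : ℂ) ^ 2

section TestFunction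

variable (φ : 𝓓(halfLine, ℂ))

theorem eventually_eq_zero_atTop_of_hasCompactSupport {E : Type*} [Zero E] {f : ℝ → E}
    (hf : HasCompactSupport f) : ∀ᶠ x in atTop, f x = 0 :=
  (coclosedCompact_eq_cocompact (X := ℝ) ▸ atTop_le_cocompact)
    (hasCompactSupport_iff_eventuallyEq.1 hf)

theorem testFunction_eventually_eq_zero_atTop : ∀ᶠ x in atTop, φ x = 0 ∧ deriv φ x = 0 :=
  (eventually_eq_zero_atTop_of_hasCompactSupport φ.hasCompactSupport').and
    (eventually_eq_zero_atTop_of_hasCompactSupport (HasCompactSupport.deriv φ.hasCompactSupport'))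

theorem testFunction_eventually_eq_zero_nhds_zero :
    ∀ᶠ x in 𝓝 0, φ x = 0 ∧ deriv φ x = 0 := by
  have hφ := notMem_tsupport_iff_eventuallyEq.1
    fun h : (0 : ℝ) ∈ tsupport φ => lt_irrefl (0 : ℝ) (φ.tsupport_subset' h)
  filter_upwards [hφ, hφ.deriv] with x hx hx'
  exact ⟨hx, hx'.trans (by simp)⟩

theorem isForcedSolution_testFunction (α : ℂ) :
    IsForcedSolution (inverseSquarePotential α) (diffExpr α φ) φ (deriv φ) := fun x _ =>
  ⟨(testFunction_differentiable φ x).hasDerivAt,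
    (testFunction_differentiable_deriv φ x).hasDerivAt.congr_deriv (by
      rw [diffExpr, inverseSquarePotential]
      ring)⟩

end TestFunction

section ForcedSolution

variable {α m k : ℂ} {g η η₁ : ℝ → ℂ}

theorem IsForcedSolution.integral_mul_diffExpr
    (hη : IsForcedSolution (inverseSquarePotential α) g η η₁) (mη : MemLp η 2 halfMeasure)
    (mg : MemLp g 2 halfMeasure) (φ : 𝓓(halfLine, ℂ)) :
    ∫ x in Ioi (0 : ℝ), η x * diffExpr α φ x = ∫ x in Ioi (0 : ℝ), g x * φ x := by
  have hint : Integrable (fun x => η x * diffExpr α φ x) halfMeasure :=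
    mη.integrable_mul (memLp_diffExpr φ α)
  have hint' : Integrable (fun x => g x * φ x) halfMeasure :=
    mg.integrable_mul (memLp_testFunction φ)
  have hzero : (fun x => η₁ x * φ x - η x * deriv φ x) =ᶠ[𝓝 0] fun _ => 0 := by
    filter_upwards [testFunction_eventually_eq_zero_nhds_zero φ] with x hx
    rw [hx.1, hx.2, mul_zero, mul_zero, sub_zero]
  rw [← sub_eq_zero, ← integral_sub hint hint', integral_Ioi_of_hasDerivAt_of_tendsto
    (continuousAt_const.congr hzero.symm).continuousWithinAt
    (fun x hx => hη.hasDerivAt_wronskian (isForcedSolution_testFunction φ α) hx)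
    (hint.sub hint')
    (tendsto_zero_of_eventually_eq_zero (testFunction_eventually_eq_zero_atTop φ)),
    hzero.eq_of_nhds, sub_zero]

theorem IsForcedSolution.toLp_mem_maxGraph
    (hη : IsForcedSolution (inverseSquarePotential α) g η η₁) (mη : MemLp η 2 halfMeasure)
    (mg : MemLp g 2 halfMeasure) :
    (mη.toLp η, mg.toLp g) ∈ maxGraph α := fun φ => by
  rw [integral_congr_ae (mη.coeFn_toLp.mono fun x hx => congrArg (· * diffExpr α φ x) hx),
    integral_congr_ae (mg.coeFn_toLp.mono fun x hx => congrArg (· * φ x) hx)]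
  exact hη.integral_mul_diffExpr mη mg φ

theorem IsForcedSolution.besselPotential (k : ℂ)
    (hη : IsForcedSolution (inverseSquarePotential (m ^ 2)) g η η₁) :
    IsForcedSolution (besselPotential m k) (k ^ 2 • η + g) η η₁ := fun x hx =>
  ⟨(hη x hx).1, (hη x hx).2.congr_deriv (by
    simp only [BesselOp.besselPotential, inverseSquarePotential, Pi.add_apply, Pi.smul_apply,
      smul_eq_mul]
    ring)⟩

theorem IsForcedSolution.resolvent_apply {R : L2 →L[ℂ] L2}
    (hη : IsForcedSolution (inverseSquarePotential (m ^ 2)) g η η₁)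
    (mη : MemLp η 2 halfMeasure) (mg : MemLp g 2 halfMeasure)
    (hR : HasIntegralKernel R (resolventKernel m k)) (hm : -1 < m.re) (hk : 0 < k.re)
    (htop : ∀ᶠ x in atTop, η x = 0 ∧ η₁ x = 0)
    (hzero : Tendsto (fun x => solI' m k x * η x - solI m k x * η₁ x) (𝓝[>] 0) (𝓝 0)) :
    R (k ^ 2 • mη.toLp η + mg.toLp g) = mη.toLp η :=
  Lp.ext ((resolvent_apply_ae_eq hR hm hk (hη.besselPotential k) ((mη.const_smul (k ^ 2)).add mg)
    htop hzero).trans mη.coeFn_toLp.symm)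

end ForcedSolution

theorem resolvent_apply_of_mem_coreGraph {m k : ℂ} {R : L2 →L[ℂ] L2}
    (hR : HasIntegralKernel R (resolventKernel m k)) (hm : -1 < m.re) (hk : 0 < k.re)
    {p : L2 × L2} (hp : p ∈ coreGraph (m ^ 2)) : R (k ^ 2 • p.1 + p.2) = p.1 := by
  obtain ⟨φ, h₁, h₂⟩ := hp
  rw [← Lp.toLp_coeFn p.1 (Lp.memLp _), ← Lp.toLp_coeFn p.2 (Lp.memLp _),
    MemLp.toLp_congr _ (memLp_testFunction φ) h₁, MemLp.toLp_congr _ (memLp_diffExpr φ _) h₂]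
  exact (isForcedSolution_testFunction φ (m ^ 2)).resolvent_apply _ _ hR hm hk
    (testFunction_eventually_eq_zero_atTop φ) (tendsto_zero_of_eventually_eq_zero
      (nhdsWithin_le_nhds (testFunction_eventually_eq_zero_nhds_zero φ)))

/-! ### The boundary function `x^{1/2+m} ξ` -/

section Boundary

variable {m k : ℂ} {ξ : ℝ → ℝ}

/-- The function `x^{1/2+m} ξ` spanning the boundary line. -/
def bdry (m : ℂ) (ξ : ℝ → ℝ) (x : ℝ) : ℂ := (x : ℂ) ^ (1 / 2 + m) * (ξ x : ℂ)

/-- The derivative of `bdry m ξ`. -/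
def bdry' (m : ℂ) (ξ : ℝ → ℝ) (x : ℝ) : ℂ :=
  (x : ℂ) ^ (1 / 2 + m) * ((1 / 2 + m) / x * (ξ x : ℂ) + ((deriv ξ x : ℝ) : ℂ))

/-- The image of `bdry m ξ` under the differential expression `L_{m²}`; the terms in which `ξ` is
not differentiated cancel because `x^{1/2+m}` is a homogeneous solution. -/
def bdryImage (m : ℂ) (ξ : ℝ → ℝ) (x : ℝ) : ℂ :=
  -((x : ℂ) ^ (1 / 2 + m) *
    (2 * (1 / 2 + m) / x * ((deriv ξ x : ℝ) : ℂ) + ((deriv (deriv ξ) x : ℝ) : ℂ)))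

namespace IsCutoff

theorem contDiff_deriv (hξ : IsCutoff ξ) : ContDiff ℝ ∞ (deriv ξ) :=
  (contDiff_infty_iff_deriv.1 hξ.1).2

theorem continuous_deriv_deriv (hξ : IsCutoff ξ) : Continuous (deriv (deriv ξ)) :=
  (contDiff_infty_iff_deriv.1 hξ.contDiff_deriv).2.continuous

theorem exists_eq_one (hξ : IsCutoff ξ) :
    ∃ δ > 0, ∀ x, 0 < x → x < δ → ξ x = 1 ∧ deriv ξ x = 0 ∧ deriv (deriv ξ) x = 0 := by
  have h0 : ξ =ᶠ[𝓝 0] fun _ => 1 := hξ.2.2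
  have h1 : deriv ξ =ᶠ[𝓝 0] fun _ => 0 := h0.deriv.trans (by simp)
  have h2 : deriv (deriv ξ) =ᶠ[𝓝 0] fun _ => 0 := h1.deriv.trans (by simp)
  obtain ⟨δ, hδ, h⟩ := Metric.eventually_nhds_iff.1 (h0.and (h1.and h2))
  exact ⟨δ, hδ, fun x hx hxδ => h (by rwa [Real.dist_0_eq_abs, abs_of_pos hx])⟩

theorem exists_eq_zero (hξ : IsCutoff ξ) :
    ∃ T > 0, ∀ x, T < x → ξ x = 0 ∧ deriv ξ x = 0 ∧ deriv (deriv ξ) x = 0 := by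
  have hξ0 := eventually_eq_zero_atTop_of_hasCompactSupport hξ.2.1
  have hξ1 := eventually_eq_zero_atTop_of_hasCompactSupport hξ.2.1.deriv
  have hξ2 := eventually_eq_zero_atTop_of_hasCompactSupport hξ.2.1.deriv.deriv
  obtain ⟨T, hT⟩ := eventually_atTop.1 (hξ0.and (hξ1.and hξ2))
  exact ⟨max T 1, by positivity, fun x hx => hT x ((le_max_left _ _).trans hx.le)⟩

end IsCutoff

theorem hasDerivAt_ofReal_cpow (a : ℂ) {x : ℝ} (hx : 0 < x) :
    HasDerivAt (fun x : ℝ => (x : ℂ) ^ a) (a / x * (x : ℂ) ^ a) x := by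
  have hx0 : (x : ℂ) ≠ 0 := Complex.ofReal_ne_zero.2 hx.ne'
  refine ((hasDerivAt_id (x : ℂ)).cpow_const (c := a)
    (Or.inl (by simpa using hx))).comp_ofReal.congr_deriv ?_
  rw [id, Complex.cpow_sub _ _ hx0, Complex.cpow_one]
  ring

theorem isForcedSolution_bdry (m : ℂ) (hξ : IsCutoff ξ) :
    IsForcedSolution (inverseSquarePotential (m ^ 2)) (bdryImage m ξ) (bdry m ξ) (bdry' m ξ) := by
  intro x hx
  have hx0 : (x : ℂ) ≠ 0 := Complex.ofReal_ne_zero.2 hx.ne'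
  have hcpow := hasDerivAt_ofReal_cpow (1 / 2 + m) hx
  have h := (hξ.1.differentiable (by simp) x).hasDerivAt.ofReal_comp
  have h' := (hξ.contDiff_deriv.differentiable (by simp) x).hasDerivAt.ofReal_comp
  have hinv : HasDerivAt (fun x : ℝ => (1 / 2 + m) / (x : ℂ))
      (((0 : ℂ) * x - (1 / 2 + m) * 1) / (x : ℂ) ^ 2) x :=
    (hasDerivAt_const x (1 / 2 + m)).div (hasDerivAt_id x).ofReal_comp hx0
  refine ⟨(hcpow.mul h).congr_deriv ?_, (hcpow.mul ((hinv.mul h).add h')).congr_deriv ?_⟩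
  · rw [bdry']
    ring
  · simp only [bdryImage, bdry, inverseSquarePotential, Pi.add_apply, Pi.mul_apply]
    field_simp
    ring

theorem eventually_bdry_eq_zero (m : ℂ) (hξ : IsCutoff ξ) :
    ∀ᶠ x in atTop, bdry m ξ x = 0 ∧ bdry' m ξ x = 0 := by
  obtain ⟨T, -, hT⟩ := hξ.exists_eq_zero
  filter_upwards [eventually_gt_atTop T] with x hx
  obtain ⟨h1, h2, -⟩ := hT x hx
  simp [bdry, bdry', h1, h2]

theorem continuousOn_ofReal_cpow (a : ℂ) : ContinuousOn (fun x : ℝ => (x : ℂ) ^ a) (Ioi 0) :=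
  fun _ hx => (hasDerivAt_ofReal_cpow a hx).continuousAt.continuousWithinAt

theorem continuousOn_bdryImage (m : ℂ) (hξ : IsCutoff ξ) :
    ContinuousOn (bdryImage m ξ) (Ioi 0) := by
  have h1 := hξ.contDiff_deriv.continuous
  have h2 := hξ.continuous_deriv_deriv
  have h3 : ContinuousOn (fun x : ℝ => 2 * (1 / 2 + m) / (x : ℂ)) (Ioi 0) :=
    continuousOn_const.div Complex.continuous_ofReal.continuousOn fun x hx =>
      Complex.ofReal_ne_zero.2 (ne_of_gt hx)
  exact ((continuousOn_ofReal_cpow _).mul ((h3.mul (by fun_prop)).add (by fun_prop))).neg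

theorem memLp_halfMeasure_of_forall_notMem {f : ℝ → ℂ} {S : Set ℝ} (hS : MeasurableSet S)
    (hf : MemLp f 2 (volume.restrict S)) (h0 : ∀ x, 0 < x → x ∉ S → f x = 0) :
    MemLp f 2 halfMeasure := by
  refine ((memLp_indicator_iff_restrict hS).2
    (hf.mono_measure (Measure.restrict_mono_measure Measure.restrict_le_self S))).ae_eq ?_
  filter_upwards [ae_restrict_mem measurableSet_Ioi] with x hx
  by_cases hxS : x ∈ S
  · exact indicator_of_mem hxS f
  · rw [indicator_of_notMem hxS, h0 x hx hxS]

theorem memLp_bdryImage (m : ℂ) (hξ : IsCutoff ξ) : MemLp (bdryImage m ξ) 2 halfMeasure := by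
  obtain ⟨δ, hδ0, hδ⟩ := hξ.exists_eq_one
  obtain ⟨T, -, hT⟩ := hξ.exists_eq_zero
  have hcont : ContinuousOn (bdryImage m ξ) (Icc δ T) :=
    (continuousOn_bdryImage m hξ).mono fun x hx => hδ0.trans_le hx.1
  obtain ⟨C, hC⟩ := isCompact_Icc.exists_bound_of_continuousOn hcont
  refine memLp_halfMeasure_of_forall_notMem measurableSet_Icc
    (MemLp.of_bound (hcont.aestronglyMeasurable measurableSet_Icc) C
      ((ae_restrict_mem measurableSet_Icc).mono hC)) fun x hx hxS => ?_
  have hderiv : deriv ξ x = 0 ∧ deriv (deriv ξ) x = 0 := by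
    by_cases hxδ : x < δ
    · exact (hδ x hx hxδ).2
    · exact (hT x (not_le.1 fun hxT => hxS ⟨not_lt.1 hxδ, hxT⟩)).2
  simp [bdryImage, hderiv.1, hderiv.2]

theorem memLp_ofReal_cpow {a : ℂ} (ha : -(1 / 2) < a.re) {T : ℝ} (hT : 0 < T) :
    MemLp (fun x : ℝ => (x : ℂ) ^ a) 2 (volume.restrict (Ioo 0 T)) := by
  rw [memLp_two_iff_integrable_sq_norm (((continuousOn_ofReal_cpow a).mono
    Ioo_subset_Ioi_self).aestronglyMeasurable measurableSet_Ioo)]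
  refine ((intervalIntegral.integrableOn_Ioo_rpow_iff (s := 2 * a.re) hT).2 (by linarith)).congr_fun
    (fun x hx => ?_) measurableSet_Ioo
  simp only
  rw [Complex.norm_cpow_eq_rpow_re_of_pos hx.1, ← Real.rpow_natCast, ← Real.rpow_mul hx.1.le,
    mul_comm]
  norm_cast

theorem memLp_bdry (hm : -1 < m.re) (hξ : IsCutoff ξ) : MemLp (bdry m ξ) 2 halfMeasure := by
  obtain ⟨T, hT0, hT⟩ := hξ.exists_eq_zero
  obtain ⟨C, hC⟩ := hξ.2.1.exists_bound_of_continuous hξ.1.continuous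
  have hcut : MemLp (fun x => (ξ x : ℂ)) ⊤ (volume.restrict (Ioo 0 (T + 1))) :=
    memLp_top_of_bound (Complex.continuous_ofReal.comp hξ.1.continuous).aestronglyMeasurable C
      (Eventually.of_forall fun x => (Complex.norm_real _).trans_le (hC x))
  have hpow : MemLp (fun x : ℝ => (x : ℂ) ^ (1 / 2 + m)) 2 (volume.restrict (Ioo 0 (T + 1))) :=
    memLp_ofReal_cpow (by simp; linarith) (by linarith)
  refine memLp_halfMeasure_of_forall_notMem measurableSet_Ioo (hcut.mul' hpow) fun x hx hxS => ?_
  rw [bdry, (hT x (by by_contra! h; exact hxS ⟨hx, by linarith⟩)).1, Complex.ofReal_zero, mul_zero]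

theorem solI_cpow_wronskian (m : ℂ) (hk : 0 < k.re) {x : ℝ} (hx : 0 < x) :
    solI' m k x * (x : ℂ) ^ (1 / 2 + m) -
        solI m k x * ((1 / 2 + m) / x * (x : ℂ) ^ (1 / 2 + m)) =
      (k / 2) ^ m * (k ^ 2 / 2) * ((x : ℂ) ^ (1 / 2 + m) * (x * (x : ℂ) ^ (1 / 2 + m))) *
        hyp01 (m + 2) (k ^ 2 * x ^ 2 / 4) := by
  have hsq : HasDerivAt (fun x : ℝ => k ^ 2 * (x : ℂ) ^ 2 / 4) (k ^ 2 * x / 2) x := by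
    refine ((((hasDerivAt_id x).ofReal_comp.pow 2).const_mul (k ^ 2)).div_const 4).congr_deriv ?_
    simp only [id, Complex.ofReal_one]
    push_cast
    ring
  have hhyp : HasDerivAt (fun x : ℝ => hyp01 (m + 1) (k ^ 2 * x ^ 2 / 4))
      (hyp01 (m + 2) (k ^ 2 * x ^ 2 / 4) * (k ^ 2 * x / 2)) x := by
    have h := hasDerivAt_hyp01 (m + 1) (k ^ 2 * (x : ℂ) ^ 2 / 4)
    rw [add_assoc, one_add_one_eq_two] at h
    exact h.comp x hsq
  have hI := (((hasDerivAt_ofReal_cpow (1 / 2 + m) hx).mul hhyp).const_mul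
    ((k / 2) ^ m)).congr_of_eventuallyEq (f₁ := solI m k)
      ((eventually_gt_nhds hx).mono fun y hy => solI_eq_cpow_mul_hyp01 m hk hy)
  rw [((isSolution_solI m hk) x hx).1.unique hI, solI_eq_cpow_mul_hyp01 m hk hx]
  ring

theorem eventually_bdry_eq_cpow (m : ℂ) (hξ : IsCutoff ξ) :
    ∀ᶠ x : ℝ in 𝓝[>] 0, bdry m ξ x = (x : ℂ) ^ (1 / 2 + m) ∧
      bdry' m ξ x = (1 / 2 + m) / x * (x : ℂ) ^ (1 / 2 + m) := by
  obtain ⟨δ, hδ0, hδ⟩ := hξ.exists_eq_one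
  filter_upwards [Ioo_mem_nhdsGT hδ0] with x hx
  obtain ⟨h0, h1, -⟩ := hδ x hx.1 hx.2
  constructor
  · rw [bdry, h0, Complex.ofReal_one, mul_one]
  · rw [bdry', h0, h1, Complex.ofReal_one, Complex.ofReal_zero, mul_one, add_zero, mul_comm]

theorem tendsto_rpow_nhdsGT_zero {p : ℝ} (hp : 0 < p) :
    Tendsto (fun x : ℝ => x ^ p) (𝓝[>] 0) (𝓝 0) := by
  have hcont : ContinuousAt (fun x : ℝ => x ^ p) 0 :=
    Real.continuousAt_rpow_const _ _ (Or.inr hp.le)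
  simpa only [Real.zero_rpow hp.ne'] using hcont.tendsto.mono_left nhdsWithin_le_nhds

theorem tendsto_hyp01_mul_sq (c k : ℂ) :
    Tendsto (fun x : ℝ => hyp01 c (k ^ 2 * x ^ 2 / 4)) (𝓝[>] 0) (𝓝 (Complex.Gamma c)⁻¹) := by
  have hcont : Continuous fun x : ℝ => hyp01 c (k ^ 2 * x ^ 2 / 4) :=
    (continuous_hyp01 c).comp (by fun_prop)
  simpa [hyp01_zero] using (hcont.tendsto 0).mono_left (nhdsWithin_le_nhds (s := Ioi 0))

theorem norm_cpow_mul_mul_cpow (m : ℂ) {x : ℝ} (hx : 0 < x) :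
    ‖(x : ℂ) ^ (1 / 2 + m) * (x * (x : ℂ) ^ (1 / 2 + m))‖ = x ^ (2 + 2 * m.re) := by
  rw [norm_mul, norm_mul, Complex.norm_cpow_eq_rpow_re_of_pos hx, Complex.norm_real,
    Real.norm_of_nonneg hx.le, Complex.add_re, Complex.div_ofNat_re, Complex.one_re,
    show 2 + 2 * m.re = (1 / 2 + m.re) + (1 + (1 / 2 + m.re)) by ring, Real.rpow_add hx _ (1 + _),
    Real.rpow_add hx 1, Real.rpow_one]

theorem tendsto_wronskian_bdry (hm : -1 < m.re) (hk : 0 < k.re) (hξ : IsCutoff ξ) :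
    Tendsto (fun x => solI' m k x * bdry m ξ x - solI m k x * bdry' m ξ x) (𝓝[>] 0) (𝓝 0) := by
  have hpow : Tendsto (fun x : ℝ => (x : ℂ) ^ (1 / 2 + m) * (x * (x : ℂ) ^ (1 / 2 + m)))
      (𝓝[>] 0) (𝓝 0) := by
    rw [tendsto_zero_iff_norm_tendsto_zero]
    refine (tendsto_rpow_nhdsGT_zero (p := 2 + 2 * m.re) (by linarith)).congr' ?_
    filter_upwards [self_mem_nhdsWithin] with x hx
    rw [norm_cpow_mul_mul_cpow m hx]
  have hlim := (hpow.const_mul ((k / 2) ^ m * (k ^ 2 / 2))).mul (tendsto_hyp01_mul_sq (m + 2) k)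
  rw [mul_zero, zero_mul] at hlim
  refine hlim.congr' ?_
  filter_upwards [self_mem_nhdsWithin, eventually_bdry_eq_cpow m hξ] with x hx hbdry
  rw [hbdry.1, hbdry.2, solI_cpow_wronskian m hk hx]

end Boundary

/-! ### The graph of `H_m` -/

section Graph

theorem mem_graph_domRestrict {R E F : Type*} [Ring R] [AddCommGroup E] [Module R E]
    [AddCommGroup F] [Module R F] (f : E →ₗ.[R] F) (S : Submodule R E) (p : E × F) :
    p ∈ (f.domRestrict S).graph ↔ p ∈ f.graph ∧ p.1 ∈ S := by
  constructor
  · intro hp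
    exact ⟨LinearPMap.le_graph_of_le LinearPMap.domRestrict_le hp,
      (LinearPMap.mem_domain_of_mem_graph hp).1⟩
  · rintro ⟨hp, hpS⟩
    obtain ⟨v, hv₁, hv₂⟩ := (LinearPMap.mem_graph_iff _).1 hp
    exact (LinearPMap.mem_graph_iff _).2
      ⟨⟨p.1, hpS, hv₁ ▸ v.2⟩, rfl, (LinearPMap.domRestrict_apply hv₁.symm).trans hv₂⟩

theorem mem_iff_mem_maxGraph_of_le {α : ℂ} {S : Submodule ℂ (L2 × L2)} (hS : S ≤ maxGraph α)
    {p : L2 × L2} : p ∈ S ↔ p ∈ maxGraph α ∧ p.1 ∈ S.map (LinearMap.fst ℂ L2 L2) := by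
  refine ⟨fun hp => ⟨hS hp, p, hp, rfl⟩, ?_⟩
  rintro ⟨hp, q, hq, hqp⟩
  have hfst : (p - q).1 = 0 := sub_eq_zero.2 hqp.symm
  have hsnd := maxGraph_single_valued α _ (sub_mem hp (hS hq)) hfst
  rwa [sub_eq_zero.1 (Prod.ext hfst hsnd : p - q = 0)]

variable {m k : ℂ} {ξ : ℝ → ℝ}

/-- The boundary function `x^{1/2+m} ξ` paired with its image under `L_{m²}`. -/
def bdryPair (hm : -1 < m.re) (hξ : IsCutoff ξ) : L2 × L2 :=
  ((memLp_bdry hm hξ).toLp _, (memLp_bdryImage m hξ).toLp _)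

/-- The graph of `H_m`, as the sum of the graph of `L_{m²}^min` and a line. -/
def graphH (hm : -1 < m.re) (hξ : IsCutoff ξ) : Submodule ℂ (L2 × L2) :=
  (coreGraph (m ^ 2)).topologicalClosure ⊔ Submodule.span ℂ {bdryPair hm hξ}

theorem isClosed_graphH (hm : -1 < m.re) (hξ : IsCutoff ξ) :
    IsClosed (graphH hm hξ : Set (L2 × L2)) :=
  Submodule.isClosed_sup_finiteDimensional _ _ (Submodule.isClosed_topologicalClosure _)

theorem graphH_le_maxGraph (hm : -1 < m.re) (hξ : IsCutoff ξ) :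
    graphH hm hξ ≤ maxGraph (m ^ 2) :=
  sup_le (closure_coreGraph_le_maxGraph _) ((Submodule.span_singleton_le_iff_mem _ _).2
    ((isForcedSolution_bdry m hξ).toLp_mem_maxGraph _ _))

theorem boundaryLine_eq (hm : -1 < m.re) (hξ : IsCutoff ξ) :
    boundaryLine m ξ = Submodule.span ℂ {(bdryPair hm hξ).1} := by
  have hbdry := (memLp_bdry hm hξ).coeFn_toLp
  refine congrArg (Submodule.span ℂ) (Set.ext fun u => ?_)
  exact ⟨fun h => Lp.ext (EventuallyEq.trans h hbdry.symm), fun h => mem_singleton_iff.1 h ▸ hbdry⟩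

theorem map_fst_graphH (hm : -1 < m.re) (hξ : IsCutoff ξ) :
    (graphH hm hξ).map (LinearMap.fst ℂ L2 L2) = (LMin (m ^ 2)).domain ⊔ boundaryLine m ξ := by
  rw [graphH, Submodule.map_sup, Submodule.map_span, image_singleton, boundaryLine_eq hm hξ]
  rfl

theorem H_graph (hm : -1 < m.re) (hξ : IsCutoff ξ) : (H m ξ).graph = graphH hm hξ := by
  ext p
  rw [H, mem_graph_domRestrict, LMax_graph, mem_iff_mem_maxGraph_of_le (graphH_le_maxGraph hm hξ),
    map_fst_graphH]

theorem resolvent_apply_of_mem_graphH {R : L2 →L[ℂ] L2}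
    (hR : HasIntegralKernel R (resolventKernel m k)) (hm : -1 < m.re) (hk : 0 < k.re)
    (hξ : IsCutoff ξ) {p : L2 × L2} (hp : p ∈ graphH hm hξ) : R (k ^ 2 • p.1 + p.2) = p.1 := by
  let T : L2 × L2 →L[ℂ] L2 :=
    R.comp (k ^ 2 • ContinuousLinearMap.fst ℂ L2 L2 + ContinuousLinearMap.snd ℂ L2 L2)
  let S := (T : L2 × L2 →ₗ[ℂ] L2).eqLocus (LinearMap.fst ℂ L2 L2)
  have hclosed : IsClosed (S : Set (L2 × L2)) := isClosed_eq T.continuous continuous_fst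
  have hcore : (coreGraph (m ^ 2)).topologicalClosure ≤ S :=
    Submodule.topologicalClosure_minimal _
      (fun _ hq => resolvent_apply_of_mem_coreGraph hR hm hk hq) hclosed
  have hbdry : bdryPair hm hξ ∈ S :=
    (isForcedSolution_bdry m hξ).resolvent_apply (memLp_bdry hm hξ) (memLp_bdryImage m hξ) hR hm hk
      (eventually_bdry_eq_zero m hξ) (tendsto_wronskian_bdry hm hk hξ)
  exact sup_le hcore ((Submodule.span_singleton_le_iff_mem _ _).2 hbdry) hp

end Graph

/-! ### Weak solutions -/

section Distributions

theorem integrableOn_mul_testFunction {w : ℝ → ℂ} (hw : LocallyIntegrableOn w (Ioi 0))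
    (φ : 𝓓(halfLine, ℂ)) : IntegrableOn (fun x => w x * φ x) (Ioi 0) := by
  have hK : IsCompact (tsupport φ) := φ.hasCompactSupport'
  have hint : IntegrableOn (fun x => w x * φ x) (tsupport φ) :=
    (hw.integrableOn_compact_subset φ.tsupport_subset' hK).mul_continuousOn
      (testFunction_contDiff φ).continuous.continuousOn hK
  exact ((integrableOn_iff_integrable_of_support_subset
    ((Function.support_mul_subset_right w φ).trans (subset_tsupport φ))).1 hint).integrableOn

/-- The distribution on `(0, ∞)` given by a locally integrable function. -/
def pairing {w : ℝ → ℂ} (hw : LocallyIntegrableOn w (Ioi 0)) : 𝓓(halfLine, ℂ) →ₗ[ℂ] ℂ where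
  toFun φ := ∫ x in Ioi (0 : ℝ), w x * φ x
  map_add' φ ψ := by
    rw [← integral_add (integrableOn_mul_testFunction hw φ) (integrableOn_mul_testFunction hw ψ)]
    exact integral_congr_ae (Eventually.of_forall fun x => mul_add _ _ _)
  map_smul' c φ := by
    rw [RingHom.id_apply, smul_eq_mul, ← integral_const_mul]
    exact integral_congr_ae (Eventually.of_forall fun x => mul_left_comm _ _ _)

theorem ae_eq_zero_of_forall_integral_testFunction_eq_zero {w : ℝ → ℂ}
    (hw : LocallyIntegrableOn w (Ioi 0))
    (h : ∀ φ : 𝓓(halfLine, ℂ), ∫ x in Ioi (0 : ℝ), w x * φ x = 0) : w =ᵐ[halfMeasure] 0 := by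
  refine (ae_restrict_iff' measurableSet_Ioi).2
    (isOpen_Ioi.ae_eq_zero_of_integral_contDiff_smul_eq_zero hw fun u hu hc hs => ?_)
  let φ : 𝓓(halfLine, ℂ) :=
    { toFun := fun x => (u x : ℂ)
      contDiff' := Complex.ofRealCLM.contDiff.comp hu
      hasCompactSupport' := hc.comp_left (g := fun t : ℝ => (t : ℂ)) Complex.ofReal_zero
      tsupport_subset' :=
        (tsupport_comp_subset (g := fun t : ℝ => (t : ℂ)) Complex.ofReal_zero u).trans hs }
  rw [← h φ, setIntegral_eq_integral_of_forall_compl_eq_zero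
    fun x hx => by rw [testFunction_eq_zero φ hx, mul_zero]]
  exact integral_congr_ae (Eventually.of_forall fun x => Complex.real_smul.trans (mul_comm _ _))

theorem ae_eq_combination_of_pairing_eq {u v h : ℝ → ℂ} (hu : LocallyIntegrableOn u (Ioi 0))
    (hv : LocallyIntegrableOn v (Ioi 0)) (hh : LocallyIntegrableOn h (Ioi 0)) {a b : ℂ}
    (hab : a • pairing hu + b • pairing hv = pairing hh) :
    h =ᵐ[halfMeasure] fun x => a * u x + b * v x := by
  refine (ae_eq_zero_of_forall_integral_testFunction_eq_zero
    (hh.sub ((hu.smul a).add (hv.smul b))) fun φ => ?_).mono fun x hx => sub_eq_zero.1 hx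
  have hcomb : a * (∫ x in Ioi (0 : ℝ), u x * φ x) + b * (∫ x in Ioi (0 : ℝ), v x * φ x) =
      ∫ x in Ioi (0 : ℝ), h x * φ x := LinearMap.congr_fun hab φ
  have hint_u := (integrableOn_mul_testFunction hu φ).const_mul a
  have hint_v := (integrableOn_mul_testFunction hv φ).const_mul b
  have hint : Integrable (fun x => a * (u x * φ x) + b * (v x * φ x)) (volume.restrict (Ioi 0)) :=
    hint_u.add hint_v
  rw [← sub_eq_zero.2 hcomb.symm, ← integral_const_mul, ← integral_const_mul,
    ← integral_add hint_u hint_v, ← integral_sub (integrableOn_mul_testFunction hh φ) hint]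
  refine integral_congr_ae (Eventually.of_forall fun x => ?_)
  simp only [Pi.sub_apply, Pi.add_apply, Pi.smul_apply, smul_eq_mul]
  ring

end Distributions

section Support

variable {f : ℝ → ℂ} {δ T : ℝ}

theorem contDiff_of_contDiffOn_Ioi_zero (hf : ContDiffOn ℝ ∞ f (Ioi 0)) (hδ : 0 < δ)
    (hsupp : ∀ x ∉ Icc δ T, f x = 0) : ContDiff ℝ ∞ f := by
  rw [contDiff_iff_contDiffAt]
  intro x
  rcases lt_or_ge x δ with hx | hx
  · refine (contDiffAt_const (c := (0 : ℂ))).congr_of_eventuallyEq ?_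
    filter_upwards [Iio_mem_nhds hx] with y hy using hsupp y fun h => not_le.2 hy h.1
  · exact hf.contDiffAt (Ioi_mem_nhds (hδ.trans_le hx))

theorem exists_testFunction_coe_eq (hf : ContDiffOn ℝ ∞ f (Ioi 0)) (hδ : 0 < δ)
    (hsupp : ∀ x ∉ Icc δ T, f x = 0) : ∃ φ : 𝓓(halfLine, ℂ), ⇑φ = f := by
  have hIcc : tsupport f ⊆ Icc δ T := closure_minimal
    (fun x hx => by_contra fun h => hx (hsupp x h)) isClosed_Icc
  exact ⟨{
    toFun := f
    contDiff' := contDiff_of_contDiffOn_Ioi_zero hf hδ hsupp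
    hasCompactSupport' := isCompact_Icc.of_isClosed_subset (isClosed_tsupport _) hIcc
    tsupport_subset' := hIcc.trans fun x hx => hδ.trans_le hx.1 }, rfl⟩

theorem exists_forall_notMem_Icc_testFunction_eq_zero (ψ : 𝓓(halfLine, ℂ)) :
    ∃ δ T : ℝ, 0 < δ ∧ ∀ x ∉ Icc δ T, ψ x = 0 := by
  obtain ⟨δ, hδ, hzero⟩ := Metric.eventually_nhds_iff.1
    (testFunction_eventually_eq_zero_nhds_zero ψ)
  obtain ⟨T, htop⟩ := eventually_atTop.1 (testFunction_eventually_eq_zero_atTop ψ)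
  refine ⟨δ, T, hδ, fun x hx => ?_⟩
  by_cases hx0 : 0 < x
  · rcases lt_or_ge x δ with hxδ | hxδ
    · exact (hzero (by rwa [Real.dist_0_eq_abs, abs_of_pos hx0])).1
    · exact (htop x (not_le.1 fun h => hx ⟨hxδ, h⟩).le).1
  · exact testFunction_eq_zero ψ hx0

theorem intervalIntegral_eq_zero_of_integral_Ioi_eq_zero (hδ : 0 < δ)
    (hsupp : ∀ x ∉ Icc δ T, f x = 0) (hint : ∫ x in Ioi (0 : ℝ), f x = 0) :
    ∀ x ∉ Icc δ T, ∫ y in (0 : ℝ)..x, f y = 0 := by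
  intro x hx
  rcases lt_or_ge x δ with hxδ | hxδ
  · refine intervalIntegral.integral_zero_ae (Eventually.of_forall fun y hy => hsupp y fun h => ?_)
    exact (hy.2.trans_lt (max_lt hδ hxδ)).not_ge h.1
  · have hTx : T < x := not_le.1 fun h => hx ⟨hxδ, h⟩
    rw [intervalIntegral.integral_of_le (hδ.le.trans hxδ), ← hint]
    refine (setIntegral_eq_of_subset_of_forall_sdiff_eq_zero measurableSet_Ioi
      Ioc_subset_Ioi_self fun y hy => hsupp y fun h => ?_).symm
    exact hy.2 ⟨hy.1, h.2.trans hTx.le⟩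

end Support

theorem contDiff_primitive {g : ℝ → ℂ} (hg : ContDiff ℝ ∞ g) :
    ContDiff ℝ ∞ fun x => ∫ y in (0 : ℝ)..x, g y := by
  have hderiv := hg.continuous.deriv_integral g 0
  exact contDiff_infty_iff_deriv.2
    ⟨fun x => (hg.continuous.integral_hasStrictDerivAt 0 x).hasDerivAt.differentiableAt,
      by rwa [funext hderiv]⟩

section FundamentalSystem

variable {q u u₁ v v₁ : ℝ → ℂ}

theorem IsForcedSolution.mul_sub_deriv_deriv_eq {g η η₁ : ℝ → ℂ} (hη : IsForcedSolution q g η η₁)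
    {x : ℝ} (hx : 0 < x) : q x * η x - deriv (deriv η) x = g x := by
  have hderiv : deriv η =ᶠ[𝓝 x] η₁ := by
    filter_upwards [Ioi_mem_nhds hx] with y hy using (hη y hy).1.deriv
  rw [hderiv.deriv_eq, (hη x hx).2.deriv, sub_sub_cancel]

theorem IsSolution.isForcedSolution_variation (hu : IsSolution q u u₁) (hv : IsSolution q v v₁)
    (hW : ∀ x, 0 < x → u₁ x * v x - u x * v₁ x = 1) {g A B : ℝ → ℂ}
    (hA : ∀ x, 0 < x → HasDerivAt A (u x * g x) x) (hB : ∀ x, 0 < x → HasDerivAt B (v x * g x) x) :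
    IsForcedSolution q g (fun x => v x * A x - u x * B x)
      (fun x => v₁ x * A x - u₁ x * B x) := fun x hx => by
  constructor
  · refine (((hv x hx).1.mul (hA x hx)).sub ((hu x hx).1.mul (hB x hx))).congr_deriv ?_
    ring
  · refine (((hv x hx).2.mul (hA x hx)).sub ((hu x hx).2.mul (hB x hx))).congr_deriv ?_
    linear_combination (-g x) * hW x hx

theorem IsSolution.exists_testFunction (hu : IsSolution q u u₁) (hv : IsSolution q v v₁)
    (hW : ∀ x, 0 < x → u₁ x * v x - u x * v₁ x = 1) (hq : ContDiffOn ℝ ∞ q (Ioi 0))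
    (ψ : 𝓓(halfLine, ℂ)) (hψu : ∫ x in Ioi (0 : ℝ), u x * ψ x = 0)
    (hψv : ∫ x in Ioi (0 : ℝ), v x * ψ x = 0) :
    ∃ φ : 𝓓(halfLine, ℂ), ∀ x, 0 < x → q x * φ x - deriv (deriv φ) x = ψ x := by
  obtain ⟨δ, T, hδ, hψ⟩ := exists_forall_notMem_Icc_testFunction_eq_zero ψ
  have hsupp (w : ℝ → ℂ) : ∀ x ∉ Icc δ T, w x * ψ x = 0 := fun x hx => by rw [hψ x hx, mul_zero]
  have hsmooth {w : ℝ → ℂ} (hw : ContDiffOn ℝ ∞ w (Ioi 0)) : ContDiff ℝ ∞ fun x => w x * ψ x :=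
    contDiff_of_contDiffOn_Ioi_zero (hw.mul (testFunction_contDiff ψ).contDiffOn) hδ (hsupp w)
  set A : ℝ → ℂ := fun x => ∫ y in (0 : ℝ)..x, u y * ψ y
  set B : ℝ → ℂ := fun x => ∫ y in (0 : ℝ)..x, v y * ψ y
  have cu := hu.contDiffOn hq
  have cv := hv.contDiffOn hq
  have hΦ : IsForcedSolution q ψ (fun x => v x * A x - u x * B x)
      (fun x => v₁ x * A x - u₁ x * B x) := hu.isForcedSolution_variation hv hW
    (fun x _ => ((hsmooth cu).continuous.integral_hasStrictDerivAt 0 x).hasDerivAt)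
    (fun x _ => ((hsmooth cv).continuous.integral_hasStrictDerivAt 0 x).hasDerivAt)
  obtain ⟨φ, hφ⟩ := exists_testFunction_coe_eq (T := T)
    ((cv.mul (contDiff_primitive (hsmooth cu)).contDiffOn).sub
      (cu.mul (contDiff_primitive (hsmooth cv)).contDiffOn)) hδ fun x hx => by
    rw [intervalIntegral_eq_zero_of_integral_Ioi_eq_zero hδ (hsupp u) hψu x hx,
      intervalIntegral_eq_zero_of_integral_Ioi_eq_zero hδ (hsupp v) hψv x hx, mul_zero, mul_zero,
      sub_zero]
  exact ⟨φ, fun x hx => hφ ▸ hΦ.mul_sub_deriv_deriv_eq hx⟩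

theorem exists_smul_add_smul_eq_of_ker_inf_ker_le {K V : Type*} [Field K] [AddCommGroup V]
    [Module K V] {f g h : V →ₗ[K] K} (hker : f.ker ⊓ g.ker ≤ h.ker) :
    ∃ a b : K, a • f + b • g = h := by
  have hspan : h ∈ Submodule.span K (range ![f, g]) :=
    mem_span_of_iInf_ker_le_ker fun x hx => hker
      ⟨(Submodule.mem_iInf _).1 hx 0, (Submodule.mem_iInf _).1 hx 1⟩
  rwa [Matrix.range_cons_cons_empty, Submodule.mem_span_pair] at hspan

theorem IsSolution.exists_ae_eq_of_weak_solution (hu : IsSolution q u u₁) (hv : IsSolution q v v₁)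
    (hW : ∀ x, 0 < x → u₁ x * v x - u x * v₁ x = 1) (hq : ContDiffOn ℝ ∞ q (Ioi 0))
    {h : ℝ → ℂ} (hh : LocallyIntegrableOn h (Ioi 0))
    (hweak : ∀ φ : 𝓓(halfLine, ℂ),
      ∫ x in Ioi (0 : ℝ), h x * (q x * φ x - deriv (deriv φ) x) = 0) :
    ∃ a b : ℂ, h =ᵐ[halfMeasure] fun x => a * u x + b * v x := by
  have lu := hu.continuousOn.locallyIntegrableOn measurableSet_Ioi (μ := volume)
  have lv := hv.continuousOn.locallyIntegrableOn measurableSet_Ioi (μ := volume)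
  have hker : (pairing lu).ker ⊓ (pairing lv).ker ≤ (pairing hh).ker := by
    rintro ψ ⟨hψu, hψv⟩
    obtain ⟨φ, hφ⟩ := hu.exists_testFunction hv hW hq ψ hψu hψv
    exact (setIntegral_congr_fun measurableSet_Ioi fun x hx => by rw [hφ x hx]).symm.trans (hweak φ)
  obtain ⟨a, b, hab⟩ := exists_smul_add_smul_eq_of_ker_inf_ker_le hker
  exact ⟨a, b, ae_eq_combination_of_pairing_eq lu lv hh hab⟩

end FundamentalSystem

/-! ### Orthogonal complement of the range -/

theorem IsSolution.not_memLp_two {q u u₁ v v₁ : ℝ → ℂ} {C : ℝ} (hu : IsSolution q u u₁)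
    (hv : IsSolution q v v₁) (hW : ∀ x, 0 < x → u₁ x * v x - u x * v₁ x = 1)
    (hbdd : ∀ x, 1 ≤ x → ‖u x * v x‖ ≤ C) (hv₁ : MemLp v₁ 2 (volume.restrict (Ioi 1))) :
    ¬ MemLp u 2 (volume.restrict (Ioi 1)) := by
  intro hu_mem
  have hderiv : ∀ x ∈ Ioi (1 : ℝ),
      HasDerivAt (fun x : ℝ => u x * v x - x) (2 * (u x * v₁ x)) x := fun x hx => by
    have hx0 : 0 < x := one_pos.trans hx
    refine (((hu x hx0).1.mul (hv x hx0).1).sub (hasDerivAt_id x).ofReal_comp).congr_deriv ?_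
    rw [Complex.ofReal_one]
    linear_combination hW x hx0
  have hint : IntegrableOn (fun x => 2 * (u x * v₁ x)) (Ioi 1) :=
    (hu_mem.integrable_mul hv₁).const_mul 2
  have hlim := (tendsto_limUnder_of_hasDerivAt_of_integrableOn_Ioi hderiv hint).norm
  set L := ‖limUnder atTop fun x : ℝ => u x * v x - x‖
  obtain ⟨x, hxL, hx1, hx⟩ := ((hlim.eventually_le_const (lt_add_one L)).and
    ((eventually_ge_atTop 1).and (eventually_gt_atTop (C + (L + 1))))).exists
  have hx_le : x ≤ ‖u x * v x‖ + ‖u x * v x - x‖ := by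
    have h := norm_sub_le (u x * v x) (u x * v x - x)
    rwa [sub_sub_cancel, Complex.norm_real, Real.norm_of_nonneg (by linarith)] at h
  linarith [hbdd x hx1]

section Orthogonal

variable {m k : ℂ} {ξ : ℝ → ℝ}

theorem not_memLp_solI (m : ℂ) (hk : 0 < k.re) :
    ¬ MemLp (solI m k) 2 (volume.restrict (Ioi 1)) := by
  have hIoi := Ioi_subset_Ioi_zero one_pos
  obtain ⟨A, hA0, hA⟩ := exists_norm_solI_le_exp m hk
  obtain ⟨B, -, hB⟩ := exists_norm_solK_le_exp m hk
  obtain ⟨D, -, hD⟩ := exists_norm_solK'_le_exp m hk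
  have hbdd : ∀ x, 1 ≤ x → ‖solI m k x * solK m k x‖ ≤ A * B := fun x hx => by
    calc ‖solI m k x * solK m k x‖
        ≤ A * Real.exp (k.re * x) * (B * Real.exp (-(k.re * x))) := by
          rw [norm_mul]
          gcongr
          exacts [hA x hx, hB x hx]
      _ = A * B := by
          rw [mul_mul_mul_comm, ← Real.exp_add, add_neg_cancel, Real.exp_zero, mul_one]
  exact (isSolution_solI m hk).not_memLp_two (isSolution_solK m hk)
    (fun x hx => solI_solK_wronskian m hk hx) hbdd (memLp_two_of_norm_le_exp hk
      ((isSolution_solK m hk).continuousOn_deriv.mono hIoi) fun x hx => hD x (le_of_lt hx))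

theorem tendsto_solK_mul_cpow (hm : -1 < m.re) (hk : 0 < k.re) :
    Tendsto (fun x : ℝ => solK m k x * (x * (x : ℂ) ^ (1 / 2 + m))) (𝓝[>] 0) (𝓝 0) := by
  obtain ⟨σ, hσ0, hσm, hσ⟩ : ∃ σ : ℝ, 0 < σ ∧ |m.re| ≤ σ ∧ σ < 2 + m.re :=
    ⟨max |m.re| (1 / 2), by positivity, le_max_left _ _,
      max_lt (abs_lt.2 ⟨by linarith, by linarith⟩) (by linarith)⟩
  obtain ⟨C, -, hC⟩ := exists_norm_solK_le_rpow hk hσ0 hσm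
  have hlim := (tendsto_rpow_nhdsGT_zero (p := 2 + m.re - σ) (by linarith)).const_mul C
  rw [mul_zero] at hlim
  refine squeeze_zero_norm' ?_ hlim
  filter_upwards [self_mem_nhdsWithin] with x (hx : 0 < x)
  calc ‖solK m k x * (x * (x : ℂ) ^ (1 / 2 + m))‖
      = ‖solK m k x‖ * (x ^ (1 : ℝ) * x ^ (1 / 2 + m.re)) := by
        rw [norm_mul, norm_mul, Complex.norm_cpow_eq_rpow_re_of_pos hx, Complex.norm_real,
          Real.norm_of_nonneg hx.le, Complex.add_re, Complex.div_ofNat_re, Complex.one_re,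
          Real.rpow_one]
    _ ≤ C * x ^ (1 / 2 - σ) * (x ^ (1 : ℝ) * x ^ (1 / 2 + m.re)) := by
        gcongr
        exact hC x hx
    _ = C * x ^ (2 + m.re - σ) := by
        rw [mul_assoc, ← Real.rpow_add hx, ← Real.rpow_add hx]
        ring_nf

theorem not_tendsto_wronskian_solK_bdry (hm : -1 < m.re) (hk : 0 < k.re) (hξ : IsCutoff ξ) :
    ¬ Tendsto (fun x => solK m k x * bdry' m ξ x - solK' m k x * bdry m ξ x) (𝓝[>] 0) (𝓝 0) := by
  -- Dividing `x^{1/2+m} = K W(I, x^{1/2+m}) - I W(K, x^{1/2+m})` by `x^{1/2+m}` would give `1 → 0`.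
  intro hW
  have hlim := (((tendsto_solK_mul_cpow hm hk).mul (tendsto_hyp01_mul_sq (m + 2) k)).const_mul
    ((k / 2) ^ m * (k ^ 2 / 2))).add
      (((tendsto_hyp01_mul_sq (m + 1) k).const_mul ((k / 2) ^ m)).mul hW)
  simp only [zero_mul, mul_zero, add_zero] at hlim
  refine one_ne_zero (α := ℂ) (tendsto_nhds_unique (Tendsto.congr' ?_ tendsto_const_nhds) hlim)
  filter_upwards [self_mem_nhdsWithin, eventually_bdry_eq_cpow m hξ] with x (hx : 0 < x) hbdry
  have hpow : (x : ℂ) ^ (1 / 2 + m) ≠ 0 :=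
    Complex.cpow_ne_zero_iff.2 (Or.inl (Complex.ofReal_ne_zero.2 hx.ne'))
  rw [hbdry.1, hbdry.2]
  refine mul_left_cancel₀ hpow ?_
  linear_combination -(x : ℂ) ^ (1 / 2 + m) * solI_solK_wronskian m hk hx +
    solK m k x * solI_cpow_wronskian m hk hx +
    (solK m k x * ((1 / 2 + m) / x * (x : ℂ) ^ (1 / 2 + m)) -
      solK' m k x * (x : ℂ) ^ (1 / 2 + m)) * solI_eq_cpow_mul_hyp01 m hk hx

theorem tendsto_wronskian_solK (hk : 0 < k.re) {g η η₁ : ℝ → ℂ}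
    (hη : IsForcedSolution (besselPotential m k) g η η₁) (hg : MemLp g 2 halfMeasure)
    (htop : ∀ᶠ x in atTop, η x = 0 ∧ η₁ x = 0) (hK : MemLp (solK m k) 2 halfMeasure) :
    Tendsto (fun x => solK m k x * η₁ x - solK' m k x * η x) (𝓝[>] 0)
      (𝓝 (∫ x in Ioi (0 : ℝ), solK m k x * g x)) := by
  have hcover : AECover (volume.restrict (Ioi (0 : ℝ))) (𝓝[>] (0 : ℝ)) fun x => Ioi x :=
    aecover_Ioi_of_Ioi (tendsto_id.mono_left nhdsWithin_le_nhds)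
  refine (hcover.integral_tendsto_of_countably_generated (hK.integrable_mul hg)).congr' ?_
  filter_upwards [self_mem_nhdsWithin] with x (hx : 0 < x)
  rw [Measure.restrict_restrict measurableSet_Ioi,
    inter_eq_self_of_subset_left (Ioi_subset_Ioi_zero hx)]
  exact integral_Ioi_solK_mul hk hη hg htop hx

theorem integral_solK_mul_bdry_ne_zero (hm : -1 < m.re) (hk : 0 < k.re) (hξ : IsCutoff ξ)
    (hK : MemLp (solK m k) 2 halfMeasure) :
    ∫ x in Ioi (0 : ℝ), solK m k x * (k ^ 2 * bdry m ξ x + bdryImage m ξ x) ≠ 0 := fun h0 =>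
  not_tendsto_wronskian_solK_bdry hm hk hξ (h0 ▸ tendsto_wronskian_solK hk
    ((isForcedSolution_bdry m hξ).besselPotential k)
    (((memLp_bdry hm hξ).const_smul (k ^ 2)).add (memLp_bdryImage m hξ))
    (eventually_bdry_eq_zero m hξ) hK)

theorem locallyIntegrableOn_of_memLp_two {h : ℝ → ℂ} (hh : MemLp h 2 halfMeasure) :
    LocallyIntegrableOn h (Ioi 0) :=
  locallyIntegrableOn_of_locallyIntegrable_restrict (hh.locallyIntegrable one_le_two)

theorem memLp_of_ae_eq_mul_add {μ : Measure ℝ} {h u v : ℝ → ℂ} {a b : ℂ} (ha : a ≠ 0)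
    (hh : MemLp h 2 μ) (hv : MemLp v 2 μ) (hab : h =ᵐ[μ] fun x => a * u x + b * v x) :
    MemLp u 2 μ := by
  refine ((hh.sub (hv.const_mul b)).const_mul a⁻¹).ae_eq (hab.mono fun x hx => ?_)
  rw [Pi.sub_apply, hx, add_sub_cancel_right, inv_mul_cancel_left₀ ha]

theorem ae_eq_zero_of_orthogonal (hm : -1 < m.re) (hk : 0 < k.re) (hξ : IsCutoff ξ) {h : ℝ → ℂ}
    (hh : MemLp h 2 halfMeasure)
    (htest : ∀ φ : 𝓓(halfLine, ℂ),
      ∫ x in Ioi (0 : ℝ), h x * (k ^ 2 * φ x + diffExpr (m ^ 2) φ x) = 0)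
    (hbdry : ∫ x in Ioi (0 : ℝ), h x * (k ^ 2 * bdry m ξ x + bdryImage m ξ x) = 0) :
    h =ᵐ[halfMeasure] 0 := by
  obtain ⟨a, b, hab⟩ := (isSolution_solI m hk).exists_ae_eq_of_weak_solution (isSolution_solK m hk)
    (fun x hx => solI_solK_wronskian m hk hx) (contDiffOn_besselPotential m k)
    (locallyIntegrableOn_of_memLp_two hh) fun φ => by
      rw [← htest φ]
      refine integral_congr_ae (Eventually.of_forall fun x => ?_)
      simp only [besselPotential, diffExpr]
      ring
  have hle : volume.restrict (Ioi (1 : ℝ)) ≤ halfMeasure :=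
    Measure.restrict_mono (Ioi_subset_Ioi_zero one_pos) le_rfl
  have ha : a = 0 := by_contra fun ha => not_memLp_solI m hk
    (memLp_of_ae_eq_mul_add ha (hh.mono_measure hle) (memLp_solK_Ioi m hk one_pos)
      (ae_mono hle hab))
  have hhK : h =ᵐ[halfMeasure] fun x => b * solK m k x :=
    hab.mono fun x hx => by simp only [hx, ha, zero_mul, zero_add]
  have hb : b = 0 := by
    by_contra hb
    have hK : MemLp (solK m k) 2 halfMeasure :=
      (hh.const_mul b⁻¹).ae_eq (hhK.mono fun x hx => by rw [hx, inv_mul_cancel_left₀ hb])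
    refine integral_solK_mul_bdry_ne_zero hm hk hξ hK ((mul_eq_zero.1 ?_).resolve_left hb)
    rw [← hbdry, ← integral_const_mul]
    exact integral_congr_ae (hhK.mono fun x hx => by simp only [hx, mul_assoc])
  exact hhK.mono fun x hx => by simp only [hx, hb, zero_mul, Pi.zero_apply]

theorem integral_star_mul_eq_inner (g : L2) {w : ℝ → ℂ} (hw : MemLp w 2 halfMeasure) :
    ∫ x in Ioi (0 : ℝ), star (g x) * w x = inner ℂ g (hw.toLp w) := by
  rw [L2.inner_def]
  exact integral_congr_ae (hw.coeFn_toLp.mono fun x hx => by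
    simp only [hx, RCLike.inner_apply', RCLike.star_def])

theorem eq_zero_of_forall_mem_graphH_inner_eq_zero (hm : -1 < m.re) (hk : 0 < k.re)
    (hξ : IsCutoff ξ) {g : L2} (hg : ∀ p ∈ graphH hm hξ, inner ℂ g (k ^ 2 • p.1 + p.2) = 0) :
    g = 0 := by
  have horth {η w : ℝ → ℂ} (hη : MemLp η 2 halfMeasure) (hw : MemLp w 2 halfMeasure)
      (hmem : (hη.toLp η, hw.toLp w) ∈ graphH hm hξ) :
      ∫ x in Ioi (0 : ℝ), star (g x) * (k ^ 2 * η x + w x) = 0 :=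
    (integral_star_mul_eq_inner g ((hη.const_smul (k ^ 2)).add hw)).trans (hg _ hmem)
  have hstar : (fun x => star (g x)) =ᵐ[halfMeasure] 0 :=
    ae_eq_zero_of_orthogonal hm hk hξ (Lp.memLp g).star
      (fun φ => horth (memLp_testFunction φ) (memLp_diffExpr φ (m ^ 2)) (Submodule.mem_sup_left
        (Submodule.le_topologicalClosure _ ⟨φ, (memLp_testFunction φ).coeFn_toLp,
          (memLp_diffExpr φ (m ^ 2)).coeFn_toLp⟩)))
      (horth (memLp_bdry hm hξ) (memLp_bdryImage m hξ)
        (Submodule.mem_sup_right (Submodule.mem_span_singleton_self _)))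
  exact (Lp.eq_zero_iff_ae_eq_zero).2 (hstar.mono fun x hx => star_eq_zero.1 hx)

end Orthogonal

end BesselOp

end

theorem mainTheorem5 (m : ℂ) (hm : -1 < m.re) (ξ : ℝ → ℝ) (hξ : BesselOp.IsCutoff ξ)
    (k : ℂ) (hk : 0 < k.re) :
    ∃ R : BesselOp.L2 →L[ℂ] BesselOp.L2,
      BesselOp.IsBoundedInverse (BesselOp.H m ξ) (k ^ 2) R ∧
      BesselOp.HasIntegralKernel R (BesselOp.resolventKernel m k) := by
  obtain ⟨R, hR⟩ := BesselOp.exists_hasIntegralKernel_resolventKernel hm hk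
  have hgraph := BesselOp.H_graph hm hξ
  refine ⟨R, BesselOp.isBoundedInverse_of_isClosed ?_ (fun p hp => ?_) (fun g hg => ?_), hR⟩
  · rw [LinearPMap.IsClosed, hgraph]
    exact BesselOp.isClosed_graphH hm hξ
  · exact BesselOp.resolvent_apply_of_mem_graphH hR hm hk hξ (hgraph ▸ hp)
  · exact BesselOp.eq_zero_of_forall_mem_graphH_inner_eq_zero hm hk hξ (hgraph ▸ hg)
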